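/- **Setting.** Let $(\Omega,\mathcal A,\mathbb P)$ be a probability space and, for each $n\ge 1$, let $a_n=(a_n(p,q))_{1\le p,q\le n}$ be a symmetric matrix of real random variables; $(a_n)_n$ is called a triangular scheme. Pairs $(p,q)$ and $(p',q')$ are fundamentally different if $\{p,q\}\neq\{p',q'\}$. For $\alpha>0$ the scheme is *$\alpha$-almost uncorrelated* if there are real constants $C_k$, $C^{(l)}_n$ with $\lim_{n\to\infty}C_n^{(l)}=0$ for every $l\ge1$, such that for all $N,l\ge1$, all pairwise fundamentally different pairs $(p_1,q_1),\dots,(p_l,q_l)\in\{1,\dots,N\}^2$ and all $n\ge N$: - (AAU1) for all integers $\delta_1,\dots,\delta_l\ge1$ the following expectation exists and $$\bigl|\mathbb E\, a_n(p_1,q_1)^{\delta_1}\cdots a_n(p_l,q_l)^{\delta_l}\bigr|\le C_{\delta_1+\dots+\delta_l}\, n^{-\alpha\,\#\{i:\delta_i=1\}};$$ - (AAU2) $\bigl|\mathbb E\, a_n(p_1,q_1)^2\cdots a_n(p_l,q_l)^2-1\bigr|\le C_n^{(l)}$. It is *strongly $\alpha$-almost uncorrelated* with constants $C_k,C^{(l)}_n,D^{(l)}_n$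 if moreover $\lim_{n\to\infty}D_n^{(l)}=0$ for every $l\ge1$ and, for the same $N$, $l$, pairs and $n$, - (AAU3) $\bigl|\mathbb E\, a_n(p_1,q_1)^4\bigl(a_n(p_2,q_2)^2\cdots a_n(p_l,q_l)^2-1\bigr)\bigr|\le D_n^{(l)}$. The scheme is a *Wigner scheme* if for every $n$ the family $(a_n(i,j))_{1\le i\le j\le n}$ is independent, all entries have mean $0$ and variance $1$, and for every integer $p\ge1$ one has $\sup_{n}\sup_{i,j\le n}\mathbb E|a_n(i,j)|^p<\infty$. For each $n\ge 1$ let $b_n$ be an $n$-bandwidth, i.e. either $b_n=n$ or $b_n$ is an odd natural number smaller than $n$. A pair $(i,j)\in\{1,\dots,n\}^2$ is $b_n$-relevant if $b_n=n$, or $|i-j|\le\frac{b_n-1}2$, or $|i-j|\ge n-\frac{b_n-1}2$. The periodic random band matrix $X_n$ has entries $X_n(i,j)=b_n^{-1/2}a_n(i,j)$ if $(i,j)$ is $b_n$-relevant and $X_n(i,j)=0$ otherwise. Let $\sigma_n=\frac1n\sum_{i=1}^n\delta_{\lambda_i}$ be the empirical spectral distribution of $X_n$, where $\lambda_1,\dots,\lambda_n$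 are its eigenvalues with multiplicity, and let $\sigma$ be the semicircle distribution, with density $\frac1{2\pi}\sqrt{4-x^2}\,\mathbf 1_{[-2,2]}(x)$. The semicircle law holds for $(X_n)_n$ in probability (resp. almost surely) if for every bounded continuous $f:\mathbb R\to\mathbb R$ one has $\int f\,d\sigma_n\to\int f\,d\sigma$ in probability (resp. almost surely). **Theorem 2.4.** Assume $b_n\to\infty$. 1. If $(a_n)_n$ is $\alpha$-almost uncorrelated with $\alpha\ge\frac12$, then the semicircle law holds for $(X_n)_n$ in probability. 2. If $(a_n)_n$ is $\alpha$-almost uncorrelated with $\alpha\ge\frac12$, all entries are $\{-1,1\}$-valued and $\sum_n b_n^{-3}<\infty$, then the semicircle law holds for $(X_n)_n$ almost surely. 3. If $(a_n)_n$ is strongly $\alpha$-almost uncorrelated with $\alpha>\frac12$ and constants $C_k,C_n^{(l)},D_n^{(l)}$ such that the sequences $b_n^{-2}$, $b_n^{-1}D^{(l)}_n$ and $C^{(l)}_n$ are summable over $n$ for every $l\ge1$, then the semicircle law holds for $(X_n)_n$ almost surely. 4. If $(a_n)_n$ is a Wigner scheme and $\sum_n \frac1{n b_n}<\infty$, then the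 semicircle law holds for $(X_n)_n$ almost surely. -/

import Mathlib

open MeasureTheory ProbabilityTheory Filter Topology
open scoped ENNReal BoundedContinuousFunction

noncomputable section

/-- A triangular scheme: for every `n`, a symmetric `n × n` matrix of real random variables.
The entry `a_n(p,q)` is `a.entry n p q`; indices run through `Fin n` instead of `{1, …, n}`. -/
structure TriangularScheme (Ω : Type*) [MeasurableSpace Ω] where
  entry : (n : ℕ) → Fin n → Fin n → Ω → ℝ
  measurable_entry : ∀ n p q, Measurable (entry n p q)
  symm : ∀ n p q, entry n p q = entry n q p

/-- The pairs `P 0, …, P (l-1)` are (pairwise) fundamentally different, i.e. the unordered pairs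
`{p_i, q_i}` are pairwise distinct. -/
def FundamentallyDifferent {n l : ℕ} (P : Fin l → Fin n × Fin n) : Prop :=
  ∀ i j : Fin l, i ≠ j → s((P i).1, (P i).2) ≠ s((P j).1, (P j).2)

variable {Ω : Type*} [MeasurableSpace Ω]

/-- `a` satisfies the conditions for being `α`-almost uncorrelated with the constants
`K k` (for `C_k`) and `C l n` (for `C_n^{(l)}`). Pairs in a smaller square `[N] × [N]`, `N ≤ n`,
are among the pairs in `[n] × [n]`, so it suffices to quantify over the latter. The existence of
the expectations in `aau1` (hence in `aau2`) is part of the condition. -/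
structure AlmostUncorrelatedWith (μ : Measure Ω) (a : TriangularScheme Ω) (α : ℝ)
    (K : ℕ → ℝ) (C : ℕ → ℕ → ℝ) : Prop where
  alpha_pos : 0 < α
  tendsto_C : ∀ l, 1 ≤ l → Tendsto (fun n => C l n) atTop (𝓝 0)
  aau1 : ∀ (n l : ℕ), 1 ≤ l → ∀ P : Fin l → Fin n × Fin n, FundamentallyDifferent P →
    ∀ δ : Fin l → ℕ, (∀ i, 1 ≤ δ i) →
      Integrable (fun ω => ∏ i, a.entry n (P i).1 (P i).2 ω ^ δ i) μ ∧
      |∫ ω, ∏ i, a.entry n (P i).1 (P i).2 ω ^ δ i ∂μ| ≤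
        K (∑ i, δ i) / (n : ℝ) ^ (α * ((Finset.univ.filter fun i => δ i = 1).card : ℝ))
  aau2 : ∀ (n l : ℕ), 1 ≤ l → ∀ P : Fin l → Fin n × Fin n, FundamentallyDifferent P →
    |(∫ ω, ∏ i, a.entry n (P i).1 (P i).2 ω ^ 2 ∂μ) - 1| ≤ C l n

/-- `a` satisfies the conditions for being strongly `α`-almost uncorrelated with the constants
`K k` (for `C_k`), `C l n` (for `C_n^{(l)}`) and `D l n` (for `D_n^{(l)}`). In `aau3` the number of
pairs is `l = m + 1`, and `P 0` is the distinguished first pair. -/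
structure StronglyAlmostUncorrelatedWith (μ : Measure Ω) (a : TriangularScheme Ω) (α : ℝ)
    (K : ℕ → ℝ) (C D : ℕ → ℕ → ℝ) : Prop extends AlmostUncorrelatedWith μ a α K C where
  tendsto_D : ∀ l, 1 ≤ l → Tendsto (fun n => D l n) atTop (𝓝 0)
  aau3 : ∀ (n m : ℕ) (P : Fin (m + 1) → Fin n × Fin n), FundamentallyDifferent P →
    |∫ ω, a.entry n (P 0).1 (P 0).2 ω ^ 4 *
        ((∏ i : Fin m, a.entry n (P i.succ).1 (P i.succ).2 ω ^ 2) - 1) ∂μ| ≤ D (m + 1) n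

/-- `α`-almost uncorrelated triangular schemes. -/
def AlmostUncorrelated (μ : Measure Ω) (a : TriangularScheme Ω) (α : ℝ) : Prop :=
  ∃ (K : ℕ → ℝ) (C : ℕ → ℕ → ℝ), AlmostUncorrelatedWith μ a α K C

/-- Wigner schemes: independent entries on and above the diagonal, centred, of unit variance, with
uniformly bounded absolute moments. -/
structure IsWignerScheme (μ : Measure Ω) (a : TriangularScheme Ω) : Prop where
  indep : ∀ n, iIndepFun
    (fun (p : {p : Fin n × Fin n // p.1 ≤ p.2}) => a.entry n p.1.1 p.1.2) μ
  mean_zero : ∀ n i j, ∫ ω, a.entry n i j ω ∂μ = 0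
  variance_one : ∀ n i j, variance (a.entry n i j) μ = 1
  moments : ∀ p : ℕ, 1 ≤ p → ∃ B : ℝ, 0 < B ∧ ∀ n i j,
    Integrable (fun ω => |a.entry n i j ω| ^ p) μ ∧ ∫ ω, |a.entry n i j ω| ^ p ∂μ ≤ B

/-- All entries take values in `{-1, 1}`. -/
def SignValued (a : TriangularScheme Ω) : Prop :=
  ∀ n i j ω, a.entry n i j ω = -1 ∨ a.entry n i j ω = 1

/-- `b` is an `n`-bandwidth: an odd number smaller than `n`, or `n` itself. -/
def IsBandwidth (n b : ℕ) : Prop := (b < n ∧ Odd b) ∨ b = n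

/-- The pair `(i, j)` is `b`-relevant. (`(b - 1) / 2` is an integer whenever `b < n` is a
bandwidth.) -/
def Relevant (n b : ℕ) (i j : Fin n) : Prop :=
  b = n ∨ |((i : ℕ) : ℤ) - ((j : ℕ) : ℤ)| ≤ ((b : ℤ) - 1) / 2 ∨
    (n : ℤ) - ((b : ℤ) - 1) / 2 ≤ |((i : ℕ) : ℤ) - ((j : ℕ) : ℤ)|

open Classical in
/-- The periodic random band matrix `X_n` based on `a` with bandwidth `b`. -/
def bandMatrix (a : TriangularScheme Ω) (b : ℕ → ℕ) (n : ℕ) (ω : Ω) :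
    Matrix (Fin n) (Fin n) ℝ :=
  Matrix.of fun p q =>
    (1 / √(b n : ℝ)) * (if Relevant n (b n) p q then a.entry n p q ω else 0)

theorem relevant_comm (n b : ℕ) (i j : Fin n) : Relevant n b i j ↔ Relevant n b j i := by
  unfold Relevant
  rw [abs_sub_comm]

theorem bandMatrix_isHermitian (a : TriangularScheme Ω) (b : ℕ → ℕ) (n : ℕ) (ω : Ω) :
    (bandMatrix a b n ω).IsHermitian := by
  ext p q
  by_cases h : Relevant n (b n) p q
  · simp [bandMatrix, h, (relevant_comm n (b n) p q).1 h, a.symm n q p]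
  · simp [bandMatrix, h, mt (relevant_comm n (b n) p q).2 h]

/-- Empirical spectral distribution `(1/n) ∑ δ_{λ_i}` of a real symmetric matrix. -/
def esd {n : ℕ} {A : Matrix (Fin n) (Fin n) ℝ} (hA : A.IsHermitian) : Measure ℝ :=
  ((n : ℝ≥0∞)⁻¹) • ∑ i, Measure.dirac (hA.eigenvalues i)

/-- The empirical spectral distribution `σ_n` of `X_n`. -/
def bandESD (a : TriangularScheme Ω) (b : ℕ → ℕ) (n : ℕ) (ω : Ω) : Measure ℝ :=
  esd (bandMatrix_isHermitian a b n ω)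

/-- The semicircle distribution. -/
def semicircle : Measure ℝ :=
  volume.withDensity fun x =>
    ENNReal.ofReal ((Set.Icc (-2) 2).indicator (fun x => 1 / (2 * Real.pi) * √(4 - x ^ 2)) x)

/-- The semicircle law holds in probability for `(X_n)`. -/
def SemicircleLawInProbability (μ : Measure Ω) (a : TriangularScheme Ω) (b : ℕ → ℕ) : Prop :=
  ∀ f : ℝ →ᵇ ℝ, TendstoInMeasure μ (fun n ω => ∫ x, f x ∂(bandESD a b n ω)) atTop
    (fun _ => ∫ x, f x ∂semicircle)

/-- The semicircle law holds almost surely for `(X_n)`. -/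
def SemicircleLawAlmostSurely (μ : Measure Ω) (a : TriangularScheme Ω) (b : ℕ → ℕ) : Prop :=
  ∀ f : ℝ →ᵇ ℝ, ∀ᵐ ω ∂μ, Tendsto (fun n => ∫ x, f x ∂(bandESD a b n ω)) atTop
    (𝓝 (∫ x, f x ∂semicircle))

end

/-! The proof is the method of moments. The `k`-th moment of the spectral distribution is `n⁻¹
b^(-k/2)` times the sum, over closed walks of length `k` along relevant edges, of the product of the
entries met on the way. Call a walk good if its graph is a tree and each edge is traversed exactly
twice; all other walks are bad.

Good walks give the limit. A good walk is coded by a Dyck word together with the choice of a root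
and of one of `b` neighbours at each up step, so there are `catalan m * n * b^m` of them for `k = 2
* m`, up to a relative error `O(1/b)`, and none for odd `k`. This matches the semicircle moments
(`tendsto_goodCount`). By `aau2` the weight of a good walk, and the product of two such weights
without a common edge, has expectation close to `1`. Pairs with a common edge have total weight
`O(1/(n b))`, so the sum of the good weights is close to the number of good walks in mean square
(`integral_goodSum_sub_sq_le`).

Bad walks vanish. The combinatorial core is `two_mul_card_vertices_le`: `r` bad walks together visit
at most `(r k + s) / 2` vertices, where `s` counts the edges traversed once. By `aau1` with `α ≥
1/2` each such edge costs `n^(-1/2)`, which compensates for the surplus. Only starting points have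
`n` choices, all other new vertices have `b`, so the `r`-th moment of the bad part is `O(b^(-r))`
(`integral_badSum_pow_le`).

Convergence in probability follows from Chebyshev. For almost sure convergence one sums moments over
`n`: sign-valued entries make good weights exactly `1`, and `r = 4` handles the bad part; under
summability of `b^(-2)` and of the constants in `aau2`, `r = 2` suffices; for Wigner schemes walks
without a common edge are uncorrelated, so the bad part has variance `O(1/(n b))` and its mean tends
to `0`. -/

noncomputable section

open scoped Classical
open Finset

/-! ### Multiplicities in finite families -/

section EdgeMultiplicity

variable {I J E : Type*} [Fintype I] [Fintype J]

/-- The number of indices `i` with `f i = e`. -/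
def mult (f : I → E) (e : E) : ℕ := (univ.filter fun i => f i = e).card

/-- The number of values that `f` takes exactly once. -/
def singles (f : I → E) : ℕ := ((univ.image f).filter fun e => mult f e = 1).card

theorem singles_eq [DecidableEq E] (f : I → E) :
    singles f = ((univ.image f).filter fun e => mult f e = 1).card := by
  unfold singles
  congr!

theorem sum_mult [DecidableEq E] (f : I → E) :
    ∑ e ∈ univ.image f, mult f e = Fintype.card I := by
  rw [← Finset.card_univ, Finset.card_eq_sum_card_image f univ]
  exact Finset.sum_congr rfl fun e _ => by unfold mult; congr!

theorem mult_pos (f : I → E) (i : I) : 1 ≤ mult f (f i) :=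
  Finset.card_pos.2 ⟨i, by simp⟩

theorem mult_comp_equiv (f : I → E) (σ : J ≃ I) (e : E) : mult (f ∘ σ) e = mult f e := by
  unfold mult
  exact Finset.card_equiv σ (by simp)

theorem singles_comp_equiv (f : I → E) (σ : J ≃ I) : singles (f ∘ σ) = singles f := by
  unfold singles
  have : univ.image (f ∘ σ) = univ.image f := by
    ext e
    simp only [mem_image, mem_univ, true_and, Function.comp]
    exact ⟨fun ⟨a, h⟩ => ⟨_, h⟩, fun ⟨a, h⟩ => ⟨σ.symm a, by simpa using h⟩⟩
  simp [this, mult_comp_equiv]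

theorem mult_sum_elim (f : I → E) (g : J → E) (e : E) :
    mult (Sum.elim f g) e = mult f e + mult g e := by
  simp only [mult, ← Fintype.card_subtype]
  rw [← Fintype.card_sum]
  exact Fintype.card_congr Equiv.subtypeSum

end EdgeMultiplicity

/-! ### First occurrences in a sequence -/

section FirstVisit

variable {I V : Type*} [LinearOrder I]

/-- The sequence `x` takes the value `x i` at `i` for the first time. -/
def IsNew (x : I → V) (i : I) : Prop := ∀ p < i, x p ≠ x i

theorem IsNew.eq {x : I → V} {i j : I} (hi : IsNew x i) (hj : IsNew x j) (h : x i = x j) :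
    i = j := by
  rcases lt_trichotomy i j with hl | hl | hl
  · exact absurd h (hj _ hl)
  · exact hl
  · exact absurd h.symm (hi _ hl)

theorem IsNew.le {x : I → V} {i j : I} (hi : IsNew x i) (h : x j = x i) : i ≤ j :=
  not_lt.1 fun hl => hi _ hl h

theorem exists_isNew [Finite I] (x : I → V) (i : I) : ∃ p ≤ i, IsNew x p ∧ x p = x i := by
  induction i using WellFoundedLT.induction with
  | _ i ih =>
    by_cases h : IsNew x i
    · exact ⟨i, le_rfl, h, rfl⟩
    · simp only [IsNew, not_forall, not_not] at h
      obtain ⟨p, hp, hx⟩ := h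
      obtain ⟨q, hq, hn, hxq⟩ := ih p hp
      exact ⟨q, hq.trans hp.le, hn, hxq.trans hx⟩

end FirstVisit

/-! ### Closed walks whose graph is a tree -/

section ClosedWalk

variable {V : Type*} {k : ℕ} [NeZero k]

theorem Fin.sub_one_lt_self {q : Fin k} (hq : q ≠ 0) : q - 1 < q := by
  obtain ⟨k, rfl⟩ : ∃ m, k = m + 1 := ⟨k - 1, by have := NeZero.pos k; omega⟩
  exact Fin.sub_one_lt_iff.2 (Fin.pos_of_ne_zero hq)

/-- The edge which the closed walk `t 0, t 1, …, t (k - 1), t 0` traverses at step `q`. -/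
def stepEdge (t : Fin k → V) (q : Fin k) : Sym2 V := s(t q, t (q + 1))

/-- The edge `e` is one along which the walk `t` enters a vertex for the first time. -/
def IsTreeEdge (t : Fin k → V) (e : Sym2 V) : Prop :=
  ∃ q, q ≠ 0 ∧ IsNew t q ∧ e = s(t (q - 1), t q)

/-- Every edge of `t` is a tree edge. -/
def IsTreeWalk (t : Fin k → V) : Prop := ∀ p, IsTreeEdge t (stepEdge t p)

/-- The graph of `t` is a tree whose edges are traversed exactly twice each. -/
def IsGood (t : Fin k → V) : Prop :=
  IsTreeWalk t ∧ ∀ p, mult (stepEdge t) (stepEdge t p) = 2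

theorem stepEdge_sub_one (t : Fin k → V) (q : Fin k) :
    stepEdge t (q - 1) = s(t (q - 1), t q) := by
  simp [stepEdge]

/-- A function on the vertices with prescribed increments along the tree edges. -/
theorem exists_potential (t : Fin k → V) (c : Fin k → ℤ) :
    ∃ h : V → ℤ, h (t 0) = 0 ∧ ∀ q, q ≠ 0 → IsNew t q → h (t q) = h (t (q - 1)) + c q := by
  -- Induction on time: the vertex entered at time `m`, if new, has not been seen before, so `h` may
  -- be redefined there without disturbing earlier increments.
  suffices H : ∀ m : ℕ, ∃ h : V → ℤ, h (t 0) = 0 ∧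
      ∀ q : Fin k, q.val < m → q ≠ 0 → IsNew t q → h (t q) = h (t (q - 1)) + c q by
    obtain ⟨h, h0, hh⟩ := H k
    exact ⟨h, h0, fun q => hh q q.2⟩
  intro m
  induction m with
  | zero => exact ⟨fun _ => 0, rfl, fun q hq => absurd hq (Nat.not_lt_zero _)⟩
  | succ m ih =>
    obtain ⟨h, h0, hh⟩ := ih
    by_cases hm : ∃ q : Fin k, q.val = m ∧ q ≠ 0 ∧ IsNew t q
    · obtain ⟨q, hqm, hq0, hq⟩ := hm
      have hlt : ∀ p : Fin k, p < q → t p ≠ t q := hq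
      refine ⟨Function.update h (t q) (h (t (q - 1)) + c q), ?_, ?_⟩
      · rw [Function.update_of_ne (hlt 0 (Fin.pos_iff_ne_zero.2 hq0)), h0]
      · intro p hp hp0 hpn
        have hpq : p ≤ q := by rw [Fin.le_def]; omega
        rw [Function.update_of_ne (hlt (p - 1) ((Fin.sub_one_lt_self hp0).trans_le hpq))]
        rcases hpq.eq_or_lt with rfl | hl
        · simp
        · rw [Function.update_of_ne (hlt p hl)]
          exact hh p (by rw [Fin.lt_def] at hl; omega) hp0 hpn
    · refine ⟨h, h0, fun q hq hq0 hqn => ?_⟩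
      rcases Nat.lt_succ_iff_lt_or_eq.1 hq with hl | hl
      · exact hh q hl hq0 hqn
      · exact absurd ⟨q, hl, hq0, hqn⟩ hm

/-- In a closed walk all of whose edges are tree edges, every edge is traversed equally often in
both directions. -/
theorem IsTreeWalk.card_down_eq_card_up {t : Fin k → V} (ht : IsTreeWalk t) {q₀ : Fin k}
    (hq0 : q₀ ≠ 0) (hq : IsNew t q₀) :
    (univ.filter fun p => t p = t (q₀ - 1) ∧ t (p + 1) = t q₀).card =
      (univ.filter fun p => t p = t q₀ ∧ t (p + 1) = t (q₀ - 1)).card := by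
  -- This potential jumps by one across the chosen tree edge and is constant across all others. Its
  -- increments along the closed walk sum to zero, so crossings in the two directions balance.
  obtain ⟨h, -, hh⟩ := exists_potential t (fun q => if q = q₀ then 1 else 0)
  have hne : t (q₀ - 1) ≠ t q₀ := hq _ (Fin.sub_one_lt_self hq0)
  have key : ∀ p, h (t (p + 1)) - h (t p) =
      (if t p = t (q₀ - 1) ∧ t (p + 1) = t q₀ then 1 else 0) -
        (if t p = t q₀ ∧ t (p + 1) = t (q₀ - 1) then 1 else 0) := by
    intro p
    obtain ⟨q, hq0', hqn, he⟩ := ht p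
    have hd := hh q hq0' hqn
    by_cases hqq : q = q₀
    · subst hqq
      rcases Sym2.eq_iff.1 he with ⟨h1, h2⟩ | ⟨h1, h2⟩
      · simp [h1, h2, hne, hd]
      · simp [h1, h2, hne.symm, hd]
    · have h1 : t q ≠ t q₀ := fun h => hqq (hqn.eq hq h)
      -- Were one edge the discovery edge of both of its endpoints, each endpoint would have to be
      -- visited before the other.
      have h2 : ¬ (t (q - 1) = t q₀ ∧ t q = t (q₀ - 1)) := by
        rintro ⟨h1, h2⟩
        have := hqn.le h2.symm
        have := hq.le h1
        have := Fin.sub_one_lt_self hq0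
        have := Fin.sub_one_lt_self hq0'
        exact absurd (lt_of_le_of_lt ‹q ≤ q₀ - 1› ‹_›) (not_lt.2 (‹q₀ ≤ q - 1›.trans (le_of_lt ‹_›)))
      rw [if_neg hqq, add_zero] at hd
      rcases Sym2.eq_iff.1 he with ⟨h3, h4⟩ | ⟨h3, h4⟩
      · rw [h3, h4, if_neg (fun h => h1 h.2), if_neg h2, hd]; simp
      · rw [h3, h4, if_neg (fun h => h2 h.symm), if_neg (fun h => h1 h.1), hd]; simp
  have hsum : ∑ p, (h (t (p + 1)) - h (t p)) = 0 := by
    rw [Finset.sum_sub_distrib, sub_eq_zero]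
    exact Equiv.sum_comp (Equiv.addRight (1 : Fin k)) (fun p => h (t p))
  rw [Finset.sum_congr rfl fun p _ => key p, Finset.sum_sub_distrib] at hsum
  simp only [Finset.sum_boole] at hsum
  exact_mod_cast sub_eq_zero.1 hsum

/-- A traversal goes either away from or towards the parent, never both as the endpoints differ, and
the two kinds are equally many. -/
theorem IsTreeWalk.mult_eq {t : Fin k → V} (ht : IsTreeWalk t) {q₀ : Fin k}
    (hq0 : q₀ ≠ 0) (hq : IsNew t q₀) :
    mult (stepEdge t) s(t (q₀ - 1), t q₀) =
      2 * (univ.filter fun p => t p = t (q₀ - 1) ∧ t (p + 1) = t q₀).card := by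
  rw [two_mul]
  conv_rhs => rw [ht.card_down_eq_card_up hq0 hq]
  rw [← ht.card_down_eq_card_up hq0 hq]
  nth_rewrite 2 [ht.card_down_eq_card_up hq0 hq]
  rw [mult, ← Finset.card_union_of_disjoint]
  · congr 1
    ext p
    simp [stepEdge]
  · rw [Finset.disjoint_filter]
    rintro p - ⟨h1, -⟩ ⟨h2, -⟩
    exact hq _ (Fin.sub_one_lt_self hq0) (h1.symm.trans h2)

theorem IsTreeWalk.even_mult {t : Fin k → V} (ht : IsTreeWalk t) (p : Fin k) :
    Even (mult (stepEdge t) (stepEdge t p)) := by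
  obtain ⟨q, hq0, hq, he⟩ := ht p
  rw [he, ht.mult_eq hq0 hq]
  exact even_two_mul _

end ClosedWalk

/-! ### Tuples of bad walks visit few vertices -/

section Tuple

variable {V : Type*} {k r : ℕ}

/-- The edge traversed at the step `i.2` by the walk `T i.1`. -/
def tupleEdge [NeZero k] (T : Fin r → Fin k → V) (i : Fin r × Fin k) : Sym2 V := stepEdge (T i.1) i.2

/-- The vertices visited by a tuple of walks, in lexicographic order. -/
def tupleVertex (T : Fin r → Fin k → V) (i : Fin r ×ₗ Fin k) : V :=
  T (ofLex i).1 (ofLex i).2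

theorem isNew_tupleVertex (T : Fin r → Fin k → V) (j : Fin r) (q : Fin k) :
    IsNew (tupleVertex T) (toLex (j, q)) ↔
      (∀ j' < j, ∀ q', T j' q' ≠ T j q) ∧ IsNew (T j) q := by
  constructor
  · intro h
    refine ⟨fun j' hj' q' => h (toLex (j', q')) ?_, fun p hp => h (toLex (j, p)) ?_⟩
    · exact Prod.Lex.toLex_lt_toLex.2 (Or.inl hj')
    · exact Prod.Lex.toLex_lt_toLex.2 (Or.inr ⟨rfl, hp⟩)
  · rintro ⟨h1, h2⟩ p hp
    rcases Prod.Lex.lt_iff.1 hp with h | ⟨h, h'⟩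
    · exact h1 _ h _
    · have := h2 _ h'
      simp only [tupleVertex, ofLex_toLex] at h this ⊢
      rwa [h]

variable [NeZero k]

/-- A walk of the tuple which starts at a new vertex and is not good gives rise to an edge that is
not needed for connecting the graph, or is traversed more than twice. -/
theorem exists_excess_edge (T : Fin r → Fin k → V) (j : Fin r) (hj : ¬ IsGood (T j))
    (hnew : IsNew (tupleVertex T) (toLex (j, 0))) :
    ∃ e, (∃ q, stepEdge (T j) q = e) ∧ (∀ j' < j, ∀ q, stepEdge (T j') q ≠ e) ∧
      ((¬ ∃ i : Fin r × Fin k, i.2 ≠ 0 ∧ IsNew (tupleVertex T) (toLex i) ∧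
          e = s(T i.1 (i.2 - 1), T i.1 i.2)) ∨ 4 ≤ mult (tupleEdge T) e) := by
  by_contra hcon
  push Not at hcon
  have hfresh : ∀ q, (∀ j' < j, ∀ q', T j' q' ≠ T j q) → ∀ e, T j q ∈ e →
      ∀ j' < j, ∀ q', stepEdge (T j') q' ≠ e := by
    intro q hq e he j' hj' q' h
    rw [← h, stepEdge, Sym2.mem_iff] at he
    rcases he with he | he
    · exact hq j' hj' _ he.symm
    · exact hq j' hj' _ he.symm
  -- Under the negated claim, every edge of `T j` avoided by earlier walks is a tree edge of the
  -- tuple. The start of `T j` is new; inductively, the step leaving an unvisited vertex uses such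
  -- an edge, which is discovered no earlier than in walk `j`, so its other end is unvisited by
  -- earlier walks too.
  have hall : ∀ q, ∀ j' < j, ∀ q', T j' q' ≠ T j q := by
    intro q
    induction q using WellFoundedLT.induction with
    | _ q ih =>
    by_cases hq0 : q = 0
    · subst hq0
      exact ((isNew_tupleVertex T j 0).1 hnew).1
    have hlt := Fin.sub_one_lt_self hq0
    have hfr := hfresh (q - 1) (ih _ hlt) (stepEdge (T j) (q - 1)) (by simp [stepEdge])
    obtain ⟨⟨⟨j₁, q₁⟩, h10, hn1, he1⟩, -⟩ := hcon _ ⟨q - 1, rfl⟩ hfr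
    obtain ⟨hn1, hn1'⟩ := (isNew_tupleVertex T j₁ q₁).1 hn1
    simp only at he1 h10
    have hj1 : j ≤ j₁ := by
      by_contra hlt'
      exact hfr j₁ (not_le.1 hlt') (q₁ - 1) (by rw [he1, stepEdge_sub_one])
    intro j' hj' q' hh
    rw [stepEdge_sub_one] at he1
    rcases Sym2.eq_iff.1 he1 with ⟨h1, h2⟩ | ⟨h1, h2⟩
    · exact hn1 j' (hj'.trans_le hj1) q' (hh.trans h2)
    · rcases hj1.eq_or_lt with rfl | hlt'
      · have hle := hn1'.le h1
        exact ih (q₁ - 1) ((Fin.sub_one_lt_self h10).trans_le (hle.trans hlt.le)) j' hj' q'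
          (hh.trans h2)
      · exact hn1 j hlt' _ h1
  have hedge : ∀ p, ∀ j' < j, ∀ q, stepEdge (T j') q ≠ stepEdge (T j) p := fun p =>
    hfresh p (hall p) _ (by simp [stepEdge])
  -- A tree edge of the tuple that lies on `T j` is discovered neither before walk `j` (its vertices
  -- are fresh) nor after it (they have then been seen), hence in walk `j` itself.
  have htree : IsTreeWalk (T j) := by
    intro p
    obtain ⟨⟨⟨j₁, q₁⟩, h10, hn1, he1⟩, -⟩ := hcon _ ⟨p, rfl⟩ (hedge p)
    obtain ⟨hn1, hn1'⟩ := (isNew_tupleVertex T j₁ q₁).1 hn1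
    simp only at he1 h10
    have hj1 : j₁ = j := by
      rcases lt_trichotomy j₁ j with hl | hl | hl
      · exact absurd (by rw [he1, stepEdge_sub_one]) (hedge p j₁ hl (q₁ - 1))
      · exact hl
      · have : T j₁ q₁ ∈ stepEdge (T j) p := by rw [he1]; simp
        rw [stepEdge, Sym2.mem_iff] at this
        rcases this with h | h
        · exact absurd h.symm (hn1 j hl _)
        · exact absurd h.symm (hn1 j hl _)
    subst hj1
    exact ⟨q₁, h10, hn1', he1⟩
  -- Within `T j` the multiplicity is even, positive and below `4`, hence `2`, so `T j` would be
  -- good.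
  refine hj ⟨htree, fun p => ?_⟩
  obtain ⟨-, h4⟩ := hcon _ ⟨p, rfl⟩ (hedge p)
  have hle : mult (stepEdge (T j)) (stepEdge (T j) p) ≤ mult (tupleEdge T) (stepEdge (T j) p) := by
    unfold mult
    refine Finset.card_le_card_of_injOn (fun q => (j, q)) ?_ ?_
    · intro q hq
      simp only [coe_filter, mem_univ, true_and, Set.mem_ofPred_eq] at hq ⊢
      exact hq
    · intro q _ q' _ h
      simpa using h
  have hpos := mult_pos (stepEdge (T j)) p
  obtain ⟨c, hc⟩ := htree.even_mult p
  omega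

/-- The number of vertices visited by a tuple of walks that are not good. -/
theorem two_mul_card_vertices_le (T : Fin r → Fin k → V) (hT : ∀ j, ¬ IsGood (T j)) :
    2 * (univ.filter (IsNew (tupleVertex T))).card ≤ r * k + singles (tupleEdge T) := by
  set N : Finset (Fin r × Fin k) := univ.filter fun i => IsNew (tupleVertex T) (toLex i) with hN
  have hcard : (univ.filter (IsNew (tupleVertex T))).card = N.card :=
    Finset.card_equiv ofLex (by simp [hN])
  set N1 := N.filter fun i => i.2 ≠ 0 with hN1
  set J : Finset (Fin r) := univ.filter fun j => IsNew (tupleVertex T) (toLex (j, 0)) with hJ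
  set τ : Fin r × Fin k → Sym2 V := fun i => s(T i.1 (i.2 - 1), T i.1 i.2) with hτ
  -- A new vertex is either the start of a walk or is entered by a step; the latter correspond to
  -- tree edges through `τ`.
  have hNJ : N.card = J.card + N1.card := by
    rw [← Finset.card_filter_add_card_filter_not (s := N) (fun i => i.2 = 0)]
    congr 1
    symm
    refine Finset.card_bij (fun j _ => (j, 0)) ?_ ?_ ?_
    · intro j hj; simpa [hN, hJ] using hj
    · intro j _ j' _ h; simpa using h
    · rintro ⟨j, q⟩ h
      simp only [hN, mem_filter, mem_univ, true_and] at h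
      obtain ⟨h, rfl⟩ := h
      exact ⟨j, by simpa [hJ] using h, rfl⟩
  have hτinj : Set.InjOn τ N1 := by
    have aux : ∀ i ∈ N1, ∀ i' ∈ N1, toLex i < toLex i' → τ i ≠ τ i' := by
      intro i hi i' hi' hlt he
      simp only [hN1, hN, mem_filter, mem_univ, true_and] at hi hi'
      have hmem : T i'.1 i'.2 ∈ τ i := by rw [he]; simp [hτ]
      rw [hτ, Sym2.mem_iff] at hmem
      rcases hmem with h | h
      · refine hi'.1 (toLex (i.1, i.2 - 1)) (lt_trans ?_ hlt) h.symm
        exact Prod.Lex.toLex_lt_toLex.2 (Or.inr ⟨rfl, Fin.sub_one_lt_self hi.2⟩)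
      · exact hi'.1 (toLex i) hlt h.symm
    intro i hi i' hi' he
    rcases lt_trichotomy (toLex i) (toLex i') with h | h | h
    · exact absurd he (aux i hi i' hi' h)
    · exact toLex.injective h
    · exact absurd he.symm (aux i' hi' i hi h)
  set Tree := N1.image τ with hTree
  have hTreecard : Tree.card = N1.card := Finset.card_image_of_injOn hτinj
  set Ed := univ.image (tupleEdge T) with hEd
  have hTreeEd : Tree ⊆ Ed := by
    intro e he
    obtain ⟨i, -, rfl⟩ := Finset.mem_image.1 he
    exact Finset.mem_image.2 ⟨(i.1, i.2 - 1), mem_univ _, by simp [tupleEdge, stepEdge_sub_one, hτ]⟩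
  have hex : ∀ j, ∃ e, j ∈ J → (∃ q, stepEdge (T j) q = e) ∧
      (∀ j' < j, ∀ q, stepEdge (T j') q ≠ e) ∧ (e ∉ Tree ∨ 4 ≤ mult (tupleEdge T) e) := by
    intro j
    by_cases hj : j ∈ J
    · obtain ⟨e, h1, h2, h3⟩ := exists_excess_edge T j (hT j) (by simpa [hJ] using hj)
      refine ⟨e, fun _ => ⟨h1, h2, h3.imp_left fun h hmem => h ?_⟩⟩
      obtain ⟨i, hi, rfl⟩ := Finset.mem_image.1 hmem
      simp only [hN1, hN, mem_filter, mem_univ, true_and] at hi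
      exact ⟨i, hi.2, hi.1, rfl⟩
    · exact ⟨s(T j 0, T j 0), fun h => absurd h hj⟩
  choose ε hε using hex
  have hεinj : Set.InjOn ε J := by
    intro j hj j' hj' he
    rcases lt_trichotomy j j' with h | h | h
    · obtain ⟨q, hq⟩ := (hε j hj).1
      exact absurd (hq.trans he) ((hε j' hj').2.1 j h q)
    · exact h
    · obtain ⟨q, hq⟩ := (hε j' hj').1
      exact absurd (hq.trans he.symm) ((hε j hj).2.1 j' h q)
  set X := J.image ε with hX
  have hXcard : X.card = J.card := Finset.card_image_of_injOn hεinj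
  have hXEd : X ⊆ Ed := by
    intro e he
    obtain ⟨j, hj, rfl⟩ := Finset.mem_image.1 he
    obtain ⟨q, hq⟩ := (hε j hj).1
    exact Finset.mem_image.2 ⟨(j, q), mem_univ _, hq⟩
  have hX4 : ∀ e ∈ X, e ∉ Tree ∨ 4 ≤ mult (tupleEdge T) e := by
    intro e he
    obtain ⟨j, hj, rfl⟩ := Finset.mem_image.1 he
    exact (hε j hj).2.2
  -- Charging scheme: new starts are paid for by their excess edges, other new vertices by tree
  -- edges, at a price of `2` each. An edge charged twice has multiplicity at least `4`; an edge
  -- charged once has multiplicity at least `2`, or is single and receives a bonus of `1`.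
  -- Multiplicities sum to `r * k`.
  have hpt : ∀ e ∈ Ed, 2 * (if e ∈ X then 1 else 0) + 2 * (if e ∈ Tree then 1 else 0) ≤
      mult (tupleEdge T) e + (if mult (tupleEdge T) e = 1 then 1 else 0) := by
    intro e he
    obtain ⟨i, -, rfl⟩ := Finset.mem_image.1 he
    have h1 := mult_pos (tupleEdge T) i
    have h4 := hX4 (tupleEdge T i)
    generalize mult (tupleEdge T) (tupleEdge T i) = m at *
    by_cases a : tupleEdge T i ∈ X <;> by_cases b : tupleEdge T i ∈ Tree <;>
      simp only [a, b, if_true, if_false, not_true, false_or, forall_true_left] at h4 ⊢ <;>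
      split_ifs <;> omega
  have hs := Finset.sum_le_sum hpt
  have hm : ∑ e ∈ Ed, mult (tupleEdge T) e = Fintype.card (Fin r × Fin k) := sum_mult _
  rw [Finset.sum_add_distrib, Finset.sum_add_distrib, ← Finset.mul_sum, ← Finset.mul_sum,
    hm, ← Finset.card_filter, ← Finset.card_filter, ← Finset.card_filter,
    Finset.filter_mem_eq_inter, Finset.filter_mem_eq_inter, Finset.inter_eq_right.2 hXEd,
    Finset.inter_eq_right.2 hTreeEd, hXcard, hTreecard] at hs
  rw [hcard, hNJ]
  simp only [Fintype.card_prod, Fintype.card_fin] at hs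
  have hsing : singles (tupleEdge T) = (Ed.filter fun e => mult (tupleEdge T) e = 1).card :=
    singles_eq _
  omega

end Tuple

/-! ### Concatenation of two closed walks -/

section Append

variable {V : Type*} {k : ℕ} [NeZero k]

instance neZero_add_self : NeZero (k + k) := ⟨by have := NeZero.ne k; omega⟩

/-- As the starting points agree, the two steps across the junctions are the closing steps of `s`
and of `t`. -/
theorem stepEdge_append (s t : Fin k → V) (h0 : s 0 = t 0) :
    stepEdge (Fin.append s t) ∘ finSumFinEquiv = Sum.elim (stepEdge s) (stepEdge t) := by
  have hk := NeZero.pos k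
  have key : ∀ (x y : Fin k → V), x 0 = y 0 → ∀ q : Fin k, ∀ p : Fin (k + k),
      (p.val = q.val + 1) → Fin.append x y p = x (q + 1) := by
    intro x y hxy q p hp
    by_cases hq : q.val + 1 < k
    · have : p = Fin.castAdd k (q + 1) := by
        ext
        rw [Fin.val_castAdd, hp, Fin.val_add_one_of_lt' hq]
      rw [this, Fin.append_left]
    · have h1 : p = Fin.natAdd k 0 := by
        ext
        simp only [Fin.val_natAdd, Fin.val_zero]
        have := q.2
        omega
      have h2 : q + 1 = 0 := by
        ext
        rw [Fin.val_add, Fin.val_one', Fin.val_zero, Nat.add_mod_mod]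
        have : q.val + 1 = k := by have := q.2; omega
        rw [this, Nat.mod_self]
      rw [h1, h2, Fin.append_right, hxy]
  funext i
  rcases i with q | q
  · simp only [Function.comp, finSumFinEquiv_apply_left, Sum.elim_inl, stepEdge, Fin.append_left]
    rw [key s t h0 q]
    rw [Fin.val_add_one_of_lt']
    · simp
    · have := q.2; simp; omega
  · simp only [Function.comp, finSumFinEquiv_apply_right, Sum.elim_inr, stepEdge, Fin.append_right]
    by_cases hq : q.val + 1 < k
    · have : Fin.natAdd k q + 1 = Fin.natAdd k (q + 1) := by
        ext
        rw [Fin.val_add_one_of_lt' (by simp; omega)]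
        simp [Fin.val_add_one_of_lt' hq]
        omega
      rw [this, Fin.append_right]
    · have hqk : q.val + 1 = k := by have := q.2; omega
      have h1 : Fin.natAdd k q + 1 = Fin.castAdd k 0 := by
        ext
        rw [Fin.val_add, Fin.val_one', Nat.add_mod_mod]
        simp only [Fin.val_natAdd, Fin.val_castAdd, Fin.val_zero]
        rw [add_assoc, hqk, Nat.mod_self]
      have h2 : q + 1 = 0 := by
        ext
        rw [Fin.val_add, Fin.val_one', Fin.val_zero, Nat.add_mod_mod, hqk, Nat.mod_self]
      rw [h1, h2, Fin.append_left, h0]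

theorem mult_append (s t : Fin k → V) (h0 : s 0 = t 0) (e : Sym2 V) :
    mult (stepEdge (Fin.append s t)) e = mult (stepEdge s) e + mult (stepEdge t) e := by
  rw [← mult_sum_elim, ← stepEdge_append s t h0, mult_comp_equiv]

/-- Two closed walks with the same starting point and a common edge do not combine to a good
walk. -/
theorem not_isGood_append (s t : Fin k → V) (h0 : s 0 = t 0) {p p' : Fin k}
    (hp : stepEdge s p = stepEdge t p') : ¬ IsGood (Fin.append s t) := by
  rintro ⟨htree, h2⟩
  have hstep : ∀ q, stepEdge (Fin.append s t) (Fin.castAdd k q) = stepEdge s q := fun q => by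
    simpa using congrFun (stepEdge_append s t h0) (Sum.inl q)
  -- A tree edge with both ends visited by `s` is discovered within the first half, so `s` is itself
  -- a tree walk.
  have hs : IsTreeWalk s := by
    intro q
    obtain ⟨c, hc0, hc, he⟩ := htree (Fin.castAdd k q)
    rw [hstep] at he
    have hmem : Fin.append s t c ∈ stepEdge s q := by rw [he]; simp
    have hck : c.val < k := by
      have : ∃ q' : Fin k, s q' = Fin.append s t c := by
        rw [stepEdge, Sym2.mem_iff] at hmem
        rcases hmem with h | h
        · exact ⟨_, h.symm⟩
        · exact ⟨_, h.symm⟩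
      obtain ⟨q', hq'⟩ := this
      have := hc.le (j := Fin.castAdd k q') (by simpa using hq')
      rw [Fin.le_def] at this
      simp at this
      omega
    obtain ⟨d, rfl⟩ : ∃ d : Fin k, c = Fin.castAdd k d := ⟨⟨c, hck⟩, by ext; simp⟩
    have hd0 : d ≠ 0 := by
      rintro rfl
      exact hc0 (by ext; simp)
    have hsub : Fin.castAdd k d - 1 = Fin.castAdd k (d - 1) := by
      rw [sub_eq_iff_eq_add]
      have := Fin.sub_one_lt_self hd0
      have h1 : (d - 1).val + 1 = d.val := by
        have h2 := Fin.val_add_one_of_lt' (i := d - 1) (by rw [Fin.lt_def] at this; omega)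
        rw [sub_add_cancel] at h2
        exact h2.symm
      ext
      rw [Fin.val_add_one_of_lt' (by have := d.2; rw [Fin.val_castAdd]; omega)]
      exact h1.symm
    refine ⟨d, hd0, fun x hx => ?_, ?_⟩
    · have := hc (Fin.castAdd k x) hx
      simpa using this
    · rw [hsub] at he
      simpa using he
  -- The common edge is used a positive even number of times by `s` and at least once by `t`, hence
  -- at least three times.
  have h3 := h2 (Fin.castAdd k p)
  rw [hstep, mult_append s t h0] at h3
  have h4 := mult_pos (stepEdge t) p'
  rw [← hp] at h4
  have h5 := mult_pos (stepEdge s) p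
  obtain ⟨c, hc⟩ := hs.even_mult p
  omega

end Append
end

noncomputable section

open scoped Classical
open Finset

/-! ### Sequences with prescribed repetitions and adjacencies -/

section Pattern

variable {I V : Type*} [LinearOrder I]

/-- The first index at which the sequence `x` takes the value `x i`. -/
def firstIdx [Finite I] (x : I → V) (i : I) : I := (exists_isNew x i).choose

section

variable [Finite I]

theorem firstIdx_le (x : I → V) (i : I) : firstIdx x i ≤ i := (exists_isNew x i).choose_spec.1

theorem isNew_firstIdx (x : I → V) (i : I) : IsNew x (firstIdx x i) :=
  (exists_isNew x i).choose_spec.2.1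

theorem apply_firstIdx (x : I → V) (i : I) : x (firstIdx x i) = x i :=
  (exists_isNew x i).choose_spec.2.2

theorem firstIdx_eq_iff {x : I → V} {i p : I} : firstIdx x i = p ↔ IsNew x p ∧ x p = x i := by
  constructor
  · rintro rfl
    exact ⟨isNew_firstIdx x i, apply_firstIdx x i⟩
  · rintro ⟨h1, h2⟩
    exact (isNew_firstIdx x i).eq h1 ((apply_firstIdx x i).trans h2.symm)

theorem firstIdx_eq_self_iff {x : I → V} {i : I} : firstIdx x i = i ↔ IsNew x i := by
  simp [firstIdx_eq_iff]

end

/-- The value of `x` at `i` is repeated from `w i`, unless `w i = i`, in which case it is free for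
`i ∈ S` and adjacent to the value at `pred i` otherwise. -/
def HasPattern (A : Set (Sym2 V)) (w pred : I → I) (S : Set I) (x : I → V) : Prop :=
  ∀ i, (w i ≠ i → x i = x (w i)) ∧ (w i = i → i ∉ S → s(x (pred i), x i) ∈ A)

variable [Fintype I] [Fintype V]

/-- Build the sequence in increasing order of the index: a repeated index leaves no choice, a free
index in `S` leaves all of `V`, any other free index leaves the `b` neighbours of a value chosen
before. Numbering these neighbours by `Fin b` makes the choices independent. -/
theorem natCard_hasPattern {A : Set (Sym2 V)} {w pred : I → I} {S : Set I} {b : ℕ}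
    (hA : ∀ u, (univ.filter fun v => s(u, v) ∈ A).card = b)
    (hw : ∀ i, w i ≤ i) (hpred : ∀ i, i ∉ S → pred i < i) :
    Nat.card {x : I → V // HasPattern A w pred S x} =
      Fintype.card V ^ Nat.card {i // w i = i ∧ i ∈ S} *
        b ^ Nat.card {i // w i = i ∧ i ∉ S} := by
  have e : ∀ u, {v // s(u, v) ∈ A} ≃ Fin b := fun u =>
    Fintype.equivFinOfCardEq (by rw [Fintype.card_subtype, hA])
  let R := {i // w i = i ∧ i ∈ S}
  let P := {i // w i = i ∧ i ∉ S}
  let Φ : {x : I → V // HasPattern A w pred S x} → (R → V) × (P → Fin b) := fun x =>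
    (fun i => x.1 i, fun i => e (x.1 (pred i)) ⟨x.1 i, (x.2 i).2 i.2.1 i.2.2⟩)
  have hΦ : ∀ x (i : P), x.1 i = ((e (x.1 (pred i))).symm ((Φ x).2 i)).1 := by
    intro x i
    simp [Φ]
  have hbij : Function.Bijective Φ := by
    constructor
    · intro x y hxy
      apply Subtype.ext
      funext i
      induction i using WellFoundedLT.induction with
      | _ i ih =>
        by_cases h : w i = i
        · by_cases hS : i ∈ S
          · exact congrFun (congrArg Prod.fst hxy) ⟨i, h, hS⟩
          · rw [hΦ x ⟨i, h, hS⟩, hΦ y ⟨i, h, hS⟩, ih _ (hpred i hS), hxy]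
        · rw [(x.2 i).1 h, (y.2 i).1 h, ih _ (lt_of_le_of_ne (hw i) h)]
    · rintro ⟨f, c⟩
      -- The inverse map, by well-founded recursion on the index.
      let F : ∀ i : I, (∀ j, j < i → V) → V := fun i rec =>
        if h : w i = i then
          if hS : i ∈ S then f ⟨i, h, hS⟩
          else ((e (rec (pred i) (hpred i hS))).symm (c ⟨i, h, hS⟩)).1
        else rec (w i) (lt_of_le_of_ne (hw i) h)
      let x : I → V := WellFounded.fix wellFounded_lt F
      have hx : ∀ i, x i = F i fun j _ => x j := fun i => WellFounded.fix_eq _ _ _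
      have hpat : HasPattern A w pred S x := by
        intro i
        refine ⟨fun h => ?_, fun h hS => ?_⟩
        · rw [hx i]; simp [F, h]
        · rw [hx i]; simp only [F, h, hS, dif_pos, dif_neg, not_false_eq_true]
          exact ((e (x (pred i))).symm (c ⟨i, h, hS⟩)).2
      refine ⟨⟨x, hpat⟩, Prod.ext ?_ ?_⟩
      · funext i
        change x i = f i
        rw [hx i]
        simp [F, i.2.1, i.2.2]
      · funext i
        have h1 : x i = ((e (x (pred i))).symm (c i)).1 := by
          rw [hx i]
          simp [F, i.2.1, i.2.2]
        have h2 := hΦ ⟨x, hpat⟩ i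
        have h3 := Subtype.ext (h1.symm.trans h2)
        exact ((e (x (pred i))).symm.injective h3).symm
  rw [Nat.card_eq_of_bijective Φ hbij, Nat.card_prod, Nat.card_fun, Nat.card_fun,
    Nat.card_eq_fintype_card, Nat.card_fin]

theorem card_le_of_hasPattern {A : Set (Sym2 V)} {w pred : I → I} {S : Set I} {b : ℕ}
    (hA : ∀ u, (univ.filter fun v => s(u, v) ∈ A).card = b)
    (hw : ∀ i, w i ≤ i) (hpred : ∀ i, i ∉ S → pred i < i)
    (F : Finset (I → V)) (hF : ∀ x ∈ F, HasPattern A w pred S x) :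
    F.card ≤ Fintype.card V ^ Nat.card {i // w i = i ∧ i ∈ S} *
        b ^ Nat.card {i // w i = i ∧ i ∉ S} := by
  rw [← natCard_hasPattern hA hw hpred, ← Nat.card_eq_finsetCard]
  exact Nat.card_le_card_of_injective (fun x : F => (⟨x.1, hF x x.2⟩ : {x // _}))
    fun x y h => Subtype.ext (by simpa using h)

end Pattern

/-! ### Weighted counts of tuples and of pairs of walks -/

section TupleSum

variable {V : Type*} [Fintype V] {A : Set (Sym2 V)} {b : ℕ}

/-- As `b ≤ n`, each factor `n^(-1/2)` may be weakened to `b^(-1/2)`; there are at least `2 * v`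
factors in all. -/
theorem pow_mul_pow_le_inv_pow {n : ℕ} (hb : 1 ≤ b) (hbn : b ≤ n)
    {m l v : ℕ} (h : 2 * v ≤ m + l) :
    (1 / √(b : ℝ)) ^ m * (1 / √(n : ℝ)) ^ l ≤ (1 / (b : ℝ)) ^ v := by
  have hb' : (1 : ℝ) ≤ b := by exact_mod_cast hb
  have hs : 1 ≤ √(b : ℝ) := Real.one_le_sqrt.2 hb'
  have h1 : 1 / √(n : ℝ) ≤ 1 / √(b : ℝ) :=
    one_div_le_one_div_of_le (by positivity) (Real.sqrt_le_sqrt (by exact_mod_cast hbn))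
  have h2 : (1 / √(b : ℝ)) ≤ 1 := by rw [div_le_one (by positivity)]; exact hs
  calc (1 / √(b : ℝ)) ^ m * (1 / √(n : ℝ)) ^ l
      ≤ (1 / √(b : ℝ)) ^ m * (1 / √(b : ℝ)) ^ l := by gcongr
    _ = (1 / √(b : ℝ)) ^ (m + l) := (pow_add _ _ _).symm
    _ ≤ (1 / √(b : ℝ)) ^ (2 * v) := pow_le_pow_of_le_one (by positivity) h2 h
    _ = (1 / (b : ℝ)) ^ v := by
        rw [pow_mul, div_pow, one_pow, Real.sq_sqrt (by positivity)]

/-- The total weight of the tuples of closed walks with few vertices. -/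
theorem sum_tuple_le (hA : ∀ u, (univ.filter fun v => s(u, v) ∈ A).card = b)
    (hb : 1 ≤ b) (hbn : b ≤ Fintype.card V) {r k : ℕ} [NeZero k]
    (F : Finset (Fin r → Fin k → V)) (hF : ∀ T ∈ F, (∀ j q, stepEdge (T j) q ∈ A) ∧
      2 * (univ.filter (IsNew (tupleVertex T))).card ≤ r * k + singles (tupleEdge T)) :
    (1 / √(b : ℝ)) ^ (r * k) *
        ∑ T ∈ F, (1 / √(Fintype.card V : ℝ)) ^ singles (tupleEdge T) ≤
      ((r * k) ^ (r * k) : ℕ) * ((Fintype.card V : ℝ) / b) ^ r := by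
  set n := Fintype.card V with hn
  have hb0 : (0 : ℝ) < b := by exact_mod_cast hb
  have hnb : 1 ≤ (n : ℝ) / b := by rw [one_le_div hb0]; exact_mod_cast hbn
  let I := Fin r ×ₗ Fin k
  let S : Set I := {i | (ofLex i).2 = 0}
  let pred : I → I := fun i => toLex ((ofLex i).1, (ofLex i).2 - 1)
  have hpred : ∀ i, i ∉ S → pred i < i := fun i hi =>
    Prod.Lex.lt_iff.2 (Or.inr ⟨rfl, Fin.sub_one_lt_self hi⟩)
  have hScard : (univ.filter fun i : I => i ∈ S).card = r := by
    have : (univ.filter fun i : I => i ∈ S) = univ.image fun j : Fin r => (toLex (j, 0) : I) := by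
      ext i
      simp only [mem_filter, mem_univ, true_and, mem_image]
      constructor
      · intro hi
        exact ⟨(ofLex i).1, by rw [← show (ofLex i).2 = 0 from hi]; rfl⟩
      · rintro ⟨j, rfl⟩
        rfl
    rw [this, Finset.card_image_of_injective, Finset.card_univ, Fintype.card_fin]
    intro j j' h
    simpa using h
  -- Fix the pattern `w` of repetitions. With `c ≤ r` new starting points and `d` other new vertices
  -- there are at most `n^c * b^d` tuples, each of weight at most `b^(-(c + d))`, which leaves
  -- `(n/b)^c`.
  have hfib : ∀ w : I → I, (1 / √(b : ℝ)) ^ (r * k) *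
      ∑ T ∈ F with firstIdx (tupleVertex T) = w, (1 / √(n : ℝ)) ^ singles (tupleEdge T) ≤
        ((n : ℝ) / b) ^ r := by
    intro w
    set Fw := F.filter fun T => firstIdx (tupleVertex T) = w with hFw
    rcases Fw.eq_empty_or_nonempty with he | ⟨T₀, hT₀⟩
    · rw [he]; simp only [sum_empty, mul_zero]; positivity
    have hw : ∀ i, w i ≤ i := by
      have := (mem_filter.1 hT₀).2
      intro i
      rw [← this]
      exact firstIdx_le _ _
    set v := (univ.filter fun i => w i = i).card with hv
    set c := (univ.filter fun i => w i = i ∧ i ∈ S).card with hc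
    set d := (univ.filter fun i => w i = i ∧ i ∉ S).card with hd
    have hvcd : v = c + d := by
      rw [hv, ← Finset.card_filter_add_card_filter_not (fun i => i ∈ S), Finset.filter_filter,
        Finset.filter_filter]
    have hcr : c ≤ r := by
      rw [← hScard]
      exact Finset.card_le_card fun i hi => by simp at hi ⊢; exact hi.2
    have hcard : Fw.card ≤ n ^ c * b ^ d := by
      have hinj : Function.Injective (tupleVertex : (Fin r → Fin k → V) → (I → V)) := by
        intro T T' h
        funext j q
        exact congrFun h (toLex (j, q))
      rw [← Finset.card_image_of_injective Fw hinj]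
      suffices hpat : ∀ x ∈ Fw.image tupleVertex, HasPattern A w pred S x by
        have h := card_le_of_hasPattern hA hw hpred _ hpat
        rw [Nat.card_eq_fintype_card, Nat.card_eq_fintype_card, Fintype.card_subtype,
          Fintype.card_subtype] at h
        convert h
      intro x hx
      obtain ⟨T, hT, rfl⟩ := Finset.mem_image.1 hx
      obtain ⟨hTF, hTw⟩ := mem_filter.1 hT
      intro i
      refine ⟨fun _ => ?_, fun _ _ => ?_⟩
      · rw [← hTw]
        exact (apply_firstIdx _ _).symm
      · have := (hF T hTF).1 (ofLex i).1 ((ofLex i).2 - 1)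
        rwa [stepEdge_sub_one] at this
    have hterm : ∀ T ∈ Fw, (1 / √(b : ℝ)) ^ (r * k) * (1 / √(n : ℝ)) ^ singles (tupleEdge T) ≤
        (1 / (b : ℝ)) ^ v := by
      intro T hT
      obtain ⟨hTF, hTw⟩ := mem_filter.1 hT
      have h2 := (hF T hTF).2
      refine pow_mul_pow_le_inv_pow hb hbn ?_
      have : v = (univ.filter (IsNew (tupleVertex T))).card := by
        rw [hv, ← hTw]
        simp only [firstIdx_eq_self_iff]
        congr!
      rwa [this]
    rw [Finset.mul_sum]
    calc _ ≤ ∑ T ∈ Fw, (1 / (b : ℝ)) ^ v := Finset.sum_le_sum hterm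
      _ = Fw.card * (1 / (b : ℝ)) ^ v := by rw [Finset.sum_const, nsmul_eq_mul]
      _ ≤ ((n : ℝ) ^ c * (b : ℝ) ^ d) * (1 / (b : ℝ)) ^ v := by
          gcongr
          exact_mod_cast hcard
      _ = ((n : ℝ) / b) ^ c := by
          rw [hvcd, pow_add, div_pow, div_pow, div_pow, one_pow, one_pow]
          field_simp
      _ ≤ ((n : ℝ) / b) ^ r := pow_le_pow_right₀ hnb hcr
  rw [← Finset.sum_fiberwise F (fun T => firstIdx (tupleVertex T)), Finset.mul_sum]
  refine (Finset.sum_le_sum fun w _ => hfib w).trans ?_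
  rw [Finset.sum_const, nsmul_eq_mul, Finset.card_univ]
  have : Fintype.card (I → I) = (r * k) ^ (r * k) := by
    rw [Fintype.card_fun, Fintype.card_lex, Fintype.card_prod, Fintype.card_fin, Fintype.card_fin]
  rw [this]

/-- The total weight of the pairs of closed walks with a common edge. -/
theorem sum_sharing_le (hA : ∀ u, (univ.filter fun v => s(u, v) ∈ A).card = b)
    (hb : 1 ≤ b) (hbn : b ≤ Fintype.card V) {k : ℕ} [NeZero k]
    (F : Finset ((Fin k → V) × (Fin k → V)))
    (hF : ∀ p ∈ F, (∀ q, stepEdge p.1 q ∈ A) ∧ (∀ q, stepEdge p.2 q ∈ A) ∧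
      ∃ q q', stepEdge p.1 q = stepEdge p.2 q') :
    (1 / √(b : ℝ)) ^ (k + k) * ∑ p ∈ F, (1 / √(Fintype.card V : ℝ)) ^
        singles (Sum.elim (stepEdge p.1) (stepEdge p.2)) ≤
      (k * k * (k + k) ^ (k + k) : ℕ) * ((Fintype.card V : ℝ) / b) := by
  -- A common edge yields a common vertex. Rotating both walks to start there and concatenating them
  -- gives one closed walk of length `k + k`, which is not good, so the tuple bound with `r = 1`
  -- applies.
  have hmeet : ∀ p : (Fin k → V) × (Fin k → V), ∃ ij : Fin k × Fin k, p ∈ F →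
      p.1 ij.1 = p.2 ij.2 := by
    intro p
    by_cases hp : p ∈ F
    · obtain ⟨-, -, q, q', h⟩ := hF p hp
      rcases Sym2.eq_iff.1 h with h | h
      · exact ⟨(q, q'), fun _ => h.1⟩
      · exact ⟨(q, q' + 1), fun _ => h.1⟩
    · exact ⟨(0, 0), fun h => absurd h hp⟩
  choose m hm using hmeet
  let rot : Fin k → (Fin k → V) → (Fin k → V) := fun i t q => t (q + i)
  have hrot : ∀ i t, stepEdge (rot i t) = stepEdge t ∘ Equiv.addRight i := by
    intro i t
    funext q
    simp [stepEdge, rot, add_right_comm]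
  have hrotinj : ∀ i, Function.Injective (rot i) := by
    intro i t t' h
    funext q
    simpa [rot] using congrFun h (q - i)
  let U : Fin k × Fin k → (Fin k → V) × (Fin k → V) → (Fin 1 → Fin (k + k) → V) := fun ij p _ =>
    Fin.append (rot ij.1 p.1) (rot ij.2 p.2)
  have hUinj : ∀ ij, Function.Injective (U ij) := by
    intro ij p p' h
    have h0 := congrFun h 0
    refine Prod.ext (hrotinj ij.1 ?_) (hrotinj ij.2 ?_)
    · funext q
      simpa [U] using congrFun h0 (Fin.castAdd k q)
    · funext q
      have := congrFun h0 (Fin.natAdd k q)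
      simpa only [U, Fin.append_right] using this
  have hsing : ∀ ij, ∀ p ∈ F, m p = ij → singles (tupleEdge (U ij p)) =
      singles (Sum.elim (stepEdge p.1) (stepEdge p.2)) := by
    rintro ij p hp rfl
    have h1 : tupleEdge (U (m p) p) = stepEdge (U (m p) p 0) ∘ Equiv.uniqueProd (Fin (k + k)) (Fin 1) := by
      funext ⟨j, q⟩
      simp [tupleEdge, U]
    have h2 : Sum.elim (stepEdge (rot (m p).1 p.1)) (stepEdge (rot (m p).2 p.2)) =
        Sum.elim (stepEdge p.1) (stepEdge p.2) ∘
          Equiv.sumCongr (Equiv.addRight (m p).1) (Equiv.addRight (m p).2) := by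
      rw [hrot, hrot]
      funext x
      rcases x with x | x <;> rfl
    rw [h1, singles_comp_equiv, ← singles_comp_equiv _ finSumFinEquiv,
      stepEdge_append _ _ (by simpa [rot] using hm p hp), h2, singles_comp_equiv]
  have hfib : ∀ ij, (1 / √(b : ℝ)) ^ (k + k) * ∑ p ∈ F with m p = ij,
      (1 / √(Fintype.card V : ℝ)) ^ singles (Sum.elim (stepEdge p.1) (stepEdge p.2)) ≤
      ((k + k) ^ (k + k) : ℕ) * ((Fintype.card V : ℝ) / b) := by
    intro ij
    have := sum_tuple_le (r := 1) (k := k + k) hA hb hbn ((F.filter fun p => m p = ij).image (U ij)) ?_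
    · rw [Finset.sum_image ((hUinj ij).injOn), one_mul, pow_one] at this
      refine le_trans (le_of_eq ?_) this
      congr 1
      refine Finset.sum_congr rfl fun p hp => ?_
      rw [hsing ij p (mem_filter.1 hp).1 (mem_filter.1 hp).2]
    · intro T hT
      obtain ⟨p, hp, rfl⟩ := Finset.mem_image.1 hT
      obtain ⟨hpF, rfl⟩ := mem_filter.1 hp
      have h0 : rot (m p).1 p.1 0 = rot (m p).2 p.2 0 := by simpa [rot] using hm p hpF
      obtain ⟨h1, h2, q, q', h3⟩ := hF p hpF
      refine ⟨fun j x => ?_, two_mul_card_vertices_le _ fun j => ?_⟩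
      · obtain ⟨y, rfl⟩ := finSumFinEquiv.surjective x
        have := congrFun (stepEdge_append _ _ h0) y
        simp only [Function.comp] at this
        rw [this, hrot, hrot]
        rcases y with y | y
        · exact h1 _
        · exact h2 _
      · refine not_isGood_append _ _ h0 (p := q - (m p).1) (p' := q' - (m p).2) ?_
        rw [hrot, hrot]
        simpa using h3
  rw [← Finset.sum_fiberwise F m, Finset.mul_sum]
  refine (Finset.sum_le_sum fun w _ => hfib w).trans (le_of_eq ?_)
  rw [Finset.sum_const, nsmul_eq_mul, Finset.card_univ, Fintype.card_prod, Fintype.card_fin]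
  push_cast
  ring

end TupleSum
end

noncomputable section

open scoped Classical
open Finset

/-! ### Dyck words as exploration codes of trees -/

section DyckPattern

open DyckStep

/-- The height reached by a path of up and down steps after `i` steps. -/
def height (L : List DyckStep) (i : ℕ) : ℤ := (L.take i).count U - (L.take i).count D

theorem height_zero (L : List DyckStep) : height L 0 = 0 := by simp [height]

theorem height_succ (L : List DyckStep) {i : ℕ} (hi : i < L.length) :
    height L (i + 1) = height L i + if L[i]? = some U then 1 else -1 := by
  unfold height
  rw [List.take_add_one, List.getElem?_eq_getElem hi]
  rcases L[i].dichotomy with h | h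
  · simp [h]; ring
  · simp [h]; ring

/-- The time at which the vertex occupied at time `i` is visited first, in a walk on a tree that
discovers a new vertex at each up step and returns towards the root at each down step. -/
def dyckPattern (L : List DyckStep) : (i : ℕ) → {j : ℕ // j ≤ i}
  | 0 => ⟨0, le_rfl⟩
  | i + 1 =>
    if L[i]? = some U then ⟨i + 1, le_rfl⟩
    else
      let p := dyckPattern L i
      let q := dyckPattern L (p.1 - 1)
      ⟨q.1, q.2.trans ((Nat.sub_le _ _).trans (p.2.trans (Nat.le_succ i)))⟩
termination_by i => i
decreasing_by
  · exact Nat.lt_succ_self i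
  · exact lt_of_le_of_lt (Nat.sub_le _ _) (Nat.lt_succ_of_le p.2)

theorem dyckPattern_zero (L : List DyckStep) : (dyckPattern L 0).1 = 0 := by
  rw [dyckPattern]

theorem dyckPattern_succ_of_up {L : List DyckStep} {i : ℕ} (h : L[i]? = some U) :
    (dyckPattern L (i + 1)).1 = i + 1 := by
  rw [dyckPattern, if_pos h]

theorem dyckPattern_succ_of_not_up {L : List DyckStep} {i : ℕ} (h : L[i]? ≠ some U) :
    (dyckPattern L (i + 1)).1 = (dyckPattern L ((dyckPattern L i).1 - 1)).1 := by
  rw [dyckPattern, if_neg h]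

/-- Up steps create the value `i + 1` and all other steps copy an earlier value, so every nonzero
value is the time just after an up step. -/
theorem up_of_dyckPattern_ne_zero (L : List DyckStep) (i : ℕ) (h : (dyckPattern L i).1 ≠ 0) :
    L[(dyckPattern L i).1 - 1]? = some U := by
  induction i using Nat.strong_induction_on with
  | _ i ih =>
    rcases i with _ | i
    · exact absurd (dyckPattern_zero L) h
    · by_cases hu : L[i]? = some U
      · rw [dyckPattern_succ_of_up hu]; simpa using hu
      · rw [dyckPattern_succ_of_not_up hu] at h ⊢
        exact ih _ (by have := (dyckPattern L i).2; omega) h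

theorem dyckPattern_idem (L : List DyckStep) (i : ℕ) :
    (dyckPattern L (dyckPattern L i).1).1 = (dyckPattern L i).1 := by
  by_cases h : (dyckPattern L i).1 = 0
  · rw [h, dyckPattern_zero]
  · have hu := up_of_dyckPattern_ne_zero L i h
    obtain ⟨m, hm⟩ := Nat.exists_eq_succ_of_ne_zero h
    rw [hm] at hu ⊢
    exact dyckPattern_succ_of_up (by simpa using hu)

theorem DyckWord.height_nonneg (d : DyckWord) (i : ℕ) : 0 ≤ height d.toList i := by
  have := d.count_D_le_count_U i
  unfold height
  omega

theorem DyckWord.height_length (d : DyckWord) : height d.toList d.toList.length = 0 := by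
  have := d.count_U_eq_count_D
  unfold height
  rw [List.take_length]
  omega

/-- A down step moves from the vertex discovered at time `p` to the one occupied at time `p - 1`,
which is one lower; nonnegative heights exclude a down step at the root. -/
theorem DyckWord.height_dyckPattern (d : DyckWord) (i : ℕ) (hi : i ≤ d.toList.length) :
    height d.toList (dyckPattern d.toList i).1 = height d.toList i := by
  induction i using Nat.strong_induction_on with
  | _ i ih =>
    rcases i with _ | i
    · rw [dyckPattern_zero]
    · have hlt : i < d.toList.length := hi
      by_cases hu : d.toList[i]? = some U
      · rw [dyckPattern_succ_of_up hu]
      · rw [dyckPattern_succ_of_not_up hu, height_succ _ hlt, if_neg hu]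
        have hi' := ih i (by omega) hlt.le
        have hle := (dyckPattern d.toList i).2
        rw [ih _ (by omega) (by omega)]
        have hn := d.height_nonneg (i + 1)
        rw [height_succ _ hlt, if_neg hu] at hn
        by_cases h0 : (dyckPattern d.toList i).1 = 0
        · rw [h0, height_zero] at hi'
          omega
        · have hup := up_of_dyckPattern_ne_zero _ _ h0
          have := height_succ d.toList (i := (dyckPattern d.toList i).1 - 1) (by omega)
          rw [if_pos hup, Nat.sub_add_cancel (by omega)] at this
          omega

theorem DyckWord.dyckPattern_ne_zero (d : DyckWord) {i : ℕ} (hi : i < d.toList.length)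
    (hu : d.toList[i]? ≠ some U) : (dyckPattern d.toList i).1 ≠ 0 := by
  intro h0
  have hn := d.height_nonneg (i + 1)
  have := d.height_dyckPattern i hi.le
  rw [h0, height_zero] at this
  rw [height_succ _ hi, if_neg hu] at hn
  omega

/-- Otherwise the vertex at the end was discovered by an up step arriving at height `0`, hence
leaving from height `-1`. -/
theorem DyckWord.dyckPattern_length (d : DyckWord) :
    (dyckPattern d.toList d.toList.length).1 = 0 := by
  by_contra h0
  have hup := up_of_dyckPattern_ne_zero _ _ h0
  have hle := (dyckPattern d.toList d.toList.length).2
  have h1 := height_succ d.toList (i := (dyckPattern d.toList d.toList.length).1 - 1) (by omega)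
  rw [if_pos hup, Nat.sub_add_cancel (by omega), d.height_dyckPattern _ le_rfl,
    d.height_length] at h1
  have := d.height_nonneg ((dyckPattern d.toList d.toList.length).1 - 1)
  omega

theorem DyckWord.succ_ne_length_of_up (d : DyckWord) {i : ℕ} (hi : i < d.toList.length)
    (hu : d.toList[i]? = some U) : i + 1 < d.toList.length := by
  by_contra h
  have h1 : i + 1 = d.toList.length := by omega
  have h2 := height_succ _ hi
  rw [if_pos hu, h1, d.height_length] at h2
  have := d.height_nonneg i
  omega

theorem card_filter_getElem?_eq (L : List DyckStep) {k : ℕ} (hL : L.length = k) :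
    (univ.filter fun p : Fin k => L[p.val]? = some U).card = L.count U := by
  have := Fin.card_filter_univ_eq_vector_get_eq_count U (⟨L, hL⟩ : List.Vector DyckStep k)
  rw [List.Vector.toList_mk] at this
  rw [← this]
  congr 1
  refine Finset.filter_congr fun p _ => ?_
  have hp : p.val < L.length := by rw [hL]; exact p.2
  simp [List.Vector.get, List.getElem?_eq_getElem hp]

end DyckPattern

/-! ### Correspondence between good walks and Dyck words -/

section WalkWord

open DyckStep

variable {V : Type*} {k : ℕ} [NeZero k]

theorem Fin.ofNat_succ_eq (i : ℕ) : Fin.ofNat k (i + 1) = Fin.ofNat k i + 1 := by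
  ext; simp [Fin.ofNat, Fin.val_add]

theorem Fin.ofNat_val_eq (q : Fin k) : Fin.ofNat k q.val = q := by
  ext; simp [Fin.ofNat, Nat.mod_eq_of_lt q.2]

theorem Fin.val_sub_one_of_ne {q : Fin k} (hq : q ≠ 0) : (q - 1).val = q.val - 1 := by
  have := Fin.sub_one_lt_self hq
  rw [Fin.lt_def] at this
  have h2 := Fin.val_add_one_of_lt' (i := q - 1) (by omega)
  rw [sub_add_cancel] at h2
  omega

theorem Fin.val_add_one_of_ne {q : Fin k} (hq : q + 1 ≠ 0) : (q + 1).val = q.val + 1 := by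
  have h1 := Fin.val_sub_one_of_ne hq
  rw [add_sub_cancel_right] at h1
  rw [h1, Nat.sub_add_cancel]
  rw [Nat.one_le_iff_ne_zero]
  exact fun h => hq (Fin.val_eq_zero_iff.1 h)

/-- The step `p` of the walk `t` enters a new vertex. -/
def IsUp (t : Fin k → V) (p : Fin k) : Prop := p + 1 ≠ 0 ∧ IsNew t (p + 1)

/-- The sequence of up steps (to new vertices) and down steps of a closed walk. -/
def walkWord (t : Fin k → V) : List DyckStep := List.ofFn fun p => if IsUp t p then U else D

theorem length_walkWord (t : Fin k → V) : (walkWord t).length = k := by simp [walkWord]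

theorem walkWord_getElem? (t : Fin k → V) (p : Fin k) :
    (walkWord t)[p.val]? = some U ↔ IsUp t p := by
  unfold walkWord
  rw [List.getElem?_ofFn, dif_pos p.2]
  by_cases h : IsUp t p <;> simp [h]

/-- The down steps of a good walk return along the edge on which the current vertex was
discovered. -/
theorem IsGood.exists_of_not_isUp {t : Fin k → V} (ht : IsGood t) {p : Fin k} (hp : ¬ IsUp t p) :
    ∃ q, q ≠ 0 ∧ IsNew t q ∧ t p = t q ∧ t (p + 1) = t (q - 1) := by
  obtain ⟨q, hq0, hq, he⟩ := ht.1 p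
  rcases Sym2.eq_iff.1 he with ⟨h1, h2⟩ | ⟨h1, h2⟩
  -- A second traversal in the direction of discovery would force multiplicity at least `4`.
  · exfalso
    have hne : p ≠ q - 1 := by
      rintro rfl
      exact hp ⟨by simpa using hq0, by simpa using hq⟩
    have hm := ht.2 p
    rw [he, ht.1.mult_eq hq0 hq] at hm
    have : 2 ≤ (univ.filter fun p => t p = t (q - 1) ∧ t (p + 1) = t q).card := by
      rw [← Finset.card_pair hne]
      refine Finset.card_le_card fun x hx => ?_
      simp only [mem_insert, mem_singleton] at hx
      rcases hx with rfl | rfl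
      · simp [h1, h2]
      · simp
    omega
  · exact ⟨q, hq0, hq, h1, h2⟩

/-- The height of the word is the depth of the current vertex in the tree, that is, the potential
with increment `1` along every tree edge. It is nonnegative and returns to zero. -/
theorem IsGood.exists_dyckWord {t : Fin k → V} (ht : IsGood t) :
    ∃ d : DyckWord, d.toList = walkWord t := by
  obtain ⟨h, h0, hh⟩ := exists_potential t fun _ => 1
  have hnn : ∀ q, 0 ≤ h (t q) := by
    intro q
    induction q using WellFoundedLT.induction with
    | _ q ih =>
      by_cases hq0 : q = 0
      · rw [hq0, h0]
      · by_cases hq : IsNew t q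
        · rw [hh q hq0 hq]
          have := ih _ (Fin.sub_one_lt_self hq0)
          omega
        · simp only [IsNew, not_forall, not_not] at hq
          obtain ⟨p, hp, hx⟩ := hq
          rw [← hx]
          exact ih p hp
  have key : ∀ i ≤ k, height (walkWord t) i = h (t (Fin.ofNat k i)) := by
    intro i
    induction i with
    | zero =>
      intro _
      rw [height_zero, show Fin.ofNat k 0 = 0 by ext; simp [Fin.ofNat], h0]
    | succ i ih =>
      intro hi
      rw [height_succ _ (by rw [length_walkWord]; omega), ih (by omega), Fin.ofNat_succ_eq]
      have hval : (Fin.ofNat k i).val = i := by simp [Fin.ofNat, Nat.mod_eq_of_lt hi]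
      have hw := walkWord_getElem? t (Fin.ofNat k i)
      rw [hval] at hw
      by_cases hu : IsUp t (Fin.ofNat k i)
      · rw [if_pos (hw.2 hu), hh _ hu.1 hu.2]
        simp
      · rw [if_neg (mt hw.1 hu)]
        obtain ⟨q, hq0, hq, h1, h2⟩ := ht.exists_of_not_isUp hu
        rw [h1, h2, hh q hq0 hq]
        simp
  refine ⟨⟨walkWord t, ?_, fun i => ?_⟩, rfl⟩
  · have := key k le_rfl
    rw [show Fin.ofNat k k = 0 by ext; simp [Fin.ofNat], h0] at this
    unfold height at this
    rw [List.take_of_length_le (length_walkWord t).le] at this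
    omega
  · by_cases hi : i ≤ k
    · have h1 := key i hi
      have h2 := hnn (Fin.ofNat k i)
      unfold height at h1
      omega
    · have := key k le_rfl
      rw [show Fin.ofNat k k = 0 by ext; simp [Fin.ofNat], h0] at this
      unfold height at this
      rw [List.take_of_length_le (length_walkWord t).le] at this
      rw [List.take_of_length_le (by rw [length_walkWord]; omega)]
      omega

/-- A down step from a vertex discovered at time `q` leads to its parent `t (q - 1)`, which is
exactly the recursion defining `dyckPattern`. -/
theorem IsGood.firstIdx_eq {t : Fin k → V} (ht : IsGood t) (i : ℕ) (hi : i < k) :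
    (firstIdx t ⟨i, hi⟩).val = (dyckPattern (walkWord t) i).1 := by
  induction i using Nat.strong_induction_on with
  | _ i ih =>
    rcases i with _ | i
    · rw [dyckPattern_zero]
      have := firstIdx_le t ⟨0, hi⟩
      rw [Fin.le_def] at this
      simpa using this
    · set p : Fin k := ⟨i, by omega⟩ with hp
      have hp1 : (⟨i + 1, hi⟩ : Fin k) = p + 1 := by
        ext
        rw [Fin.val_add_one_of_lt' (by simpa [hp] using hi)]
      have hw := walkWord_getElem? t p
      rw [hp1]
      by_cases hu : IsUp t p
      · rw [dyckPattern_succ_of_up (hw.2 hu), firstIdx_eq_self_iff.2 hu.2, ← hp1]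
      · rw [dyckPattern_succ_of_not_up (mt hw.1 hu)]
        obtain ⟨q, hq0, hq, h1, h2⟩ := ht.exists_of_not_isUp hu
        have hpq : firstIdx t p = q := firstIdx_eq_iff.2 ⟨hq, h1.symm⟩
        have hqp : q ≤ p := hpq ▸ firstIdx_le t p
        rw [← ih i (by omega) (by omega), hpq]
        have hq1 : q - 1 = ⟨q.val - 1, by omega⟩ := by
          ext
          exact Fin.val_sub_one_of_ne hq0
        rw [Fin.le_def] at hqp
        have hpv : p.val = i := rfl
        rw [← ih (q.val - 1) (by omega) (by omega), ← hq1]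
        congr 1
        exact firstIdx_eq_iff.2 ⟨isNew_firstIdx _ _, (apply_firstIdx _ _).trans h2.symm⟩

/-- The `k / 2` up steps account for all the edges, one each, and every edge has positive even
multiplicity. Since multiplicities sum to `k`, all equal `2`. -/
theorem IsTreeWalk.isGood_of_card {t : Fin k → V} (ht : IsTreeWalk t)
    (hk : 2 * (univ.filter (IsUp t)).card = k) : IsGood t := by
  refine ⟨ht, ?_⟩
  have himg : univ.image (stepEdge t) = (univ.filter (IsUp t)).image (stepEdge t) := by
    ext e
    simp only [mem_image, mem_univ, true_and, mem_filter]
    constructor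
    · rintro ⟨p, rfl⟩
      obtain ⟨q, hq0, hq, he⟩ := ht p
      exact ⟨q - 1, ⟨by simpa using hq0, by simpa using hq⟩, by rw [he, stepEdge_sub_one]⟩
    · rintro ⟨p, -, rfl⟩
      exact ⟨p, rfl⟩
  have hcard : 2 * (univ.image (stepEdge t)).card ≤ k := by
    rw [himg]
    have := Finset.card_image_le (s := univ.filter (IsUp t)) (f := stepEdge t)
    omega
  have hpt : ∀ e ∈ univ.image (stepEdge t), 2 ≤ mult (stepEdge t) e := by
    intro e he
    obtain ⟨p, -, rfl⟩ := Finset.mem_image.1 he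
    obtain ⟨c, hc⟩ := ht.even_mult p
    have := mult_pos (stepEdge t) p
    omega
  have hsum : ∑ e ∈ univ.image (stepEdge t), mult (stepEdge t) e =
      ∑ e ∈ univ.image (stepEdge t), 2 := by
    refine le_antisymm ?_ (Finset.sum_le_sum hpt)
    rw [sum_mult, Fintype.card_fin, Finset.sum_const, smul_eq_mul]
    have hinj : Set.InjOn (stepEdge t) (univ.filter (IsUp t) : Finset (Fin k)) := by
      have aux : ∀ p p' : Fin k, IsUp t p → IsUp t p' → p + 1 < p' + 1 →
          stepEdge t p ≠ stepEdge t p' := by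
        intro p p' hp hp' hlt he
        have hmem : t (p' + 1) ∈ stepEdge t p := by rw [he]; simp [stepEdge]
        rw [stepEdge, Sym2.mem_iff] at hmem
        rcases hmem with h | h
        · refine hp'.2 p (lt_trans ?_ hlt) h.symm
          simpa using Fin.sub_one_lt_self hp.1
        · exact hp'.2 _ hlt h.symm
      intro p hp p' hp' he
      have hp : IsUp t p := by simpa using hp
      have hp' : IsUp t p' := by simpa using hp'
      rcases lt_trichotomy (p + 1) (p' + 1) with h | h | h
      · exact absurd he (aux p p' hp hp' h)
      · exact add_right_cancel h
      · exact absurd he.symm (aux p' p hp' hp h)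
    rw [himg, Finset.card_image_of_injOn hinj]
    omega
  intro p
  exact ((Finset.sum_eq_sum_iff_of_le hpt).1 hsum.symm _ (mem_image_of_mem _ (mem_univ p))).symm

/-- The converse of `IsGood.firstIdx_eq`: up steps are those of the word and every other step goes
back along the discovery edge of the current vertex, so the walk is a tree walk in which half of the
steps are up. -/
theorem isGood_of_firstIdx_eq (d : DyckWord) (hd : d.toList.length = k) {x : Fin k → V}
    (hx : ∀ q : Fin k, (firstIdx x q).val = (dyckPattern d.toList q.val).1) :
    IsGood x ∧ walkWord x = d.toList := by
  -- Time `k` is included: it wraps around to `0`, and the pattern of a Dyck word ends at `0`.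
  have hfirst : ∀ i ≤ k, x (Fin.ofNat k i) = x (Fin.ofNat k (dyckPattern d.toList i).1) := by
    intro i hi
    rcases hi.eq_or_lt with rfl | hlt
    · have h0 := d.dyckPattern_length
      rw [hd] at h0
      rw [h0]
      congr 1
      ext; simp [Fin.ofNat]
    · have := hx ⟨i, hlt⟩
      simp only at this
      rw [← this, Fin.ofNat_val_eq, apply_firstIdx x]
      congr 1
      ext; simp [Fin.ofNat, Nat.mod_eq_of_lt hlt]
  have hUp : ∀ q : Fin k, IsUp x q ↔ d.toList[q.val]? = some U := by
    intro q
    constructor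
    · rintro ⟨h1, h2⟩
      by_contra hu
      have hv := Fin.val_add_one_of_ne h1
      have h3 := hx (q + 1)
      rw [firstIdx_eq_self_iff.2 h2, hv, dyckPattern_succ_of_not_up hu] at h3
      have h4 := (dyckPattern d.toList ((dyckPattern d.toList q.val).1 - 1)).2
      have h5 := (dyckPattern d.toList q.val).2
      omega
    · intro hu
      have hlt := d.succ_ne_length_of_up (by rw [hd]; exact q.2) hu
      rw [hd] at hlt
      have hv := Fin.val_add_one_of_lt' hlt
      refine ⟨fun h => ?_, ?_⟩
      · rw [h] at hv; simp at hv
      · rw [← firstIdx_eq_self_iff]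
        ext
        rw [hx, hv, dyckPattern_succ_of_up hu]
  have htree : IsTreeWalk x := by
    intro q
    by_cases hu : IsUp x q
    · exact ⟨q + 1, hu.1, hu.2, by simp [stepEdge]⟩
    · have hu' := mt (hUp q).2 hu
      have hq : q.val < d.toList.length := by rw [hd]; exact q.2
      have hne := d.dyckPattern_ne_zero hq hu'
      have hle := (dyckPattern d.toList q.val).2
      have hf0 : firstIdx x q ≠ 0 := by
        intro h
        rw [← hx, h] at hne
        simp at hne
      refine ⟨firstIdx x q, hf0, isNew_firstIdx _ _, ?_⟩
      rw [stepEdge, apply_firstIdx x, Sym2.eq_swap]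
      suffices h : x (q + 1) = x (firstIdx x q - 1) by rw [h]
      have h1 := hfirst (q.val + 1) q.2
      rw [Fin.ofNat_succ_eq, Fin.ofNat_val_eq, dyckPattern_succ_of_not_up hu',
        ← hfirst _ (by omega)] at h1
      rw [h1]
      congr 1
      ext
      rw [Fin.val_sub_one_of_ne hf0, hx]
      simp only [Fin.ofNat]
      exact Nat.mod_eq_of_lt (by omega)
  have hword : walkWord x = d.toList := by
    refine List.ext_getElem? fun i => ?_
    by_cases hi : i < k
    · have h1 := (walkWord_getElem? x ⟨i, hi⟩).trans (hUp ⟨i, hi⟩)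
      simp only at h1
      have hi1 : i < (walkWord x).length := by rw [length_walkWord]; exact hi
      have hi2 : i < d.toList.length := by rw [hd]; exact hi
      rw [List.getElem?_eq_getElem hi1, List.getElem?_eq_getElem hi2] at h1 ⊢
      simp only [Option.some.injEq] at h1 ⊢
      rcases DyckStep.dichotomy (walkWord x)[i] with h | h <;>
        rcases DyckStep.dichotomy d.toList[i] with h' | h' <;> simp_all
    · rw [List.getElem?_eq_none (by rw [length_walkWord]; omega),
        List.getElem?_eq_none (by omega)]
  refine ⟨htree.isGood_of_card ?_, hword⟩
  have h1 : (univ.filter (IsUp x)).card = d.toList.count U := by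
    rw [← card_filter_getElem?_eq _ hd]
    congr 1
    ext p
    simp [hUp]
  rw [h1]
  exact d.two_mul_semilength_eq_length.trans hd

end WalkWord

/-! ### Asymptotic number of good walks -/

section CountGood

open DyckStep

variable {V : Type*} [Fintype V] {A : Set (Sym2 V)} {b k : ℕ}

/-- The good closed walks of length `k` along the edges in `A`. -/
def goodWalks (A : Set (Sym2 V)) (k : ℕ) [NeZero k] : Finset (Fin k → V) :=
  univ.filter fun t => IsGood t ∧ ∀ q, stepEdge t q ∈ A

theorem mem_goodWalks [NeZero k] {t : Fin k → V} :
    t ∈ goodWalks A k ↔ IsGood t ∧ ∀ q, stepEdge t q ∈ A := by simp [goodWalks]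

theorem goodWalks_eq_empty_of_odd [NeZero k] (hk : Odd k) : goodWalks A k = ∅ := by
  rw [Finset.eq_empty_iff_forall_notMem]
  intro t ht
  obtain ⟨d, hd⟩ := (mem_goodWalks.1 ht).1.exists_dyckWord
  have := d.two_mul_semilength_eq_length
  rw [hd, length_walkWord] at this
  exact (Nat.not_even_iff_odd.2 hk) ⟨d.semilength, by omega⟩

/-- `dyckPattern` as a map on the times of a walk of length `k`. -/
def dyckIdx (d : DyckWord) (k : ℕ) (i : Fin k) : Fin k :=
  ⟨(dyckPattern d.toList i.val).1, (dyckPattern d.toList i.val).2.trans_lt i.2⟩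

theorem dyckIdx_le (d : DyckWord) (i : Fin k) : dyckIdx d k i ≤ i :=
  (dyckPattern d.toList i.val).2

theorem dyckIdx_idem (d : DyckWord) (i : Fin k) : dyckIdx d k (dyckIdx d k i) = dyckIdx d k i :=
  Fin.ext (dyckPattern_idem _ _)

variable [NeZero k]

theorem card_dyckIdx_eq_and_mem (d : DyckWord) :
    Nat.card {i // dyckIdx d k i = i ∧ i ∈ ({0} : Set (Fin k))} = 1 := by
  rw [Nat.card_eq_fintype_card, Fintype.card_subtype, Finset.card_eq_one]
  refine ⟨0, ?_⟩
  ext i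
  simp only [Set.mem_singleton_iff, mem_filter, mem_univ, true_and, mem_singleton,
    and_iff_right_iff_imp]
  rintro rfl
  exact nonpos_iff_eq_zero.1 (dyckIdx_le d 0)

/-- Apart from `0`, the times at which a new vertex appears are the successors of up steps. -/
theorem card_dyckIdx_eq_and_notMem (d : DyckWord) (hd : d.toList.length = k) :
    Nat.card {i // dyckIdx d k i = i ∧ i ∉ ({0} : Set (Fin k))} = d.semilength := by
  rw [Nat.card_eq_fintype_card, Fintype.card_subtype, DyckWord.semilength, ← card_filter_getElem?_eq _ hd]
  symm
  refine Finset.card_equiv (Equiv.addRight (1 : Fin k)) fun p => ?_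
  simp only [mem_filter, mem_univ, true_and, Equiv.coe_addRight, Set.mem_singleton_iff]
  constructor
  · intro hu
    have hlt := d.succ_ne_length_of_up (by rw [hd]; exact p.2) hu
    rw [hd] at hlt
    have hv := Fin.val_add_one_of_lt' hlt
    refine ⟨?_, fun h => ?_⟩
    · ext
      simp only [dyckIdx]
      rw [hv, dyckPattern_succ_of_up hu]
    · rw [h] at hv; simp at hv
  · rintro ⟨h1, h2⟩
    have hv := Fin.val_add_one_of_ne h2
    have h3 := congrArg Fin.val h1
    simp only [dyckIdx] at h3
    have := up_of_dyckPattern_ne_zero d.toList (p + 1).val (by omega)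
    rw [h3, hv] at this
    simpa using this

theorem card_goodWalks_word_le (hA : ∀ u, (univ.filter fun v => s(u, v) ∈ A).card = b)
    (d : DyckWord) (hd : d.toList.length = k) :
    ((goodWalks A k).filter fun t => walkWord t = d.toList).card ≤
      Fintype.card V * b ^ d.semilength := by
  have h := card_le_of_hasPattern (I := Fin k) (w := dyckIdx d k) (pred := fun q => q - 1)
    (S := {0}) hA (dyckIdx_le d) (fun i hi => Fin.sub_one_lt_self hi)
    ((goodWalks A k).filter fun t => walkWord t = d.toList) ?_
  · rw [card_dyckIdx_eq_and_mem, card_dyckIdx_eq_and_notMem d hd, pow_one] at h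
    exact h
  · intro t ht
    obtain ⟨ht1, ht2⟩ := mem_filter.1 ht
    obtain ⟨hg, hgA⟩ := mem_goodWalks.1 ht1
    intro i
    refine ⟨fun _ => ?_, fun _ _ => ?_⟩
    · have : firstIdx t i = dyckIdx d k i := by
        ext
        rw [hg.firstIdx_eq i.val i.2, ht2]
        rfl
      rw [← this, apply_firstIdx t]
    · have := hgA (i - 1)
      rwa [stepEdge_sub_one] at this

/-- A sequence with the pattern of `d` is a good walk with word `d` unless a freshly chosen vertex
coincides with an earlier one. Each of the at most `k * k` possible coincidences costs one free
choice, hence a factor `b`. -/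
theorem le_card_goodWalks_word (hA : ∀ u, (univ.filter fun v => s(u, v) ∈ A).card = b)
    (d : DyckWord) (hd : d.toList.length = k) :
    Fintype.card V * b ^ d.semilength ≤
      ((goodWalks A k).filter fun t => walkWord t = d.toList).card +
        k * k * (Fintype.card V * b ^ (d.semilength - 1)) := by
  have hpred : ∀ i : Fin k, i ∉ ({0} : Set (Fin k)) → i - 1 < i := fun i hi =>
    Fin.sub_one_lt_self hi
  have hHP := natCard_hasPattern (I := Fin k) (w := dyckIdx d k) (pred := fun q => q - 1)
    (S := {0}) hA (dyckIdx_le d) hpred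
  rw [card_dyckIdx_eq_and_mem, card_dyckIdx_eq_and_notMem d hd, pow_one,
    Nat.card_eq_fintype_card, Fintype.card_subtype] at hHP
  set w := dyckIdx d k with hw
  set HP : Finset (Fin k → V) := univ.filter fun x => HasPattern A w (fun q => q - 1) {0} x
    with hHPdef
  let B : Fin k × Fin k → Finset (Fin k → V) := fun ij =>
    if ij.1 < ij.2 ∧ w ij.2 = ij.2 then HP.filter fun x => x ij.1 = x ij.2 else ∅
  have hB : ∀ ij, (B ij).card ≤ Fintype.card V * b ^ (d.semilength - 1) := by
    rintro ⟨i, j⟩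
    by_cases hij : i < j ∧ w j = j
    · have hj0 : j ≠ 0 := by
        rintro rfl
        exact absurd hij.1 (by simp)
      -- The coincidence `x i = x j` turns the free index `j` into a repetition of `i`.
      have h := card_le_of_hasPattern (I := Fin k) (w := Function.update w j i)
        (pred := fun q => q - 1) (S := {0}) hA ?_ hpred (B (i, j)) ?_
      · have h1 : Nat.card {q // Function.update w j i q = q ∧
            q ∈ ({0} : Set (Fin k))} = 1 := by
          rw [← card_dyckIdx_eq_and_mem (k := k) d]
          refine Nat.card_congr (Equiv.subtypeEquivRight fun q => ?_)
          simp only [Set.mem_singleton_iff, and_congr_left_iff]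
          rintro rfl
          rw [Function.update_of_ne hj0.symm]
        have h2 : Nat.card {q // Function.update w j i q = q ∧
            q ∉ ({0} : Set (Fin k))} = d.semilength - 1 := by
          rw [← card_dyckIdx_eq_and_notMem d hd, Nat.card_eq_fintype_card,
            Nat.card_eq_fintype_card, Fintype.card_subtype, Fintype.card_subtype]
          rw [← Finset.card_erase_of_mem (a := j) (by simpa [hj0] using hij.2)]
          congr 1
          ext q
          simp only [mem_filter, mem_univ, true_and, mem_erase]
          by_cases hq : q = j
          · subst hq
            simp [hij.1.ne]
          · rw [Function.update_of_ne hq]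
            simp [hq, hw]
        rwa [h1, h2, pow_one] at h
      · intro q
        by_cases hq : q = j
        · subst hq; simpa using hij.1.le
        · rw [Function.update_of_ne hq]; exact dyckIdx_le d q
      · intro x hx
        simp only [B, if_pos hij, mem_filter, hHPdef, mem_univ, true_and] at hx
        intro q
        by_cases hq : q = j
        · subst hq
          simp only [Function.update_self]
          exact ⟨fun _ => hx.2.symm, fun h => absurd h hij.1.ne⟩
        · rw [Function.update_of_ne hq]
          exact hx.1 q
    · simp [B, hij]
  have hsub : HP ⊆ ((goodWalks A k).filter fun t => walkWord t = d.toList) ∪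
      univ.biUnion B := by
    intro x hx
    have hxP : HasPattern A w (fun q => q - 1) {0} x := by simpa [hHPdef] using hx
    have hxw : ∀ q, x q = x (w q) := by
      intro q
      by_cases h : w q = q
      · rw [h]
      · exact (hxP q).1 h
    rw [mem_union]
    by_cases hc : ∃ i j, i < j ∧ w j = j ∧ x i = x j
    · right
      obtain ⟨i, j, hij, hj, hxij⟩ := hc
      rw [mem_biUnion]
      refine ⟨(i, j), mem_univ _, ?_⟩
      simp [B, hij, hj, hx, hxij]
    · left
      push Not at hc
      have hfirst : ∀ q, firstIdx x q = w q := by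
        intro q
        exact firstIdx_eq_iff.2 ⟨fun p hp => hc p _ hp (dyckIdx_idem d q), (hxw q).symm⟩
      obtain ⟨hg, hword⟩ := isGood_of_firstIdx_eq d hd (x := x) fun q => by rw [hfirst]; rfl
      refine mem_filter.2 ⟨mem_goodWalks.2 ⟨hg, fun p => ?_⟩, hword⟩
      obtain ⟨q, hq0, hq, he⟩ := hg.1 p
      rw [he]
      exact (hxP q).2 (by rw [← hfirst, firstIdx_eq_self_iff.2 hq]) hq0
  calc Fintype.card V * b ^ d.semilength = HP.card := hHP.symm
    _ ≤ _ := Finset.card_le_card hsub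
    _ ≤ _ := Finset.card_union_le _ _
    _ ≤ _ := by
        gcongr
        refine (Finset.card_biUnion_le_card_mul _ _ _ fun ij _ => hB ij).trans ?_
        simp

/-- The Dyck words of semilength `m`, as lists. -/
def dyckLists (m : ℕ) : Finset (List DyckStep) :=
  (univ : Finset {d : DyckWord // d.semilength = m}).image fun d => d.1.toList

theorem card_dyckLists (m : ℕ) : (dyckLists m).card = catalan m := by
  rw [dyckLists, Finset.card_image_of_injective, Finset.card_univ,
    DyckWord.card_dyckWord_semilength_eq_catalan]
  intro d d' h
  exact Subtype.ext (DyckWord.ext h)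

theorem card_goodWalks_eq_sum {m : ℕ} (hk : k = 2 * m) :
    (goodWalks A k).card =
      ∑ L ∈ dyckLists m, ((goodWalks A k).filter fun t => walkWord t = L).card := by
  have h := Finset.card_eq_sum_card_fiberwise (f := walkWord) (s := goodWalks A k)
    (t := dyckLists m) ?_
  · convert h
  · intro t ht
    obtain ⟨d, hd⟩ := (mem_goodWalks.1 ht).1.exists_dyckWord
    have := d.two_mul_semilength_eq_length
    rw [hd, length_walkWord] at this
    exact Finset.mem_coe.2 (Finset.mem_image.2 ⟨⟨d, by omega⟩, mem_univ _, hd⟩)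

theorem card_goodWalks_le (hA : ∀ u, (univ.filter fun v => s(u, v) ∈ A).card = b)
    {m : ℕ} (hk : k = 2 * m) :
    (goodWalks A k).card ≤ catalan m * (Fintype.card V * b ^ m) := by
  rw [card_goodWalks_eq_sum hk, ← card_dyckLists m]
  refine Finset.sum_le_card_nsmul _ _ _ fun L hL => ?_
  obtain ⟨⟨d, rfl⟩, -, rfl⟩ := Finset.mem_image.1 hL
  exact card_goodWalks_word_le hA d (by rw [← d.two_mul_semilength_eq_length, hk])

theorem le_card_goodWalks (hA : ∀ u, (univ.filter fun v => s(u, v) ∈ A).card = b)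
    {m : ℕ} (hk : k = 2 * m) :
    catalan m * (Fintype.card V * b ^ m) ≤
      (goodWalks A k).card + catalan m * (k * k * (Fintype.card V * b ^ (m - 1))) := by
  rw [card_goodWalks_eq_sum hk, ← card_dyckLists m]
  rw [← smul_eq_mul (dyckLists m).card, ← smul_eq_mul (dyckLists m).card, ← Finset.sum_const,
    ← Finset.sum_const, ← Finset.sum_add_distrib]
  refine Finset.sum_le_sum fun L hL => ?_
  obtain ⟨⟨d, rfl⟩, -, rfl⟩ := Finset.mem_image.1 hL
  exact le_card_goodWalks_word hA d (by rw [← d.two_mul_semilength_eq_length, hk])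

end CountGood
end

noncomputable section

open scoped Classical
open Finset

/-! ### Traces of powers as sums over closed walks -/

section Trace

theorem trace_pow_eq_sum_eigenvalues {n : ℕ} {A : Matrix (Fin n) (Fin n) ℝ} (hA : A.IsHermitian)
    (k : ℕ) : (A ^ k).trace = ∑ i, hA.eigenvalues i ^ k := by
  conv_lhs => rw [hA.spectral_theorem, ← map_pow, Unitary.conjStarAlgAut_apply, Matrix.diagonal_pow,
    Matrix.trace_mul_cycle]
  simp [Matrix.trace_diagonal]

theorem pow_succ_apply_eq_sum {V : Type*} [Fintype V] [DecidableEq V] (A : Matrix V V ℝ) (m : ℕ)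
    (i j : V) : (A ^ (m + 1)) i j = ∑ t : Fin (m + 1) → V, if t 0 = i then
      (∏ q : Fin m, A (t q.castSucc) (t q.succ)) * A (t (Fin.last m)) j else 0 := by
  induction m generalizing i with
  | zero =>
    rw [← (Equiv.funUnique (Fin 1) V).symm.sum_comp]
    simp
  | succ m ih =>
    rw [pow_succ', Matrix.mul_apply, ← (Fin.consEquiv fun _ => V).sum_comp, Fintype.sum_prod_type]
    simp only [ih, Fin.consEquiv_apply, Fin.cons_zero, Finset.mul_sum, Fin.prod_univ_succ,
      Fin.castSucc_zero, Fin.cons_succ, ← Fin.succ_castSucc, ← Fin.succ_last]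
    rw [Finset.sum_comm]
    conv_rhs => rw [Finset.sum_comm]
    refine Finset.sum_congr rfl fun t _ => ?_
    simp [mul_ite, Finset.sum_ite_eq, mul_assoc]

theorem trace_pow_eq_sum_walks {V : Type*} [Fintype V] [DecidableEq V] (A : Matrix V V ℝ) (k : ℕ)
    [NeZero k] : (A ^ k).trace = ∑ t : Fin k → V, ∏ q, A (t q) (t (q + 1)) := by
  obtain ⟨m, rfl⟩ : ∃ m, k = m + 1 := ⟨k - 1, by have := NeZero.pos k; omega⟩
  simp only [Matrix.trace, Matrix.diag, pow_succ_apply_eq_sum]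
  rw [Finset.sum_comm]
  refine Finset.sum_congr rfl fun t _ => ?_
  rw [Finset.sum_ite_eq, if_pos (mem_univ _), Fin.prod_univ_castSucc]
  simp

end Trace

/-! ### Every row has exactly `b` relevant positions -/

section Band

/-- The unordered relevant pairs. -/
def bandEdges (n b : ℕ) : Set (Sym2 (Fin n)) :=
  {e | Sym2.lift ⟨Relevant n b, fun i j => propext (relevant_comm n b i j)⟩ e}

theorem mem_bandEdges {n b : ℕ} {i j : Fin n} : s(i, j) ∈ bandEdges n b ↔ Relevant n b i j :=
  Iff.rfl

theorem IsBandwidth.le {n b : ℕ} (h : IsBandwidth n b) : b ≤ n := by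
  rcases h with ⟨h, -⟩ | h <;> omega

theorem card_relevant {n b : ℕ} (hb : IsBandwidth n b) (i : Fin n) :
    (univ.filter fun j => s(i, j) ∈ bandEdges n b).card = b := by
  simp only [mem_bandEdges]
  rcases hb with ⟨hlt, h, rfl⟩ | rfl
  · have hh : ((2 * h + 1 : ℕ) - 1 : ℤ) / 2 = h := by push_cast; omega
    have hn : NeZero n := ⟨by omega⟩
    -- Relevance depends on the cyclic difference `j - i` only: it is among the `h + 1` smallest or
    -- the `h` largest residues, and these do not overlap as `2 * h + 1 < n`.
    have hval : ∀ j : Fin n, Relevant n (2 * h + 1) i j ↔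
        ((j - i).val ≤ h ∨ n - h ≤ (j - i).val) := by
      intro j
      unfold Relevant
      rw [hh, Fin.sub_def]
      have hi := i.2
      have hj := j.2
      simp only
      by_cases hij : i.val ≤ j.val
      · have : (n - i.val + j.val) % n = j.val - i.val := by
          rw [show n - i.val + j.val = j.val - i.val + n by omega, Nat.add_mod_right,
            Nat.mod_eq_of_lt (by omega)]
        rw [this, abs_sub_comm, abs_of_nonneg (by omega)]
        omega
      · have : (n - i.val + j.val) % n = n - i.val + j.val := Nat.mod_eq_of_lt (by omega)
        rw [this, abs_of_nonneg (by omega)]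
        omega
    simp only [hval]
    have h1 : (univ.filter fun j : Fin n => (j - i).val ≤ h ∨ n - h ≤ (j - i).val).card =
        (univ.filter fun d : Fin n => d.val ≤ h ∨ n - h ≤ d.val).card :=
      Finset.card_equiv (Equiv.subRight i) (by simp)
    rw [h1, Finset.filter_or, Finset.card_union_of_disjoint]
    · have h2 : (univ.filter fun d : Fin n => d.val ≤ h).card = h + 1 := by
        rw [← Finset.card_map Fin.valEmbedding, ← Finset.card_range (h + 1)]
        congr 1
        ext x
        simp only [Finset.mem_map, mem_filter, mem_univ, true_and, Fin.valEmbedding_apply, mem_range]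
        exact ⟨by rintro ⟨d, hd, rfl⟩; omega, fun hx => ⟨⟨x, by omega⟩, by simp; omega, rfl⟩⟩
      have h3 : (univ.filter fun d : Fin n => n - h ≤ d.val).card = h := by
        rw [← Finset.card_map Fin.valEmbedding]
        trans (Finset.Ico (n - h) n).card
        · congr 1
          ext x
          simp only [Finset.mem_map, mem_filter, mem_univ, true_and, Fin.valEmbedding_apply, mem_Ico]
          exact ⟨by rintro ⟨d, hd, rfl⟩; exact ⟨hd, d.2⟩, fun hx => ⟨⟨x, hx.2⟩, hx.1, rfl⟩⟩
        · simp; omega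
      rw [h2, h3]
      ring
    · rw [Finset.disjoint_filter]
      intro d _ h1
      omega
  · simp [Relevant]

end Band

/-! ### Expectations of products of entries -/

section Entries

variable {Ω : Type*} [MeasurableSpace Ω]

/-- The entry of the random matrix `a_n` at an unordered pair. -/
def edgeEntry (a : TriangularScheme Ω) (n : ℕ) (e : Sym2 (Fin n)) (ω : Ω) : ℝ :=
  Sym2.lift ⟨fun p q => a.entry n p q ω, fun p q => congrFun (a.symm n p q) ω⟩ e

theorem edgeEntry_mk (a : TriangularScheme Ω) (n : ℕ) (p q : Fin n) (ω : Ω) :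
    edgeEntry a n s(p, q) ω = a.entry n p q ω := rfl

theorem edgeEntry_out (a : TriangularScheme Ω) (n : ℕ) (e : Sym2 (Fin n)) (ω : Ω) :
    a.entry n (Quot.out e).1 (Quot.out e).2 ω = edgeEntry a n e ω := by
  rw [← edgeEntry_mk]
  congr 1
  exact Quot.out_eq e

theorem fundamentallyDifferent_out {n l : ℕ} {e : Fin l → Sym2 (Fin n)}
    (he : Function.Injective e) :
    FundamentallyDifferent fun i => ((Quot.out (e i)).1, (Quot.out (e i)).2) := by
  intro i j hij h
  refine hij (he ?_)
  have h1 : ∀ i, s((Quot.out (e i)).1, (Quot.out (e i)).2) = e i := fun i => Quot.out_eq (e i)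
  simpa only [h1] using h

/-- The point where `α ≥ 1/2` enters: a single edge costs at least `n^(-1/2)`. -/
theorem one_div_rpow_le {n s : ℕ} (hn : 1 ≤ n) {α : ℝ} (hα : 1 / 2 ≤ α) :
    1 / (n : ℝ) ^ (α * (s : ℝ)) ≤ (1 / √(n : ℝ)) ^ s := by
  have hn' : (1 : ℝ) ≤ n := by exact_mod_cast hn
  rw [div_pow, one_pow]
  refine one_div_le_one_div_of_le (by positivity) ?_
  rw [Real.sqrt_eq_rpow, ← Real.rpow_natCast, ← Real.rpow_mul (by positivity)]
  exact Real.rpow_le_rpow_of_exponent_le hn' (by gcongr)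

theorem prod_edgeEntry {I : Type*} [Fintype I] (a : TriangularScheme Ω) (n : ℕ)
    (f : I → Sym2 (Fin n)) (ω : Ω) :
    ∏ i, edgeEntry a n (f i) ω = ∏ e ∈ univ.image f, edgeEntry a n e ω ^ mult f e := by
  rw [Finset.prod_comp (fun e => edgeEntry a n e ω) f]
  refine Finset.prod_congr rfl fun e _ => ?_
  unfold mult
  congr!

namespace AlmostUncorrelatedWith

variable {μ : Measure Ω} {a : TriangularScheme Ω} {α : ℝ} {K : ℕ → ℝ} {C : ℕ → ℕ → ℝ}

theorem finset_moment (h : AlmostUncorrelatedWith μ a α K C) {n : ℕ} (F : Finset (Sym2 (Fin n)))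
    (hF : F.Nonempty) (δ : Sym2 (Fin n) → ℕ) (hδ : ∀ e ∈ F, 1 ≤ δ e) :
    Integrable (fun ω => ∏ e ∈ F, edgeEntry a n e ω ^ δ e) μ ∧
      |∫ ω, ∏ e ∈ F, edgeEntry a n e ω ^ δ e ∂μ| ≤
        K (∑ e ∈ F, δ e) / (n : ℝ) ^ (α * ((F.filter fun e => δ e = 1).card : ℝ)) := by
  let σ := F.equivFin.symm
  have hinj : Function.Injective fun i => (σ i : Sym2 (Fin n)) :=
    Subtype.val_injective.comp σ.injective
  have := h.aau1 n F.card (Finset.card_pos.2 hF) _ (fundamentallyDifferent_out hinj)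
    (fun i => δ (σ i)) (fun i => hδ _ (σ i).2)
  have h1 : ∀ ω, ∏ i, edgeEntry a n (σ i) ω ^ δ (σ i) = ∏ e ∈ F, edgeEntry a n e ω ^ δ e := by
    intro ω
    rw [σ.prod_comp fun e : F => edgeEntry a n e ω ^ δ e,
      Finset.prod_coe_sort F fun e => edgeEntry a n e ω ^ δ e]
  have h2 : ∑ i, δ (σ i) = ∑ e ∈ F, δ e := by
    rw [σ.sum_comp fun e : F => δ e, Finset.sum_coe_sort F δ]
  have h3 : (univ.filter fun i => δ (σ i) = 1).card = (F.filter fun e => δ e = 1).card := by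
    rw [Finset.card_filter, Finset.card_filter, σ.sum_comp fun e : F => if δ e = 1 then 1 else 0,
      Finset.sum_coe_sort F fun e => if δ e = 1 then 1 else 0]
  simp only [edgeEntry_out, h1, h2, h3] at this
  exact this

theorem finset_sq (h : AlmostUncorrelatedWith μ a α K C) {n : ℕ} (F : Finset (Sym2 (Fin n)))
    (hF : F.Nonempty) :
    |(∫ ω, ∏ e ∈ F, edgeEntry a n e ω ^ 2 ∂μ) - 1| ≤ C F.card n := by
  let σ := F.equivFin.symm
  have hinj : Function.Injective fun i => (σ i : Sym2 (Fin n)) :=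
    Subtype.val_injective.comp σ.injective
  have := h.aau2 n F.card (Finset.card_pos.2 hF) _ (fundamentallyDifferent_out hinj)
  have h1 : ∀ ω, ∏ i, edgeEntry a n (σ i) ω ^ 2 = ∏ e ∈ F, edgeEntry a n e ω ^ 2 := by
    intro ω
    rw [σ.prod_comp fun e : F => edgeEntry a n e ω ^ 2,
      Finset.prod_coe_sort F fun e => edgeEntry a n e ω ^ 2]
  simp only [edgeEntry_out, h1] at this
  exact this

variable {I : Type*} [Fintype I] [Nonempty I]

/-- Grouping equal factors turns the product into one over distinct edges with the multiplicities as
exponents, to which `aau1` applies. -/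
theorem prod_moment (h : AlmostUncorrelatedWith μ a α K C) (hα : 1 / 2 ≤ α) {n : ℕ}
    (f : I → Sym2 (Fin n)) :
    Integrable (fun ω => ∏ i, edgeEntry a n (f i) ω) μ ∧
      |∫ ω, ∏ i, edgeEntry a n (f i) ω ∂μ| ≤
        |K (Fintype.card I)| * (1 / √(n : ℝ)) ^ singles f := by
  have hn : 1 ≤ n := by
    obtain ⟨i⟩ := ‹Nonempty I›
    have := (Quot.out (f i)).1.2
    omega
  have h1 := h.finset_moment (univ.image f) (univ_nonempty.image f) (mult f) (by
    intro e he
    obtain ⟨i, -, rfl⟩ := Finset.mem_image.1 he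
    exact mult_pos f i)
  simp only [prod_edgeEntry]
  refine ⟨h1.1, h1.2.trans ?_⟩
  rw [sum_mult, ← singles_eq, div_eq_mul_one_div]
  exact mul_le_mul (le_abs_self _) (one_div_rpow_le hn hα) (by positivity) (abs_nonneg _)

theorem prod_sq_moment (h : AlmostUncorrelatedWith μ a α K C) {n l : ℕ}
    (f : I → Sym2 (Fin n)) (hf : ∀ i, mult f (f i) = 2) (hl : Fintype.card I = 2 * l) :
    |(∫ ω, ∏ i, edgeEntry a n (f i) ω ∂μ) - 1| ≤ C l n := by
  have h1 := h.finset_sq (univ.image f) (univ_nonempty.image f)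
  have hm : ∀ e ∈ univ.image f, mult f e = 2 := by
    intro e he
    obtain ⟨i, -, rfl⟩ := Finset.mem_image.1 he
    exact hf i
  have hc : (univ.image f).card = l := by
    have := sum_mult f
    rw [Finset.sum_congr rfl hm, Finset.sum_const, smul_eq_mul] at this
    omega
  have h2 : ∀ ω, ∏ i, edgeEntry a n (f i) ω = ∏ e ∈ univ.image f, edgeEntry a n e ω ^ 2 := by
    intro ω
    rw [prod_edgeEntry]
    exact Finset.prod_congr rfl fun e he => by rw [hm e he]
  simp only [h2]
  rwa [hc] at h1

end AlmostUncorrelatedWith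

end Entries

/-! ### Spectral moments as good and bad walk sums -/

section WalkSum

variable {Ω : Type*} [MeasurableSpace Ω]

/-- The product of the matrix entries along a closed walk. -/
def walkWeight (a : TriangularScheme Ω) {n k : ℕ} [NeZero k] (t : Fin k → Fin n) (ω : Ω) : ℝ :=
  ∏ q, edgeEntry a n (stepEdge t q) ω

/-- The contribution of a set of closed walks to the `k`-th moment of the spectral distribution. -/
def walkSum (a : TriangularScheme Ω) (b n : ℕ) {k : ℕ} [NeZero k] (F : Finset (Fin k → Fin n))
    (ω : Ω) : ℝ := (1 / (n : ℝ)) * (1 / √(b : ℝ)) ^ k * ∑ t ∈ F, walkWeight a t ω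

/-- The closed walks of length `k` along the edges in `A` that are not good. -/
def badWalks {V : Type*} [Fintype V] (A : Set (Sym2 V)) (k : ℕ) [NeZero k] : Finset (Fin k → V) :=
  univ.filter fun t => ¬ IsGood t ∧ ∀ q, stepEdge t q ∈ A

theorem integral_esd {n : ℕ} {A : Matrix (Fin n) (Fin n) ℝ} (hA : A.IsHermitian) (f : ℝ → ℝ) :
    ∫ x, f x ∂(esd hA) = (1 / (n : ℝ)) * ∑ i, f (hA.eigenvalues i) := by
  unfold esd
  rw [integral_smul_measure, integral_finsetSum_measure]
  · simp [integral_dirac]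
  · intro i _
    exact integrable_dirac (by simp)

theorem bandMatrix_apply (a : TriangularScheme Ω) (b : ℕ → ℕ) (n : ℕ) (ω : Ω) (p q : Fin n) :
    bandMatrix a b n ω p q = (1 / √(b n : ℝ)) *
      (if s(p, q) ∈ bandEdges n (b n) then edgeEntry a n s(p, q) ω else 0) := by
  simp only [bandMatrix, Matrix.of_apply, mem_bandEdges, edgeEntry_mk]

theorem moment_bandESD (a : TriangularScheme Ω) (b : ℕ → ℕ) (n k : ℕ) [NeZero k] (ω : Ω) :
    ∫ x, x ^ k ∂(bandESD a b n ω) = walkSum a (b n) n (goodWalks (bandEdges n (b n)) k) ω +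
      walkSum a (b n) n (badWalks (bandEdges n (b n)) k) ω := by
  rw [bandESD, integral_esd, ← trace_pow_eq_sum_eigenvalues, trace_pow_eq_sum_walks]
  have h1 : ∀ t : Fin k → Fin n, ∏ q, bandMatrix a b n ω (t q) (t (q + 1)) =
      (1 / √(b n : ℝ)) ^ k * if ∀ q, stepEdge t q ∈ bandEdges n (b n) then walkWeight a t ω
        else 0 := by
    intro t
    simp only [bandMatrix_apply]
    rw [Finset.prod_mul_distrib, Finset.prod_const, Finset.card_univ, Fintype.card_fin,
      Finset.prod_ite_zero]
    congr 1
    by_cases hc : ∀ q, stepEdge t q ∈ bandEdges n (b n)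
    · rw [if_pos hc]
      exact if_pos fun q _ => hc q
    · rw [if_neg hc]
      exact if_neg fun h => hc fun q => h q (mem_univ q)
  simp only [h1, walkSum, ← Finset.mul_sum, ← mul_add, goodWalks, badWalks]
  rw [← Finset.sum_filter, ← Finset.sum_filter_add_sum_filter_not _ (fun t => IsGood t),
    Finset.filter_filter, Finset.filter_filter]
  simp only [and_comm, mul_assoc]

variable {μ : Measure Ω} {a : TriangularScheme Ω} {α : ℝ} {K : ℕ → ℝ} {C : ℕ → ℕ → ℝ}

/-- The walks that are not good contribute little to all moments. -/
theorem integral_badSum_pow_le (h : AlmostUncorrelatedWith μ a α K C) (hα : 1 / 2 ≤ α)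
    {b n : ℕ} (hb : IsBandwidth n b) (hb1 : 1 ≤ b) (k r : ℕ) [NeZero k] [NeZero r] :
    Integrable (fun ω => walkSum a b n (badWalks (bandEdges n b) k) ω ^ r) μ ∧
      |∫ ω, walkSum a b n (badWalks (bandEdges n b) k) ω ^ r ∂μ| ≤
        |K (r * k)| * ((r * k) ^ (r * k) : ℕ) * (1 / (b : ℝ)) ^ r := by
  set Bd := badWalks (bandEdges n b) k with hBd
  have hn : (0 : ℝ) < n := by have := hb.le; exact_mod_cast (by omega : 0 < n)
  set FT := Fintype.piFinset fun _ : Fin r => Bd with hFT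
  -- The power expands into a sum over `r`-tuples of bad walks; the prefactor `n^(-r)` then reduces
  -- the bound `(n/b)^r` to `b^(-r)`.
  have hexp : ∀ ω, walkSum a b n Bd ω ^ r = (1 / (n : ℝ)) ^ r * (1 / √(b : ℝ)) ^ (r * k) *
      ∑ T ∈ FT, ∏ i : Fin r × Fin k, edgeEntry a n (tupleEdge T i) ω := by
    intro ω
    unfold walkSum
    rw [mul_pow, mul_pow, ← pow_mul, mul_comm k r, Finset.sum_pow']
    congr 1
    refine Finset.sum_congr rfl fun T _ => ?_
    rw [Fintype.prod_prod_type]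
    rfl
  have hint : ∀ T ∈ FT, Integrable (fun ω => ∏ i, edgeEntry a n (tupleEdge T i) ω) μ := fun T _ =>
    (h.prod_moment hα (tupleEdge T)).1
  simp only [hexp]
  refine ⟨(integrable_finsetSum _ hint).const_mul _, ?_⟩
  rw [integral_const_mul, integral_finsetSum _ hint, abs_mul, abs_of_nonneg (by positivity)]
  have hsum := sum_tuple_le (V := Fin n) (A := bandEdges n b) (card_relevant hb) hb1
    (by simpa using hb.le) FT (by
      intro T hT
      have hT' : ∀ j, T j ∈ Bd := by simpa [hFT] using hT
      simp only [hBd, badWalks, mem_filter, mem_univ, true_and] at hT'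
      exact ⟨fun j => (hT' j).2, two_mul_card_vertices_le T fun j => (hT' j).1⟩)
  rw [Fintype.card_fin] at hsum
  calc _ ≤ (1 / (n : ℝ)) ^ r * (1 / √(b : ℝ)) ^ (r * k) *
        ∑ T ∈ FT, |K (r * k)| * (1 / √(n : ℝ)) ^ singles (tupleEdge T) := by
        gcongr
        refine (Finset.abs_sum_le_sum_abs _ _).trans (Finset.sum_le_sum fun T _ => ?_)
        simpa using (h.prod_moment hα (tupleEdge T)).2
    _ = |K (r * k)| * (1 / (n : ℝ)) ^ r * ((1 / √(b : ℝ)) ^ (r * k) *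
        ∑ T ∈ FT, (1 / √(n : ℝ)) ^ singles (tupleEdge T)) := by
        rw [← Finset.mul_sum]; ring
    _ ≤ |K (r * k)| * (1 / (n : ℝ)) ^ r * (((r * k) ^ (r * k) : ℕ) * ((n : ℝ) / b) ^ r) := by
        gcongr
    _ = _ := by
        simp only [div_pow, one_pow]
        field_simp

/-- The normalised number of good walks. -/
def goodCount (b n k : ℕ) [NeZero k] : ℝ :=
  (1 / (n : ℝ)) * (1 / √(b : ℝ)) ^ k * (goodWalks (bandEdges n b) k).card

theorem one_div_sqrt_pow_two_mul (b m : ℕ) : (1 / √(b : ℝ)) ^ (2 * m) = (1 / (b : ℝ)) ^ m := by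
  rw [pow_mul, div_pow, one_pow, Real.sq_sqrt (by positivity)]

theorem goodCount_nonneg (b n k : ℕ) [NeZero k] : 0 ≤ goodCount b n k := by
  unfold goodCount; positivity

theorem goodCount_le {b n k m : ℕ} [NeZero k] (hb : IsBandwidth n b) (hb1 : 1 ≤ b)
    (hk : k = 2 * m) : goodCount b n k ≤ catalan m := by
  have hn : (0 : ℝ) < n := by have := hb.le; exact_mod_cast (by omega : 0 < n)
  have hb0 : (0 : ℝ) < b := by exact_mod_cast hb1
  have h1 := card_goodWalks_le (V := Fin n) (A := bandEdges n b) (card_relevant hb) hk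
  rw [Fintype.card_fin] at h1
  have h2 : ((goodWalks (bandEdges n b) k).card : ℝ) ≤ catalan m * (n * b ^ m) := by
    exact_mod_cast h1
  unfold goodCount
  calc _ ≤ (1 / (n : ℝ)) * (1 / √(b : ℝ)) ^ k * (catalan m * (n * b ^ m)) := by gcongr
    _ = catalan m := by
      rw [hk, one_div_sqrt_pow_two_mul, div_pow, one_pow]
      field_simp

theorem le_goodCount {b n k m : ℕ} [NeZero k] (hb : IsBandwidth n b) (hb1 : 1 ≤ b)
    (hk : k = 2 * m) : (catalan m : ℝ) - catalan m * (k * k) / b ≤ goodCount b n k := by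
  have hn : (0 : ℝ) < n := by have := hb.le; exact_mod_cast (by omega : 0 < n)
  have hb0 : (0 : ℝ) < b := by exact_mod_cast hb1
  have h1 := le_card_goodWalks (V := Fin n) (A := bandEdges n b) (card_relevant hb) hk
  rw [Fintype.card_fin] at h1
  have h2 : (catalan m : ℝ) * (n * b ^ m) - catalan m * (k * k * (n * b ^ (m - 1))) ≤
      (goodWalks (bandEdges n b) k).card := by
    rw [sub_le_iff_le_add]
    exact_mod_cast h1
  -- Since `k ≠ 0`, also `m ≠ 0`, so the exponent `m - 1` is not truncated.
  obtain ⟨m, rfl⟩ : ∃ l, m = l + 1 := ⟨m - 1, by have := NeZero.pos k; omega⟩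
  unfold goodCount
  calc _ = (1 / (n : ℝ)) * (1 / √(b : ℝ)) ^ k * ((catalan (m + 1) : ℝ) * (n * b ^ (m + 1)) -
        catalan (m + 1) * (k * k * (n * b ^ (m + 1 - 1)))) := by
        rw [hk, one_div_sqrt_pow_two_mul, div_pow, one_pow, Nat.add_sub_cancel]
        field_simp
        ring
    _ ≤ _ := by gcongr

end WalkSum
end

noncomputable section

open scoped Classical
open Finset

/-! ### Sums over pairs of walks -/

section Pairs

theorem mult_eq_zero {I E : Type*} [Fintype I] {f : I → E} {e : E} (h : ∀ i, f i ≠ e) :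
    mult f e = 0 := by
  unfold mult
  rw [Finset.card_eq_zero, Finset.filter_eq_empty_iff]
  exact fun i _ => h i

theorem singles_eq_zero {I E : Type*} [Fintype I] {f : I → E} (h : ∀ i, mult f (f i) ≠ 1) :
    singles f = 0 := by
  unfold singles
  rw [Finset.card_eq_zero, Finset.filter_eq_empty_iff]
  intro e he
  obtain ⟨i, -, rfl⟩ := Finset.mem_image.1 he
  exact h i

/-- The walks `s` and `t` have a common edge. -/
def ShareEdge {V : Type*} {k : ℕ} [NeZero k] (s t : Fin k → V) : Prop :=
  ∃ q q', stepEdge s q = stepEdge t q'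

/-- A sum over pairs of walks whose terms are small for pairs without a common edge. -/
theorem abs_sum_pairs_le {b n k : ℕ} [NeZero k] (hb : IsBandwidth n b) (hb1 : 1 ≤ b)
    (F : Finset (Fin k → Fin n)) (hF : ∀ t ∈ F, ∀ q, stepEdge t q ∈ bandEdges n b)
    (c : (Fin k → Fin n) → (Fin k → Fin n) → ℝ) {M ε : ℝ} (hM : 0 ≤ M) (hε : 0 ≤ ε)
    (h1 : ∀ s ∈ F, ∀ t ∈ F, ShareEdge s t →
      |c s t| ≤ M * (1 / √(n : ℝ)) ^ singles (Sum.elim (stepEdge s) (stepEdge t)))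
    (h2 : ∀ s ∈ F, ∀ t ∈ F, ¬ ShareEdge s t → |c s t| ≤ ε) :
    ((1 / (n : ℝ)) * (1 / √(b : ℝ)) ^ k) ^ 2 * |∑ s ∈ F, ∑ t ∈ F, c s t| ≤
      M * (k * k * (k + k) ^ (k + k) : ℕ) * (1 / ((n : ℝ) * b)) +
        ε * ((1 / (n : ℝ)) * (1 / √(b : ℝ)) ^ k * F.card) ^ 2 := by
  have hn : (0 : ℝ) < n := by have := hb.le; exact_mod_cast (by omega : 0 < n)
  have hb0 : (0 : ℝ) < b := by exact_mod_cast hb1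
  set x := (1 / (n : ℝ)) * (1 / √(b : ℝ)) ^ k with hx
  set Sh := (F ×ˢ F).filter fun p => ShareEdge p.1 p.2 with hSh
  have hsh := sum_sharing_le (V := Fin n) (A := bandEdges n b) (card_relevant hb) hb1
    (by simpa using hb.le) Sh (by
      intro p hp
      simp only [hSh, mem_filter, mem_product] at hp
      exact ⟨hF _ hp.1.1, hF _ hp.1.2, hp.2⟩)
  rw [Fintype.card_fin] at hsh
  have hsum : |∑ s ∈ F, ∑ t ∈ F, c s t| ≤
      M * (∑ p ∈ Sh, (1 / √(n : ℝ)) ^ singles (Sum.elim (stepEdge p.1) (stepEdge p.2))) +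
        ε * (F.card : ℝ) ^ 2 := by
    rw [← Finset.sum_product', ← Finset.sum_filter_add_sum_filter_not (F ×ˢ F)
      fun p => ShareEdge p.1 p.2]
    refine (abs_add_le _ _).trans (add_le_add ?_ ?_)
    · rw [Finset.mul_sum]
      refine (Finset.abs_sum_le_sum_abs _ _).trans (Finset.sum_le_sum fun p hp => ?_)
      simp only [mem_filter, mem_product] at hp
      exact h1 _ hp.1.1 _ hp.1.2 hp.2
    · refine (Finset.abs_sum_le_sum_abs _ _).trans ?_
      refine (Finset.sum_le_card_nsmul _ _ ε fun p hp => ?_).trans ?_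
      · simp only [mem_filter, mem_product] at hp
        exact h2 _ hp.1.1 _ hp.1.2 hp.2
      · rw [nsmul_eq_mul, mul_comm]
        gcongr
        have := Finset.card_filter_le (F ×ˢ F) fun p => ¬ ShareEdge p.1 p.2
        rw [Finset.card_product] at this
        rw [sq]
        exact_mod_cast this
  calc _ ≤ x ^ 2 * (M * (∑ p ∈ Sh, (1 / √(n : ℝ)) ^
          singles (Sum.elim (stepEdge p.1) (stepEdge p.2))) + ε * (F.card : ℝ) ^ 2) := by gcongr
    _ = M * (1 / (n : ℝ)) ^ 2 * ((1 / √(b : ℝ)) ^ (k + k) * ∑ p ∈ Sh,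
          (1 / √(n : ℝ)) ^ singles (Sum.elim (stepEdge p.1) (stepEdge p.2))) +
        ε * (x * F.card) ^ 2 := by
        rw [hx, pow_add]; ring
    _ ≤ M * (1 / (n : ℝ)) ^ 2 * ((k * k * (k + k) ^ (k + k) : ℕ) * ((n : ℝ) / b)) +
        ε * (x * F.card) ^ 2 := by gcongr
    _ = _ := by
        congr 1
        field_simp

end Pairs

/-! ### Mean square error of the good part -/

section Variance

variable {Ω : Type*} [MeasurableSpace Ω] {μ : Measure Ω}
  {a : TriangularScheme Ω} {α : ℝ} {K : ℕ → ℝ} {C : ℕ → ℕ → ℝ}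

theorem walkWeight_mul (a : TriangularScheme Ω) {n k : ℕ} [NeZero k] (s t : Fin k → Fin n)
    (ω : Ω) : walkWeight a s ω * walkWeight a t ω =
      ∏ i, edgeEntry a n (Sum.elim (stepEdge s) (stepEdge t) i) ω := by
  rw [Fintype.prod_sum_type]
  rfl

theorem mult_pair_of_not_shareEdge {V : Type*} {k : ℕ} [NeZero k] {s t : Fin k → V}
    (hs : IsGood s) (ht : IsGood t) (h : ¬ ShareEdge s t) (i : Fin k ⊕ Fin k) :
    mult (Sum.elim (stepEdge s) (stepEdge t)) (Sum.elim (stepEdge s) (stepEdge t) i) = 2 := by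
  rw [mult_sum_elim]
  rcases i with q | q
  · simp only [Sum.elim_inl]
    rw [hs.2 q, mult_eq_zero fun q' he => h ⟨q, q', he.symm⟩]
  · simp only [Sum.elim_inr]
    rw [ht.2 q, mult_eq_zero fun q' he => h ⟨q', q, he⟩]

theorem singles_pair_eq_zero {V : Type*} {k : ℕ} [NeZero k] {s t : Fin k → V}
    (hs : IsGood s) (ht : IsGood t) :
    singles (Sum.elim (stepEdge s) (stepEdge t)) = 0 := by
  refine singles_eq_zero fun i => ?_
  rw [mult_sum_elim]
  rcases i with q | q
  · simp only [Sum.elim_inl]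
    rw [hs.2 q]
    omega
  · simp only [Sum.elim_inr]
    rw [ht.2 q]
    omega

theorem AlmostUncorrelatedWith.integrable_walkWeight (h : AlmostUncorrelatedWith μ a α K C)
    (hα : 1 / 2 ≤ α) {n k : ℕ} [NeZero k] (t : Fin k → Fin n) :
    Integrable (walkWeight a t) μ := (h.prod_moment hα (stepEdge t)).1

theorem AlmostUncorrelatedWith.integrable_walkWeight_mul (h : AlmostUncorrelatedWith μ a α K C)
    (hα : 1 / 2 ≤ α) {n k : ℕ} [NeZero k] (s t : Fin k → Fin n) :
    Integrable (fun ω => walkWeight a s ω * walkWeight a t ω) μ := by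
  simp only [walkWeight_mul]
  exact (h.prod_moment hα _).1

theorem one_div_sqrt_pow_le_one (n s : ℕ) : (1 / √(n : ℝ)) ^ s ≤ 1 := by
  rcases Nat.eq_zero_or_pos n with rfl | hn
  · simpa using pow_le_one₀ (n := s) (le_refl (0 : ℝ)) zero_le_one
  · refine pow_le_one₀ (by positivity) ?_
    have : (1 : ℝ) ≤ n := by exact_mod_cast hn
    rw [div_le_one (by positivity)]
    exact Real.one_le_sqrt.2 this

theorem AlmostUncorrelatedWith.abs_integral_walkWeight_le (h : AlmostUncorrelatedWith μ a α K C)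
    (hα : 1 / 2 ≤ α) {n k : ℕ} [NeZero k] (t : Fin k → Fin n) :
    |∫ ω, walkWeight a t ω ∂μ| ≤ |K k| * (1 / √(n : ℝ)) ^ singles (stepEdge t) := by
  have := (h.prod_moment hα (stepEdge t)).2
  rw [Fintype.card_fin] at this
  exact this

theorem AlmostUncorrelatedWith.abs_integral_walkWeight_mul_le
    (h : AlmostUncorrelatedWith μ a α K C) (hα : 1 / 2 ≤ α) {n k : ℕ} [NeZero k]
    (s t : Fin k → Fin n) :
    |∫ ω, walkWeight a s ω * walkWeight a t ω ∂μ| ≤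
      |K (k + k)| * (1 / √(n : ℝ)) ^ singles (Sum.elim (stepEdge s) (stepEdge t)) := by
  simp only [walkWeight_mul]
  simpa using (h.prod_moment hα (Sum.elim (stepEdge s) (stepEdge t))).2

variable [IsProbabilityMeasure μ]

/-- A quadratic expansion of a centred walk sum. -/
theorem integral_sq_walkSum_sub {b n k : ℕ} [NeZero k] (F : Finset (Fin k → Fin n))
    (v : (Fin k → Fin n) → ℝ)
    (h1 : ∀ t : Fin k → Fin n, Integrable (walkWeight a t) μ)
    (h2 : ∀ s t : Fin k → Fin n, Integrable (fun ω => walkWeight a s ω * walkWeight a t ω) μ) :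
    Integrable (fun ω => (walkSum a b n F ω -
      (1 / (n : ℝ)) * (1 / √(b : ℝ)) ^ k * ∑ t ∈ F, v t) ^ 2) μ ∧
    ∫ ω, (walkSum a b n F ω - (1 / (n : ℝ)) * (1 / √(b : ℝ)) ^ k * ∑ t ∈ F, v t) ^ 2 ∂μ =
      ((1 / (n : ℝ)) * (1 / √(b : ℝ)) ^ k) ^ 2 * ∑ s ∈ F, ∑ t ∈ F,
        ((∫ ω, walkWeight a s ω * walkWeight a t ω ∂μ) - v t * ∫ ω, walkWeight a s ω ∂μ -
          v s * (∫ ω, walkWeight a t ω ∂μ) + v s * v t) := by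
  have hexp : ∀ ω, (walkSum a b n F ω - (1 / (n : ℝ)) * (1 / √(b : ℝ)) ^ k * ∑ t ∈ F, v t) ^ 2 =
      ((1 / (n : ℝ)) * (1 / √(b : ℝ)) ^ k) ^ 2 * ∑ s ∈ F, ∑ t ∈ F,
        (walkWeight a s ω * walkWeight a t ω - v t * walkWeight a s ω -
          v s * walkWeight a t ω + v s * v t) := by
    intro ω
    unfold walkSum
    rw [← mul_sub, ← Finset.sum_sub_distrib, mul_pow, sq (∑ t ∈ F, _), Finset.sum_mul_sum]
    congr 1
    refine Finset.sum_congr rfl fun s _ => Finset.sum_congr rfl fun t _ => ?_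
    ring
  have hint : ∀ s t : Fin k → Fin n, Integrable (fun ω => walkWeight a s ω * walkWeight a t ω -
      v t * walkWeight a s ω - v s * walkWeight a t ω + v s * v t) μ := fun s t =>
    (((h2 s t).sub ((h1 s).const_mul _)).sub ((h1 t).const_mul _)).add (integrable_const _)
  simp only [hexp]
  constructor
  · exact (integrable_finsetSum _ fun s _ => integrable_finsetSum _ fun t _ => hint s t).const_mul _
  · rw [integral_const_mul, integral_finsetSum _ fun s _ => integrable_finsetSum _ fun t _ =>
      hint s t]
    congr 1
    refine Finset.sum_congr rfl fun s _ => ?_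
    rw [integral_finsetSum _ fun t _ => hint s t]
    refine Finset.sum_congr rfl fun t _ => ?_
    rw [integral_add, integral_sub, integral_sub, integral_const_mul, integral_const_mul]
    · simp
    · exact h2 s t
    · exact (h1 s).const_mul _
    · exact (h2 s t).sub ((h1 s).const_mul _)
    · exact (h1 t).const_mul _
    · exact ((h2 s t).sub ((h1 s).const_mul _)).sub ((h1 t).const_mul _)
    · exact integrable_const _

/-- The contribution of the good walks is close to their number. -/
theorem integral_goodSum_sub_sq_le (h : AlmostUncorrelatedWith μ a α K C) (hα : 1 / 2 ≤ α)
    {b n : ℕ} (hb : IsBandwidth n b) (hb1 : 1 ≤ b) {k m : ℕ} [NeZero k] (hk : k = 2 * m) :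
    Integrable (fun ω => (walkSum a b n (goodWalks (bandEdges n b) k) ω - goodCount b n k) ^ 2) μ ∧
      ∫ ω, (walkSum a b n (goodWalks (bandEdges n b) k) ω - goodCount b n k) ^ 2 ∂μ ≤
        (|K (k + k)| + 2 * |K k| + 1) * (k * k * (k + k) ^ (k + k) : ℕ) * (1 / ((n : ℝ) * b)) +
          (|C k n| + 2 * |C m n|) * (catalan m : ℝ) ^ 2 := by
  set F := goodWalks (bandEdges n b) k with hF
  obtain ⟨h1, h2⟩ := integral_sq_walkSum_sub (μ := μ) (a := a) (b := b) F (fun _ => 1)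
    (h.integrable_walkWeight hα) (h.integrable_walkWeight_mul hα)
  have hg : (1 / (n : ℝ)) * (1 / √(b : ℝ)) ^ k * ∑ t ∈ F, (1 : ℝ) = goodCount b n k := by
    simp [goodCount, hF]
  rw [hg] at h1 h2
  refine ⟨h1, ?_⟩
  have hnn := integral_nonneg (μ := μ)
    (f := fun ω => (walkSum a b n F ω - goodCount b n k) ^ 2) fun ω => sq_nonneg _
  rw [h2] at hnn ⊢
  rw [← abs_of_nonneg hnn, abs_mul, abs_of_nonneg (by positivity)]
  refine (abs_sum_pairs_le hb hb1 F (fun t ht => (mem_goodWalks.1 ht).2) _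
    (M := |K (k + k)| + 2 * |K k| + 1) (ε := |C k n| + 2 * |C m n|) (by positivity) (by positivity)
    ?_ ?_).trans ?_
  · intro s hs t ht _
    have hs := (mem_goodWalks.1 hs).1
    have ht := (mem_goodWalks.1 ht).1
    have e1 := h.abs_integral_walkWeight_mul_le hα s t
    have e2 := (h.abs_integral_walkWeight_le hα s).trans
      (mul_le_of_le_one_right (abs_nonneg _) (one_div_sqrt_pow_le_one _ _))
    have e3 := (h.abs_integral_walkWeight_le hα t).trans
      (mul_le_of_le_one_right (abs_nonneg _) (one_div_sqrt_pow_le_one _ _))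
    rw [singles_pair_eq_zero hs ht, pow_zero, mul_one] at e1 ⊢
    rw [abs_le] at e1 e2 e3 ⊢
    constructor <;> linarith [e1.1, e1.2, e2.1, e2.2, e3.1, e3.2]
  -- The term is `(E[w_s w_t] - 1) - (E[w_s] - 1) - (E[w_t] - 1)`, and `aau2` applies to each
  -- bracket, with `k`, `m` and `m` distinct edges.
  · intro s hs t ht hst
    have hs := (mem_goodWalks.1 hs).1
    have ht := (mem_goodWalks.1 ht).1
    have e1 := h.prod_sq_moment (l := k) (Sum.elim (stepEdge s) (stepEdge t))
      (mult_pair_of_not_shareEdge hs ht hst) (by simp; ring)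
    simp only [← walkWeight_mul] at e1
    have e2 := h.prod_sq_moment (l := m) (stepEdge s) hs.2 (by simpa using hk)
    have e3 := h.prod_sq_moment (l := m) (stepEdge t) ht.2 (by simpa using hk)
    have e1 := e1.trans (le_abs_self _)
    have e2 := e2.trans (le_abs_self _)
    have e3 := e3.trans (le_abs_self _)
    change |(∫ ω, walkWeight a s ω ∂μ) - 1| ≤ _ at e2
    change |(∫ ω, walkWeight a t ω ∂μ) - 1| ≤ _ at e3
    rw [abs_le] at e1 e2 e3 ⊢
    constructor <;> linarith [e1.1, e1.2, e2.1, e2.2, e3.1, e3.2]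
  · have : (1 / (n : ℝ)) * (1 / √(b : ℝ)) ^ k * F.card = goodCount b n k := rfl
    rw [this]
    gcongr
    · exact goodCount_nonneg _ _ _
    · exact goodCount_le hb hb1 hk

end Variance

/-! ### Wigner schemes -/

section Wigner

variable {Ω : Type*} [MeasurableSpace Ω] {μ : Measure Ω}
  {a : TriangularScheme Ω}

theorem measurable_edgeEntry (a : TriangularScheme Ω) (n : ℕ) (e : Sym2 (Fin n)) :
    Measurable (edgeEntry a n e) := by
  have : edgeEntry a n e = a.entry n (Quot.out e).1 (Quot.out e).2 :=
    funext fun ω => (edgeEntry_out a n e ω).symm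
  rw [this]
  exact a.measurable_entry _ _ _

theorem IsWignerScheme.iIndepFun_edgeEntry (h : IsWignerScheme μ a) (n : ℕ) :
    iIndepFun (fun e : Sym2 (Fin n) => edgeEntry a n e) μ := by
  have := (h.indep n).precomp (g := Sym2.sortEquiv) Sym2.sortEquiv.injective
  convert this using 2 with e
  funext ω
  rw [← edgeEntry_mk]
  congr 1
  induction e with
  | _ x y => rw [Sym2.sortEquiv_apply_coe]; rcases le_total x y with h | h <;> simp [h, Sym2.eq_swap]

theorem IsWignerScheme.integral_sq (h : IsWignerScheme μ a) (n : ℕ) (i j : Fin n) :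
    ∫ ω, a.entry n i j ω ^ 2 ∂μ = 1 := by
  have := h.variance_one n i j
  rw [variance_eq_integral (a.measurable_entry n i j).aemeasurable, h.mean_zero] at this
  simpa using this

/-- Replace each `|x i|` by the largest one; this elementary bound plays the role of Hölder's
inequality. -/
theorem prod_abs_pow_le_sum {ι : Type*} [Fintype ι] [Nonempty ι] (x : ι → ℝ) (δ : ι → ℕ) :
    |∏ i, x i ^ δ i| ≤ ∑ i, |x i| ^ (∑ j, δ j) := by
  obtain ⟨i₀, -, h⟩ := Finset.exists_max_image univ (fun i => |x i|) univ_nonempty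
  rw [Finset.abs_prod]
  calc ∏ i, |x i ^ δ i| ≤ ∏ i, |x i₀| ^ δ i := by
        refine Finset.prod_le_prod (fun i _ => abs_nonneg _) fun i hi => ?_
        rw [abs_pow]
        exact pow_le_pow_left₀ (abs_nonneg _) (h i hi) _
    _ = |x i₀| ^ (∑ j, δ j) := Finset.prod_pow_eq_pow_sum _ _ _
    _ ≤ _ := Finset.single_le_sum (f := fun i => |x i| ^ (∑ j, δ j))
        (fun i _ => by positivity) (mem_univ i₀)

/-- Wigner schemes are almost uncorrelated. -/
theorem IsWignerScheme.almostUncorrelatedWith (h : IsWignerScheme μ a) :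
    ∃ K, AlmostUncorrelatedWith μ a (1 / 2) K fun _ _ => 0 := by
  have hB : ∀ p : ℕ, ∃ B : ℝ, 1 ≤ p → 0 < B ∧ ∀ n i j,
      Integrable (fun ω => |a.entry n i j ω| ^ p) μ ∧ ∫ ω, |a.entry n i j ω| ^ p ∂μ ≤ B := by
    intro p
    by_cases hp : 1 ≤ p
    · obtain ⟨B, hB⟩ := h.moments p hp
      exact ⟨B, fun _ => hB⟩
    · exact ⟨0, fun h => absurd h hp⟩
  choose B hB using hB
  have hprod : ∀ (n l : ℕ) (P : Fin l → Fin n × Fin n), FundamentallyDifferent P →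
      ∀ δ : Fin l → ℕ, ∫ ω, ∏ i, a.entry n (P i).1 (P i).2 ω ^ δ i ∂μ =
        ∏ i, ∫ ω, a.entry n (P i).1 (P i).2 ω ^ δ i ∂μ := by
    intro n l P hP δ
    have hinj : Function.Injective fun i => s((P i).1, (P i).2) := by
      intro i j hij
      by_contra hne
      exact hP i j hne hij
    have h1 := (h.iIndepFun_edgeEntry n).precomp hinj
    have h2 := h1.comp (fun i x => x ^ δ i) fun i => by fun_prop
    exact h2.integral_fun_prod_eq_prod_integral fun i =>
      ((a.measurable_entry n (P i).1 (P i).2).pow_const _).aestronglyMeasurable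
  -- The sum of `l` absolute moments of order `L = ∑ δ i` is at most `l * B L`, and `l ≤ L` because
  -- all exponents are positive. By independence products of squares have expectation exactly `1`,
  -- whence the zero constants.
  refine ⟨fun s => s * B s, by norm_num, fun _ _ => tendsto_const_nhds, ?_, ?_⟩
  · intro n l hl P hP δ hδ
    have : Nonempty (Fin l) := ⟨⟨0, hl⟩⟩
    set L := ∑ i, δ i with hL
    have hlL : l ≤ L := by
      have := Finset.card_nsmul_le_sum univ δ 1 fun i _ => hδ i
      simpa using this
    obtain ⟨hBpos, hBL⟩ := hB L (hl.trans hlL)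
    have hsumint : Integrable (fun ω => ∑ i, |a.entry n (P i).1 (P i).2 ω| ^ L) μ :=
      integrable_finsetSum _ fun i _ => (hBL n (P i).1 (P i).2).1
    have hint : Integrable (fun ω => ∏ i, a.entry n (P i).1 (P i).2 ω ^ δ i) μ := by
      refine hsumint.mono' ?_ (Eventually.of_forall fun ω => ?_)
      · exact (Finset.measurable_prod _ fun i _ =>
          (a.measurable_entry n (P i).1 (P i).2).pow_const _).aestronglyMeasurable
      · exact prod_abs_pow_le_sum _ _
    refine ⟨hint, ?_⟩
    by_cases hs : ∃ i, δ i = 1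
    · obtain ⟨i, hi⟩ := hs
      rw [hprod n l P hP, Finset.prod_eq_zero (mem_univ i) (by simp [hi, h.mean_zero]), abs_zero]
      positivity
    · have h0 : (univ.filter fun i => δ i = 1).card = 0 := by
        rw [Finset.card_eq_zero, Finset.filter_eq_empty_iff]
        exact fun i _ hi => hs ⟨i, hi⟩
      rw [h0, Nat.cast_zero, mul_zero, Real.rpow_zero, div_one]
      calc |∫ ω, ∏ i, a.entry n (P i).1 (P i).2 ω ^ δ i ∂μ|
          ≤ ∫ ω, |∏ i, a.entry n (P i).1 (P i).2 ω ^ δ i| ∂μ := abs_integral_le_integral_abs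
        _ ≤ ∫ ω, ∑ i, |a.entry n (P i).1 (P i).2 ω| ^ L ∂μ :=
            integral_mono hint.abs hsumint fun ω => prod_abs_pow_le_sum _ _
        _ = ∑ i, ∫ ω, |a.entry n (P i).1 (P i).2 ω| ^ L ∂μ :=
            integral_finsetSum _ fun i _ => (hBL n (P i).1 (P i).2).1
        _ ≤ ∑ i : Fin l, B L := Finset.sum_le_sum fun i _ => (hBL n (P i).1 (P i).2).2
        _ = l * B L := by simp
        _ ≤ L * B L := by gcongr
  · intro n l hl P hP
    rw [hprod n l P hP fun _ => 2]
    simp [h.integral_sq]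

theorem IsWignerScheme.integral_walkWeight_mul (h : IsWignerScheme μ a) {n k : ℕ} [NeZero k]
    (s t : Fin k → Fin n) (hst : ¬ ShareEdge s t) :
    ∫ ω, walkWeight a s ω * walkWeight a t ω ∂μ =
      (∫ ω, walkWeight a s ω ∂μ) * ∫ ω, walkWeight a t ω ∂μ := by
  set S := univ.image (stepEdge s) with hS
  set T := univ.image (stepEdge t) with hT
  have hdisj : Disjoint S T := by
    rw [Finset.disjoint_left]
    intro e hs ht
    obtain ⟨q, -, hq⟩ := Finset.mem_image.1 hs
    obtain ⟨q', -, hq'⟩ := Finset.mem_image.1 ht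
    exact hst ⟨q, q', hq.trans hq'.symm⟩
  have h1 := (h.iIndepFun_edgeEntry n).indepFun_finset S T hdisj (measurable_edgeEntry a n)
  have h2 := h1.comp
    (φ := fun x : S → ℝ => ∏ q, x ⟨stepEdge s q, mem_image_of_mem _ (mem_univ q)⟩)
    (ψ := fun x : T → ℝ => ∏ q, x ⟨stepEdge t q, mem_image_of_mem _ (mem_univ q)⟩)
    (Finset.measurable_prod _ fun q _ => measurable_pi_apply _)
    (Finset.measurable_prod _ fun q _ => measurable_pi_apply _)
  have hm : ∀ u : Fin k → Fin n, Measurable (walkWeight a u) := fun u =>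
    Finset.measurable_prod _ fun q _ => measurable_edgeEntry a n _
  exact IndepFun.integral_fun_mul_eq_mul_integral (X := walkWeight a s) (Y := walkWeight a t) h2
    (hm s).aestronglyMeasurable (hm t).aestronglyMeasurable

/-- An edge used once by the pair is used once by one walk and not at all by the other. Hence the
product of the two separate bounds is dominated by the bound for the pair. -/
theorem singles_pair_le {V : Type*} {k : ℕ} [NeZero k] (s t : Fin k → V) :
    singles (Sum.elim (stepEdge s) (stepEdge t)) ≤ singles (stepEdge s) + singles (stepEdge t) := by
  unfold singles
  refine le_trans (Finset.card_le_card ?_) (Finset.card_union_le _ _)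
  intro e he
  simp only [mem_filter, mem_image, mem_univ, true_and, mem_union] at he ⊢
  obtain ⟨⟨i, rfl⟩, h1⟩ := he
  rw [mult_sum_elim] at h1
  rcases i with q | q
  · left
    have := mult_pos (stepEdge s) q
    simp only [Sum.elim_inl] at h1 ⊢
    exact ⟨⟨q, rfl⟩, by omega⟩
  · right
    have := mult_pos (stepEdge t) q
    simp only [Sum.elim_inr] at h1 ⊢
    exact ⟨⟨q, rfl⟩, by omega⟩

variable [IsProbabilityMeasure μ]

/-- For Wigner schemes the variance of the spectral moments is of order `1 / (n b)`. -/
theorem IsWignerScheme.integral_walkSum_sub_sq_le (h : IsWignerScheme μ a) {K : ℕ → ℝ}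
    {C : ℕ → ℕ → ℝ} (hK : AlmostUncorrelatedWith μ a (1 / 2) K C) {b n : ℕ}
    (hb : IsBandwidth n b) (hb1 : 1 ≤ b) {k : ℕ} [NeZero k] (F : Finset (Fin k → Fin n))
    (hF : ∀ t ∈ F, ∀ q, stepEdge t q ∈ bandEdges n b) :
    Integrable (fun ω => (walkSum a b n F ω - ∫ ω', walkSum a b n F ω' ∂μ) ^ 2) μ ∧
      ∫ ω, (walkSum a b n F ω - ∫ ω', walkSum a b n F ω' ∂μ) ^ 2 ∂μ ≤
        (|K (k + k)| + |K k| * |K k|) * (k * k * (k + k) ^ (k + k) : ℕ) * (1 / ((n : ℝ) * b)) := by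
  have hα : (1 : ℝ) / 2 ≤ 1 / 2 := le_rfl
  obtain ⟨h1, h2⟩ := integral_sq_walkSum_sub (μ := μ) (a := a) (b := b) F
    (fun t => ∫ ω, walkWeight a t ω ∂μ)
    (hK.integrable_walkWeight hα) (hK.integrable_walkWeight_mul hα)
  have hg : ∫ ω', walkSum a b n F ω' ∂μ =
      (1 / (n : ℝ)) * (1 / √(b : ℝ)) ^ k * ∑ t ∈ F, ∫ ω, walkWeight a t ω ∂μ := by
    unfold walkSum
    rw [integral_const_mul, integral_finsetSum _ fun t _ => hK.integrable_walkWeight hα t]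
  rw [hg]
  refine ⟨h1, ?_⟩
  have hnn := integral_nonneg (μ := μ)
    (f := fun ω => (walkSum a b n F ω -
      (1 / (n : ℝ)) * (1 / √(b : ℝ)) ^ k * ∑ t ∈ F, ∫ ω, walkWeight a t ω ∂μ) ^ 2)
    fun ω => sq_nonneg _
  rw [h2] at hnn ⊢
  rw [← abs_of_nonneg hnn, abs_mul, abs_of_nonneg (by positivity)]
  refine (abs_sum_pairs_le hb hb1 F hF _
    (M := |K (k + k)| + |K k| * |K k|) (ε := 0) (by positivity) le_rfl ?_ ?_).trans (by simp)
  · intro s _ t _ _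
    have e1 := hK.abs_integral_walkWeight_mul_le hα s t
    have e2 := hK.abs_integral_walkWeight_le hα s
    have e3 := hK.abs_integral_walkWeight_le hα t
    have e4 : |(∫ ω, walkWeight a s ω ∂μ) * ∫ ω, walkWeight a t ω ∂μ| ≤ |K k| * |K k| *
        (1 / √(n : ℝ)) ^ singles (Sum.elim (stepEdge s) (stepEdge t)) := by
      rw [abs_mul]
      refine (mul_le_mul e2 e3 (abs_nonneg _) (by positivity)).trans ?_
      rw [mul_mul_mul_comm, ← pow_add]
      gcongr ?_ * ?_
      exact pow_le_pow_of_le_one (by positivity) (by simpa using one_div_sqrt_pow_le_one n 1)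
        (singles_pair_le s t)
    rw [add_mul]
    rw [abs_le] at e1 e4 ⊢
    constructor <;> linarith [e1.1, e1.2, e4.1, e4.2]
  -- Walks without a common edge have independent weights, so their covariance vanishes.
  · intro s _ t _ hst
    rw [h.integral_walkWeight_mul s t hst]
    apply le_of_eq
    rw [abs_eq_zero]
    ring

end Wigner
end

noncomputable section

open Finset

/-! ### Moments of the semicircle distribution -/

section Semicircle

/-- The density of the semicircle distribution on `[-2, 2]`. -/
def semicircleDensity (x : ℝ) : ℝ := 1 / (2 * Real.pi) * √(4 - x ^ 2)

theorem continuous_semicircleDensity : Continuous semicircleDensity := by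
  unfold semicircleDensity
  fun_prop

theorem semicircleDensity_nonneg (x : ℝ) : 0 ≤ semicircleDensity x := by
  unfold semicircleDensity
  positivity

theorem integral_semicircle (f : ℝ → ℝ) :
    ∫ x, f x ∂semicircle = ∫ x in (-2 : ℝ)..2, semicircleDensity x * f x := by
  unfold semicircle
  rw [integral_withDensity_eq_integral_toReal_smul₀]
  · rw [intervalIntegral.integral_of_le (by norm_num), ← integral_Icc_eq_integral_Ioc,
      ← integral_indicator measurableSet_Icc]
    congr 1
    funext x
    by_cases hx : x ∈ Set.Icc (-2 : ℝ) 2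
    · rw [Set.indicator_of_mem hx, Set.indicator_of_mem hx]
      exact congrArg (· * f x) (ENNReal.toReal_ofReal (semicircleDensity_nonneg x))
    · simp [Set.indicator_of_notMem hx]
  · exact (ENNReal.measurable_ofReal.comp (continuous_semicircleDensity.measurable.indicator
      measurableSet_Icc)).aemeasurable
  · exact Eventually.of_forall fun x => ENNReal.ofReal_lt_top

theorem integral_semicircleDensity : ∫ x in (-2 : ℝ)..2, semicircleDensity x = 1 := by
  unfold semicircleDensity
  rw [intervalIntegral.integral_const_mul]
  have h1 := intervalIntegral.mul_integral_comp_mul_left (a := -1) (b := 1)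
    (f := fun x : ℝ => √(4 - x ^ 2)) (2 : ℝ)
  have h2 : ∀ x : ℝ, √(4 - (2 * x) ^ 2) = 2 * √(1 - x ^ 2) := by
    intro x
    rw [show (4 : ℝ) - (2 * x) ^ 2 = 2 ^ 2 * (1 - x ^ 2) by ring,
      Real.sqrt_mul (by norm_num), Real.sqrt_sq (by norm_num)]
  simp only [h2, intervalIntegral.integral_const_mul, integral_sqrt_one_sub_sq] at h1
  norm_num at h1
  rw [← h1]
  have := Real.pi_pos
  field_simp

theorem ae_mem_Icc_semicircle : ∀ᵐ x ∂semicircle, x ∈ Set.Icc (-2 : ℝ) 2 := by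
  rw [ae_iff]
  change semicircle (Set.Icc (-2 : ℝ) 2)ᶜ = 0
  unfold semicircle
  rw [withDensity_apply _ measurableSet_Icc.compl]
  refine (setLIntegral_congr_fun measurableSet_Icc.compl fun x hx => ?_).trans
    (lintegral_zero (μ := volume.restrict _))
  simp [Set.indicator_of_notMem hx]

instance isProbabilityMeasure_semicircle : IsProbabilityMeasure semicircle := by
  have hint : IntegrableOn semicircleDensity (Set.Icc (-2) 2) :=
    continuous_semicircleDensity.integrableOn_Icc
  refine ⟨?_⟩
  unfold semicircle
  rw [withDensity_apply _ MeasurableSet.univ, Measure.restrict_univ,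
    ← ofReal_integral_eq_lintegral_ofReal]
  · rw [integral_indicator measurableSet_Icc, integral_Icc_eq_integral_Ioc,
      ← intervalIntegral.integral_of_le (by norm_num)]
    have := integral_semicircleDensity
    unfold semicircleDensity at this
    rw [this, ENNReal.ofReal_one]
  · exact (integrable_indicator_iff measurableSet_Icc).2 hint
  · exact Eventually.of_forall fun x =>
      Set.indicator_nonneg (fun x _ => semicircleDensity_nonneg x) x

theorem integrable_semicircle {f : ℝ → ℝ} (hf : Continuous f) : Integrable f semicircle := by
  obtain ⟨B, hB⟩ := isCompact_Icc.exists_bound_of_continuousOn (s := Set.Icc (-2 : ℝ) 2)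
    hf.continuousOn
  refine Integrable.of_bound hf.aestronglyMeasurable B ?_
  filter_upwards [ae_mem_Icc_semicircle] with x hx using hB x hx

theorem hasDerivAt_four_sub_sq_mul_sqrt {x : ℝ} (hx : x ∈ Set.Ioo (-2 : ℝ) 2) :
    HasDerivAt (fun x : ℝ => (4 - x ^ 2) * √(4 - x ^ 2)) (-3 * x * √(4 - x ^ 2)) x := by
  have hpos : 0 < 4 - x ^ 2 := by nlinarith [hx.1, hx.2]
  have h1 : HasDerivAt (fun x : ℝ => 4 - x ^ 2) (-(2 * x)) x := by
    simpa using (hasDerivAt_pow 2 x).const_sub 4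
  refine (h1.mul (h1.sqrt hpos.ne')).congr_deriv ?_
  have hs : √(4 - x ^ 2) ≠ 0 := (Real.sqrt_pos.2 hpos).ne'
  field_simp
  rw [Real.sq_sqrt hpos.le]
  ring

/-- Integrate the derivative of `x^(k+1) (4 - x²)^(3/2)`, a function that vanishes at `±2`. -/
theorem semicircle_moment_recursion (k : ℕ) :
    ((k : ℝ) + 4) * ∫ x, x ^ (k + 2) ∂semicircle = 4 * (k + 1) * ∫ x, x ^ k ∂semicircle := by
  have hcont : Continuous fun x : ℝ => x ^ (k + 1) * ((4 - x ^ 2) * √(4 - x ^ 2)) := by fun_prop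
  have hcont' : Continuous fun x : ℝ =>
      4 * (k + 1) * (√(4 - x ^ 2) * x ^ k) - (k + 4) * (√(4 - x ^ 2) * x ^ (k + 2)) := by fun_prop
  have hftc := intervalIntegral.integral_eq_sub_of_hasDerivAt_of_le (a := -2) (b := 2)
    (by norm_num) hcont.continuousOn (f' := fun x : ℝ =>
      4 * (k + 1) * (√(4 - x ^ 2) * x ^ k) - (k + 4) * (√(4 - x ^ 2) * x ^ (k + 2))) (by
        intro x hx
        refine ((hasDerivAt_pow (k + 1) x).mul (hasDerivAt_four_sub_sq_mul_sqrt hx)).congr_deriv ?_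
        push_cast
        ring) (hcont'.intervalIntegrable _ _)
  rw [intervalIntegral.integral_sub, intervalIntegral.integral_const_mul,
    intervalIntegral.integral_const_mul] at hftc
  · norm_num at hftc
    simp only [integral_semicircle, semicircleDensity, mul_assoc,
      intervalIntegral.integral_const_mul]
    linear_combination (-(1 / (2 * Real.pi))) * hftc
  · exact Continuous.intervalIntegrable (by fun_prop) _ _
  · exact Continuous.intervalIntegrable (by fun_prop) _ _

theorem semicircle_moment_one : ∫ x, x ^ 1 ∂semicircle = 0 := by
  have hcont : Continuous fun x : ℝ => (4 - x ^ 2) * √(4 - x ^ 2) := by fun_prop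
  have hcont' : Continuous fun x : ℝ => -3 * x * √(4 - x ^ 2) := by fun_prop
  have hftc := intervalIntegral.integral_eq_sub_of_hasDerivAt_of_le (a := -2) (b := 2)
    (by norm_num) hcont.continuousOn (fun x hx => hasDerivAt_four_sub_sq_mul_sqrt hx)
    (hcont'.intervalIntegrable _ _)
  norm_num at hftc
  rw [integral_semicircle]
  have : ∀ x : ℝ, semicircleDensity x * x ^ 1 = (-1 / (6 * Real.pi)) * (-(3 * x * √(4 - x ^ 2))) := by
    intro x
    have := Real.pi_pos
    unfold semicircleDensity
    field_simp
    ring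
  simp only [this, intervalIntegral.integral_const_mul]
  rw [intervalIntegral.integral_neg, hftc]
  simp

theorem semicircle_moment_even (m : ℕ) : ∫ x, x ^ (2 * m) ∂semicircle = catalan m := by
  induction m with
  | zero => simp
  | succ m ih =>
    have h1 := semicircle_moment_recursion (2 * m)
    rw [ih] at h1
    have h2 := succ_mul_catalan_eq_centralBinom m
    have h3 := succ_mul_catalan_eq_centralBinom (m + 1)
    have h4 := Nat.succ_mul_centralBinom_succ m
    rw [← h2, ← h3] at h4
    have h5 : ((m : ℝ) + 1) * ((m + 1 + 1) * catalan (m + 1)) =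
        2 * (2 * m + 1) * ((m + 1) * catalan m) := by exact_mod_cast h4
    rw [show 2 * (m + 1) = 2 * m + 2 by ring]
    push_cast at h1
    have hm : (0 : ℝ) < m + 1 := by positivity
    have h6 : ((m : ℝ) + 2) * catalan (m + 1) = 2 * (2 * m + 1) * catalan m :=
      mul_left_cancel₀ hm.ne' (by linear_combination h5)
    have h7 : (0 : ℝ) < 2 * m + 4 := by positivity
    exact mul_left_cancel₀ h7.ne' (by linear_combination h1 - 2 * h6)

theorem semicircle_moment_odd (m : ℕ) : ∫ x, x ^ (2 * m + 1) ∂semicircle = 0 := by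
  induction m with
  | zero => exact semicircle_moment_one
  | succ m ih =>
    have h1 := semicircle_moment_recursion (2 * m + 1)
    rw [ih, mul_zero] at h1
    rw [show 2 * (m + 1) + 1 = 2 * m + 1 + 2 by ring]
    exact (mul_eq_zero.1 h1).resolve_left (by positivity)

end Semicircle

/-! ### Closeness of moments implies closeness of integrals -/

section MethodOfMoments

open Polynomial

theorem abs_eval_le_of_one_le (p : ℝ[X]) {x : ℝ} (hx : 1 ≤ |x|) :
    |p.eval x| ≤ (∑ i ∈ range (p.natDegree + 1), |p.coeff i|) * |x| ^ p.natDegree := by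
  rw [Polynomial.eval_eq_sum_range, Finset.sum_mul]
  refine (Finset.abs_sum_le_sum_abs _ _).trans (Finset.sum_le_sum fun i hi => ?_)
  rw [abs_mul, abs_pow]
  gcongr
  exact Nat.lt_succ_iff.1 (mem_range.1 hi)

theorem abs_integral_polynomial_sub_le (ν : Measure ℝ) (hν : ∀ k : ℕ, Integrable (fun x => x ^ k) ν)
    (p : ℝ[X]) {δ : ℝ} (h : ∀ k ≤ p.natDegree, |∫ x, x ^ k ∂ν - ∫ x, x ^ k ∂semicircle| ≤ δ) :
    |∫ x, p.eval x ∂ν - ∫ x, p.eval x ∂semicircle| ≤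
      (∑ i ∈ range (p.natDegree + 1), |p.coeff i|) * δ := by
  simp only [Polynomial.eval_eq_sum_range]
  rw [integral_finsetSum _ fun i _ => (hν i).const_mul _,
    integral_finsetSum _ fun i _ => (integrable_semicircle (continuous_pow i)).const_mul _,
    ← Finset.sum_sub_distrib, Finset.sum_mul]
  refine (Finset.abs_sum_le_sum_abs _ _).trans (Finset.sum_le_sum fun i hi => ?_)
  rw [integral_const_mul, integral_const_mul, ← mul_sub, abs_mul]
  gcongr
  exact h i (Nat.lt_succ_iff.1 (mem_range.1 hi))

/-- A probability measure whose first moments are close to those of the semicircle distribution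
integrates a given test function almost like it. -/
theorem exists_moments_close (f : ℝ →ᵇ ℝ) {ε : ℝ} (hε : 0 < ε) :
    ∃ (N : ℕ) (δ : ℝ), 0 < δ ∧ ∀ ν : Measure ℝ, IsProbabilityMeasure ν →
      (∀ k : ℕ, Integrable (fun x => x ^ k) ν) →
      (∀ k ≤ N, |∫ x, x ^ k ∂ν - ∫ x, x ^ k ∂semicircle| ≤ δ) →
      |∫ x, f x ∂ν - ∫ x, f x ∂semicircle| < ε := by
  -- The errors used below are `2η` (from `f` to `p` under `ν`), `η` (moments of `p`) and `η` (from
  -- `p` to `f` under the semicircle law), in total `4η < ε`.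
  set η := ε / 5 with hη
  have hη0 : 0 < η := by positivity
  obtain ⟨p, hp⟩ := exists_polynomial_near_of_continuousOn (-3) 3 f f.continuous.continuousOn η hη0
  set d := p.natDegree with hd
  set c := ∑ i ∈ range (d + 1), |p.coeff i| with hc
  have hc0 : 0 ≤ c := Finset.sum_nonneg fun _ _ => abs_nonneg _
  set A := (‖f‖ + c) * 3 ^ d with hA
  have hA0 : 0 ≤ A := by positivity
  -- Outside `[-3, 3]` the error is dominated by `A * (x/3)^(2M)`. A `2M`-th moment of at most `4^M
  -- + 1` makes its integral small, as `3` exceeds the radius `2` of the support.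
  have hlim : Tendsto (fun M : ℕ => A * ((4 / 9 : ℝ) ^ M + (1 / 9 : ℝ) ^ M)) atTop (𝓝 0) := by
    have h1 := tendsto_pow_atTop_nhds_zero_of_lt_one (r := (4 / 9 : ℝ)) (by norm_num) (by norm_num)
    have h2 := tendsto_pow_atTop_nhds_zero_of_lt_one (r := (1 / 9 : ℝ)) (by norm_num) (by norm_num)
    simpa using (h1.add h2).const_mul A
  obtain ⟨M, hM, hMd⟩ := ((hlim.eventually (gt_mem_nhds hη0)).and (eventually_ge_atTop d)).exists
  have hpt : ∀ x : ℝ, |f x - p.eval x| ≤ η + A * (1 / 9 : ℝ) ^ M * x ^ (2 * M) := by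
    intro x
    by_cases hx : |x| ≤ 3
    · have := hp x (abs_le.1 hx)
      rw [abs_sub_comm] at this
      refine this.le.trans (le_add_of_nonneg_right ?_)
      have : 0 ≤ x ^ (2 * M) := (even_two_mul M).pow_nonneg x
      positivity
    · have hx3 : 3 ≤ |x| := (not_le.1 hx).le
      have h1 : |f x| ≤ ‖f‖ * |x| ^ d := by
        refine (f.norm_coe_le_norm x).trans (le_mul_of_one_le_right (norm_nonneg _) ?_)
        exact one_le_pow₀ (by linarith)
      have h2 := abs_eval_le_of_one_le p (x := x) (by linarith)
      have h3 : |x| ^ d ≤ 3 ^ d * ((1 / 9 : ℝ) ^ M * x ^ (2 * M)) := by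
        have h9 : (1 / 9 : ℝ) ^ M * x ^ (2 * M) = (|x| / 3) ^ (2 * M) := by
          rw [pow_mul, pow_mul, div_pow |x| 3, sq_abs, ← mul_pow]
          congr 1
          ring
        rw [h9]
        calc |x| ^ d = 3 ^ d * (|x| / 3) ^ d := by rw [← mul_pow]; congr 1; ring
          _ ≤ _ := by
            gcongr
            · rw [le_div_iff₀ (by norm_num)]; linarith
            · omega
      calc |f x - p.eval x| ≤ |f x| + |p.eval x| := abs_sub _ _
        _ ≤ (‖f‖ + c) * |x| ^ d := by rw [add_mul]; exact add_le_add h1 h2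
        _ ≤ (‖f‖ + c) * (3 ^ d * ((1 / 9 : ℝ) ^ M * x ^ (2 * M))) := by gcongr
        _ = A * (1 / 9 : ℝ) ^ M * x ^ (2 * M) := by rw [hA]; ring
        _ ≤ _ := le_add_of_nonneg_left hη0.le
  have hf_int : ∀ ν : Measure ℝ, IsProbabilityMeasure ν → Integrable f ν := fun ν _ =>
    f.integrable ν
  have hσ : |∫ x, f x ∂semicircle - ∫ x, p.eval x ∂semicircle| ≤ η := by
    rw [← integral_sub (hf_int _ inferInstance) (integrable_semicircle p.continuous)]
    have := norm_integral_le_of_norm_le_const (μ := semicircle)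
      (f := fun x => f x - p.eval x) (C := η) (by
        filter_upwards [ae_mem_Icc_semicircle] with x hx
        have := hp x ⟨by linarith [hx.1], by linarith [hx.2]⟩
        rw [Real.norm_eq_abs, abs_sub_comm]
        exact this.le)
    simpa using this
  have hmom : ∫ x, x ^ (2 * M) ∂semicircle ≤ 4 ^ M := by
    have := norm_integral_le_of_norm_le_const (μ := semicircle)
      (f := fun x => x ^ (2 * M)) (C := 4 ^ M) (by
        filter_upwards [ae_mem_Icc_semicircle] with x hx
        rw [norm_pow, pow_mul, Real.norm_eq_abs, sq_abs]
        refine pow_le_pow_left₀ (sq_nonneg _) ?_ _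
        nlinarith [hx.1, hx.2])
    refine (le_abs_self _).trans ?_
    simpa using this
  -- The bound `1` keeps the `2M`-th moment below `4^M + 1`; the other bound controls the integral
  -- of `p`, where `c + 1` guards against `c = 0`.
  refine ⟨max d (2 * M), min 1 (η / (c + 1)), by positivity, fun ν hν hint hclose => ?_⟩
  have hpint : Integrable (fun x => p.eval x) ν := by
    simp only [Polynomial.eval_eq_sum_range]
    exact integrable_finsetSum _ fun i _ => (hint i).const_mul _
  have h1 : |∫ x, f x ∂ν - ∫ x, p.eval x ∂ν| ≤ 2 * η := by
    rw [← integral_sub (hf_int ν hν) hpint]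
    have hm := hclose (2 * M) (le_max_right _ _)
    have hm' : ∫ x, x ^ (2 * M) ∂ν ≤ 4 ^ M + 1 := by
      have := (abs_le.1 (hm.trans (min_le_left _ _))).2
      linarith
    calc |∫ x, (f x - p.eval x) ∂ν| ≤ ∫ x, |f x - p.eval x| ∂ν := abs_integral_le_integral_abs
      _ ≤ ∫ x, (η + A * (1 / 9 : ℝ) ^ M * x ^ (2 * M)) ∂ν :=
          integral_mono ((hf_int ν hν).sub hpint).abs
            ((integrable_const _).add ((hint _).const_mul _)) hpt
      _ = η + A * (1 / 9 : ℝ) ^ M * ∫ x, x ^ (2 * M) ∂ν := by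
          rw [integral_add (integrable_const _) ((hint _).const_mul _), integral_const_mul]
          simp
      _ ≤ η + A * (1 / 9 : ℝ) ^ M * (4 ^ M + 1) := by gcongr
      _ = η + A * ((4 / 9 : ℝ) ^ M + (1 / 9 : ℝ) ^ M) := by
          rw [show (4 / 9 : ℝ) = 1 / 9 * 4 by norm_num, mul_pow]; ring
      _ ≤ 2 * η := by linarith
  have h2 : |∫ x, p.eval x ∂ν - ∫ x, p.eval x ∂semicircle| ≤ η := by
    refine (abs_integral_polynomial_sub_le ν hint p fun k hk =>
      hclose k (hk.trans (le_max_left _ _))).trans ?_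
    calc c * min 1 (η / (c + 1)) ≤ (c + 1) * (η / (c + 1)) := by
          gcongr
          · linarith
          · exact min_le_right _ _
      _ = η := by field_simp
  rw [abs_le] at h1 h2 hσ
  rw [abs_lt]
  constructor <;> linarith [h1.1, h1.2, h2.1, h2.2, hσ.1, hσ.2]

end MethodOfMoments
end

noncomputable section

open Finset

/-! ### Reduction of the semicircle law to moments -/

section Reduction

variable {Ω : Type*} [MeasurableSpace Ω] {μ : Measure Ω} {a : TriangularScheme Ω} {b : ℕ → ℕ}

theorem isProbabilityMeasure_esd {n : ℕ} (hn : 1 ≤ n) {A : Matrix (Fin n) (Fin n) ℝ}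
    (hA : A.IsHermitian) : IsProbabilityMeasure (esd hA) := by
  refine ⟨?_⟩
  have h0 : (n : ℝ≥0∞) ≠ 0 := by exact_mod_cast (by omega : n ≠ 0)
  simp [esd, ENNReal.inv_mul_cancel h0 (ENNReal.natCast_ne_top n)]

theorem integrable_esd {n : ℕ} (hn : 1 ≤ n) {A : Matrix (Fin n) (Fin n) ℝ}
    (hA : A.IsHermitian) (f : ℝ → ℝ) : Integrable f (esd hA) := by
  have h0 : (n : ℝ≥0∞) ≠ 0 := by exact_mod_cast (by omega : n ≠ 0)
  unfold esd
  refine Integrable.smul_measure ?_ (ENNReal.inv_ne_top.2 h0)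
  exact integrable_finsetSum_measure.2 fun i _ => integrable_dirac (by simp)

theorem moment_zero_bandESD {n : ℕ} (hn : 1 ≤ n) (ω : Ω) :
    ∫ x, x ^ 0 ∂(bandESD a b n ω) = ∫ x, x ^ 0 ∂semicircle := by
  have := isProbabilityMeasure_esd hn (bandMatrix_isHermitian a b n ω)
  simp [bandESD]

theorem semicircleLawInProbability_of_moments
    (h : ∀ k : ℕ, k ≠ 0 → TendstoInMeasure μ (fun n ω => ∫ x, x ^ k ∂(bandESD a b n ω)) atTop
      fun _ => ∫ x, x ^ k ∂semicircle) : SemicircleLawInProbability μ a b := by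
  intro f
  rw [tendstoInMeasure_iff_norm]
  intro ε hε
  obtain ⟨N, δ, hδ, H⟩ := exists_moments_close f hε
  have hlim : Tendsto (fun n => ∑ k ∈ Finset.Icc 1 N,
      μ {ω | δ ≤ ‖∫ x, x ^ k ∂(bandESD a b n ω) - ∫ x, x ^ k ∂semicircle‖}) atTop (𝓝 0) := by
    rw [← Finset.sum_const_zero (s := Finset.Icc 1 N)]
    refine tendsto_finsetSum _ fun k hk => ?_
    have hk0 : k ≠ 0 := by have := (Finset.mem_Icc.1 hk).1; omega
    exact tendstoInMeasure_iff_norm.1 (h k hk0) δ hδ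
  refine tendsto_of_tendsto_of_tendsto_of_le_of_le' tendsto_const_nhds hlim
    (Eventually.of_forall fun _ => zero_le) ?_
  filter_upwards [eventually_ge_atTop 1] with n hn
  refine le_trans (measure_mono ?_) (measure_biUnion_finset_le _ _)
  intro ω hω
  by_contra hcon
  simp only [Set.mem_iUnion, not_exists] at hcon
  rw [Set.mem_ofPred_eq] at hω
  refine not_le.2 ?_ hω
  refine H _ (isProbabilityMeasure_esd hn _) (fun k => integrable_esd hn _ _) fun k hk => ?_
  rcases Nat.eq_zero_or_pos k with rfl | hk0
  · rw [moment_zero_bandESD hn, sub_self, abs_zero]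
    exact hδ.le
  · exact (not_le.1 (hcon k (Finset.mem_Icc.2 ⟨hk0, hk⟩))).le

theorem semicircleLawAlmostSurely_of_moments
    (h : ∀ k : ℕ, k ≠ 0 → ∀ᵐ ω ∂μ, Tendsto (fun n => ∫ x, x ^ k ∂(bandESD a b n ω)) atTop
      (𝓝 (∫ x, x ^ k ∂semicircle))) : SemicircleLawAlmostSurely μ a b := by
  intro f
  have hall : ∀ᵐ ω ∂μ, ∀ k : ℕ, k ≠ 0 → Tendsto (fun n => ∫ x, x ^ k ∂(bandESD a b n ω)) atTop
      (𝓝 (∫ x, x ^ k ∂semicircle)) := by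
    rw [ae_all_iff]
    intro k
    by_cases hk : k = 0
    · exact Eventually.of_forall fun ω h => absurd hk h
    · filter_upwards [h k hk] with ω hω using fun _ => hω
  filter_upwards [hall] with ω hω
  rw [Metric.tendsto_nhds]
  intro ε hε
  obtain ⟨N, δ, hδ, H⟩ := exists_moments_close f hε
  have hev : ∀ᶠ n in atTop, ∀ k ∈ Finset.Icc 1 N,
      |∫ x, x ^ k ∂(bandESD a b n ω) - ∫ x, x ^ k ∂semicircle| ≤ δ := by
    rw [Filter.eventually_all_finset]
    intro k hk
    have hk0 : k ≠ 0 := by have := (Finset.mem_Icc.1 hk).1; omega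
    filter_upwards [Metric.tendsto_nhds.1 (hω k hk0) δ hδ] with n hn
    rw [Real.dist_eq] at hn
    exact hn.le
  filter_upwards [eventually_ge_atTop 1, hev] with n hn hk
  rw [Real.dist_eq]
  refine H _ (isProbabilityMeasure_esd hn _) (fun k => integrable_esd hn _ _) fun k hkN => ?_
  rcases Nat.eq_zero_or_pos k with rfl | hk0
  · rw [moment_zero_bandESD hn, sub_self, abs_zero]
    exact hδ.le
  · exact hk k (Finset.mem_Icc.2 ⟨hk0, hkN⟩)

end Reduction

/-! ### Convergence from moment bounds -/

section Convergence

variable {Ω : Type*} [MeasurableSpace Ω] {μ : Measure Ω}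

/-- The series of the `W n ^ r` has finite expectation from some index on, so it converges almost
surely and its terms tend to zero. -/
theorem ae_tendsto_zero_of_summable_moments {W : ℕ → Ω → ℝ} {s : ℕ → ℝ} {r : ℕ} (hr : Even r)
    (hs : Summable s)
    (hW : ∀ᶠ n in atTop, Integrable (fun ω => W n ω ^ r) μ ∧ ∫ ω, W n ω ^ r ∂μ ≤ s n) :
    ∀ᵐ ω ∂μ, Tendsto (fun n => W n ω) atTop (𝓝 0) := by
  obtain ⟨N, hN⟩ := eventually_atTop.1 hW
  have hnn : ∀ n ω, 0 ≤ W n ω ^ r := fun n ω => hr.pow_nonneg _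
  set F : ℕ → Ω → ℝ≥0∞ := fun n ω => ENNReal.ofReal (W (n + N) ω ^ r) with hF
  have hmeas : ∀ n, AEMeasurable (F n) μ := fun n =>
    (hN (n + N) (by omega)).1.1.aemeasurable.ennreal_ofReal
  have hs' : Summable fun n => s (n + N) := (summable_nat_add_iff N).2 hs
  have hsum : ∑' n, ∫⁻ ω, F n ω ∂μ ≠ ∞ := by
    refine ne_top_of_le_ne_top (b := ∑' n, ENNReal.ofReal (s (n + N))) ?_ ?_
    · exact hs'.tsum_ofReal_ne_top
    · refine ENNReal.tsum_le_tsum fun n => ?_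
      rw [hF, ← ofReal_integral_eq_lintegral_ofReal (hN (n + N) (by omega)).1
        (Eventually.of_forall fun ω => hnn _ ω)]
      exact ENNReal.ofReal_le_ofReal (hN (n + N) (by omega)).2
  rw [← lintegral_tsum hmeas] at hsum
  filter_upwards [ae_lt_top' (AEMeasurable.tsum hmeas) hsum] with ω hω
  have h1 := ENNReal.tendsto_atTop_zero_of_tsum_ne_top hω.ne
  have h2 : Tendsto (fun n => W (n + N) ω ^ r) atTop (𝓝 0) := by
    have := (ENNReal.tendsto_toReal ENNReal.zero_ne_top).comp h1
    simpa [hF, Function.comp_def, ENNReal.toReal_ofReal (hnn _ _)] using this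
  rw [← tendsto_add_atTop_iff_nat N, Metric.tendsto_nhds]
  intro ε hε
  filter_upwards [Metric.tendsto_nhds.1 h2 (ε ^ r) (by positivity)] with n hn
  rw [dist_zero_right, norm_pow] at hn
  rw [dist_zero_right]
  exact lt_of_pow_lt_pow_left₀ r hε.le hn

/-- Chebyshev's inequality. -/
theorem tendsto_measure_of_sq [IsFiniteMeasure μ] {W : ℕ → Ω → ℝ} {s : ℕ → ℝ}
    (hs : Tendsto s atTop (𝓝 0))
    (hW : ∀ᶠ n in atTop, Integrable (fun ω => W n ω ^ 2) μ ∧ ∫ ω, W n ω ^ 2 ∂μ ≤ s n)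
    {ε : ℝ} (hε : 0 < ε) : Tendsto (fun n => μ {ω | ε ≤ |W n ω|}) atTop (𝓝 0) := by
  have hlim : Tendsto (fun n => ENNReal.ofReal (s n / ε ^ 2)) atTop (𝓝 0) := by
    have := ENNReal.tendsto_ofReal (hs.div_const (ε ^ 2))
    simpa using this
  refine tendsto_of_tendsto_of_tendsto_of_le_of_le' tendsto_const_nhds hlim
    (Eventually.of_forall fun _ => zero_le) ?_
  filter_upwards [hW] with n hn
  have h1 := mul_meas_ge_le_integral_of_nonneg (μ := μ) (f := fun ω => W n ω ^ 2)
    (Eventually.of_forall fun ω => sq_nonneg _) hn.1 (ε ^ 2)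
  have h2 : {ω | ε ≤ |W n ω|} ⊆ {ω | ε ^ 2 ≤ W n ω ^ 2} := by
    intro ω hω
    have : ε ≤ |W n ω| := hω
    change ε ^ 2 ≤ W n ω ^ 2
    rw [← sq_abs (W n ω)]
    exact pow_le_pow_left₀ hε.le this 2
  refine (measure_mono h2).trans ?_
  rw [ENNReal.le_ofReal_iff_toReal_le (measure_ne_top _ _), le_div_iff₀ (by positivity), mul_comm]
  · exact h1.trans hn.2
  · have : 0 ≤ ∫ ω, W n ω ^ 2 ∂μ := integral_nonneg fun ω => sq_nonneg _
    exact div_nonneg (this.trans hn.2) (by positivity)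

end Convergence

/-! ### The four modes of convergence -/

section Moments

variable {Ω : Type*} [MeasurableSpace Ω] {μ : Measure Ω} {a : TriangularScheme Ω} {b : ℕ → ℕ}
  {α : ℝ} {K : ℕ → ℝ} {C : ℕ → ℕ → ℝ}

theorem tendsto_one_div_bandwidth (hb_top : Tendsto b atTop atTop) :
    Tendsto (fun n => 1 / (b n : ℝ)) atTop (𝓝 0) :=
  tendsto_one_div_atTop_nhds_zero_nat.comp hb_top

theorem eventually_bandwidth (hb : ∀ n, 1 ≤ n → IsBandwidth n (b n))
    (hb_top : Tendsto b atTop atTop) :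
    ∀ᶠ n in atTop, IsBandwidth n (b n) ∧ 1 ≤ b n := by
  filter_upwards [eventually_ge_atTop 1, hb_top.eventually_ge_atTop 1] with n h1 h2
  exact ⟨hb n h1, h2⟩

theorem tendsto_goodCount (hb : ∀ n, 1 ≤ n → IsBandwidth n (b n))
    (hb_top : Tendsto b atTop atTop) (k : ℕ) [NeZero k] :
    Tendsto (fun n => goodCount (b n) n k) atTop (𝓝 (∫ x, x ^ k ∂semicircle)) := by
  rcases Nat.even_or_odd' k with ⟨m, hk | hk⟩
  · have h0 := tendsto_one_div_bandwidth hb_top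
    have h1 : Tendsto (fun n => (catalan m : ℝ) - catalan m * (k * k) / b n) atTop
        (𝓝 (catalan m)) := by
      have := (h0.const_mul ((catalan m : ℝ) * (k * k))).const_sub (catalan m : ℝ)
      simpa [div_eq_mul_inv] using this
    have h2 : ∫ x, x ^ k ∂semicircle = catalan m := by rw [hk, semicircle_moment_even]
    rw [h2]
    refine tendsto_of_tendsto_of_tendsto_of_le_of_le' h1 tendsto_const_nhds ?_ ?_
    · filter_upwards [eventually_bandwidth hb hb_top] with n hn using le_goodCount hn.1 hn.2 hk
    · filter_upwards [eventually_bandwidth hb hb_top] with n hn using goodCount_le hn.1 hn.2 hk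
  · have h2 : ∫ x, x ^ k ∂semicircle = 0 := by rw [hk, semicircle_moment_odd]
    rw [h2]
    have h3 : ∀ n, goodCount (b n) n k = 0 := by
      intro n
      simp [goodCount, goodWalks_eq_empty_of_odd ⟨m, hk⟩]
    simp [h3]

variable (a b) in
/-- The difference between the contribution of the good walks and their number. -/
def goodError (k : ℕ) [NeZero k] (n : ℕ) (ω : Ω) : ℝ :=
  walkSum a (b n) n (goodWalks (bandEdges n (b n)) k) ω - goodCount (b n) n k

variable (a b) in
/-- The contribution of the walks that are not good. -/
def badSum (k : ℕ) [NeZero k] (n : ℕ) (ω : Ω) : ℝ :=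
  walkSum a (b n) n (badWalks (bandEdges n (b n)) k) ω

theorem moment_eq (k n : ℕ) [NeZero k] (ω : Ω) :
    ∫ x, x ^ k ∂(bandESD a b n ω) = goodError a b k n ω + badSum a b k n ω + goodCount (b n) n k := by
  rw [moment_bandESD]
  unfold goodError badSum
  ring

theorem exists_goodError_bound [IsProbabilityMeasure μ] (h : AlmostUncorrelatedWith μ a α K C)
    (hα : 1 / 2 ≤ α) (hb : ∀ n, 1 ≤ n → IsBandwidth n (b n)) (hb_top : Tendsto b atTop atTop)
    (k : ℕ) [NeZero k] : ∃ (c : ℝ) (l l' : ℕ), 0 ≤ c ∧ 1 ≤ l ∧ 1 ≤ l' ∧ ∀ᶠ n in atTop,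
      Integrable (fun ω => goodError a b k n ω ^ 2) μ ∧
      ∫ ω, goodError a b k n ω ^ 2 ∂μ ≤
        c * (1 / ((n : ℝ) * b n)) + c * (|C l n| + |C l' n|) := by
  rcases Nat.even_or_odd' k with ⟨m, hk | hk⟩
  · have hk0 := NeZero.ne k
    refine ⟨max ((|K (k + k)| + 2 * |K k| + 1) * (k * k * (k + k) ^ (k + k) : ℕ))
      (2 * (catalan m : ℝ) ^ 2), k, m, by positivity, by omega, by omega, ?_⟩
    filter_upwards [eventually_bandwidth hb hb_top] with n hn
    obtain ⟨h1, h2⟩ := integral_goodSum_sub_sq_le h hα hn.1 hn.2 hk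
    refine ⟨h1, h2.trans ?_⟩
    gcongr ?_ * _ + ?_
    · exact le_max_left _ _
    · calc (|C k n| + 2 * |C m n|) * (catalan m : ℝ) ^ 2
          ≤ (2 * |C k n| + 2 * |C m n|) * (catalan m : ℝ) ^ 2 := by
            gcongr; linarith [abs_nonneg (C k n)]
        _ = (2 * (catalan m : ℝ) ^ 2) * (|C k n| + |C m n|) := by ring
        _ ≤ _ := by gcongr; exact le_max_right _ _
  · refine ⟨0, 1, 1, le_rfl, le_rfl, le_rfl, Eventually.of_forall fun n => ?_⟩
    simp [goodError, goodCount, walkSum, goodWalks_eq_empty_of_odd ⟨m, hk⟩]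

theorem badSum_bound (h : AlmostUncorrelatedWith μ a α K C)
    (hα : 1 / 2 ≤ α) (hb : ∀ n, 1 ≤ n → IsBandwidth n (b n)) (hb_top : Tendsto b atTop atTop)
    (k r : ℕ) [NeZero k] [NeZero r] : ∀ᶠ n in atTop,
      Integrable (fun ω => badSum a b k n ω ^ r) μ ∧
      |∫ ω, badSum a b k n ω ^ r ∂μ| ≤
        |K (r * k)| * ((r * k) ^ (r * k) : ℕ) * (1 / (b n : ℝ)) ^ r := by
  filter_upwards [eventually_bandwidth hb hb_top] with n hn using
    integral_badSum_pow_le h hα hn.1 hn.2 k r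

theorem one_div_mul_le_one_div_sq {n b : ℕ} (hb : b ≤ n) (hb1 : 1 ≤ b) :
    1 / ((n : ℝ) * b) ≤ 1 / (b : ℝ) ^ 2 := by
  have hb0 : (0 : ℝ) < b := by exact_mod_cast hb1
  refine one_div_le_one_div_of_le (by positivity) ?_
  rw [sq]
  gcongr

theorem tendsto_one_div_mul (hb : ∀ n, 1 ≤ n → IsBandwidth n (b n))
    (hb_top : Tendsto b atTop atTop) :
    Tendsto (fun n : ℕ => 1 / ((n : ℝ) * b n)) atTop (𝓝 0) := by
  have h0 := (tendsto_one_div_bandwidth hb_top).pow 2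
  simp only [div_pow, one_pow, ne_eq, OfNat.ofNat_ne_zero, not_false_eq_true, zero_pow] at h0
  refine tendsto_of_tendsto_of_tendsto_of_le_of_le' tendsto_const_nhds h0
    (Eventually.of_forall fun n => by positivity) ?_
  filter_upwards [eventually_bandwidth hb hb_top] with n hn
  exact one_div_mul_le_one_div_sq hn.1.le hn.2

theorem ae_tendsto_moment (hb : ∀ n, 1 ≤ n → IsBandwidth n (b n)) (hb_top : Tendsto b atTop atTop)
    (k : ℕ) [NeZero k] (hG : ∀ᵐ ω ∂μ, Tendsto (fun n => goodError a b k n ω) atTop (𝓝 0))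
    (hY : ∀ᵐ ω ∂μ, Tendsto (fun n => badSum a b k n ω) atTop (𝓝 0)) :
    ∀ᵐ ω ∂μ, Tendsto (fun n => ∫ x, x ^ k ∂(bandESD a b n ω)) atTop
      (𝓝 (∫ x, x ^ k ∂semicircle)) := by
  filter_upwards [hG, hY] with ω h1 h2
  simp only [moment_eq]
  simpa using (h1.add h2).add (tendsto_goodCount hb hb_top k)

theorem semicircleLawInProbability_of_almostUncorrelated [IsProbabilityMeasure μ]
    (h : AlmostUncorrelatedWith μ a α K C) (hα : 1 / 2 ≤ α)
    (hb : ∀ n, 1 ≤ n → IsBandwidth n (b n)) (hb_top : Tendsto b atTop atTop) :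
    SemicircleLawInProbability μ a b := by
  refine semicircleLawInProbability_of_moments fun k hk => ?_
  have : NeZero k := ⟨hk⟩
  obtain ⟨c, l, l', -, hl, hl', hG⟩ := exists_goodError_bound h hα hb hb_top k
  have hGlim : Tendsto (fun n : ℕ => c * (1 / ((n : ℝ) * b n)) + c * (|C l n| + |C l' n|)) atTop
      (𝓝 0) := by
    have h1 := (tendsto_one_div_mul hb hb_top).const_mul c
    have h2 := ((h.tendsto_C l hl).abs.add (h.tendsto_C l' hl').abs).const_mul c
    simpa using h1.add h2
  have hY := (badSum_bound h hα hb hb_top k 2).mono fun n hn => And.imp_right (le_of_abs_le) hn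
  have hYlim : Tendsto (fun n => |K (2 * k)| * ((2 * k) ^ (2 * k) : ℕ) * (1 / (b n : ℝ)) ^ 2)
      atTop (𝓝 0) := by
    simpa using ((tendsto_one_div_bandwidth hb_top).pow 2).const_mul
      (|K (2 * k)| * ((2 * k) ^ (2 * k) : ℕ))
  rw [tendstoInMeasure_iff_norm]
  intro ε hε
  have h1 := tendsto_measure_of_sq hGlim hG (ε := ε / 3) (by positivity)
  have h2 := tendsto_measure_of_sq hYlim hY (ε := ε / 3) (by positivity)
  have h3 := h1.add h2
  rw [add_zero] at h3
  refine tendsto_of_tendsto_of_tendsto_of_le_of_le' tendsto_const_nhds h3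
    (Eventually.of_forall fun _ => zero_le) ?_
  have hg := Metric.tendsto_nhds.1 (tendsto_goodCount hb hb_top k) (ε / 3) (by positivity)
  filter_upwards [hg] with n hn
  refine le_trans (measure_mono ?_) (measure_union_le _ _)
  intro ω hω
  by_contra hcon
  simp only [Set.mem_union, not_or] at hcon
  have e1 : |goodError a b k n ω| < ε / 3 := not_le.1 hcon.1
  have e2 : |badSum a b k n ω| < ε / 3 := not_le.1 hcon.2
  rw [Set.mem_ofPred_eq] at hω
  refine not_le.2 ?_ hω
  rw [Real.dist_eq] at hn
  rw [moment_eq, Real.norm_eq_abs]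
  rw [abs_lt] at e1 e2 hn ⊢
  constructor <;> linarith [e1.1, e1.2, e2.1, e2.2, hn.1, hn.2]

/-- A good walk uses each edge twice and all entries square to `1`, so its weight is identically
`1`. -/
theorem goodError_eq_zero_of_signValued (ha : SignValued a) (k n : ℕ) [NeZero k] (ω : Ω) :
    goodError a b k n ω = 0 := by
  have hsq : ∀ e, edgeEntry a n e ω ^ 2 = 1 := by
    intro e
    rw [← edgeEntry_out]
    rcases ha n (Quot.out e).1 (Quot.out e).2 ω with h | h <;> rw [h] <;> norm_num
  have h1 : ∀ t ∈ goodWalks (bandEdges n (b n)) k, walkWeight a t ω = 1 := by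
    intro t ht
    have hg := (mem_goodWalks.1 ht).1
    unfold walkWeight
    classical
    rw [prod_edgeEntry]
    refine Finset.prod_eq_one fun e he => ?_
    obtain ⟨q, -, rfl⟩ := Finset.mem_image.1 he
    rw [hg.2 q, hsq]
  unfold goodError walkSum goodCount
  rw [Finset.sum_congr rfl h1]
  simp

theorem semicircleLawAlmostSurely_of_signValued
    (h : AlmostUncorrelatedWith μ a α K C) (hα : 1 / 2 ≤ α)
    (hb : ∀ n, 1 ≤ n → IsBandwidth n (b n)) (hb_top : Tendsto b atTop atTop) (ha : SignValued a)
    (hs : Summable fun n => 1 / (b n : ℝ) ^ 3) : SemicircleLawAlmostSurely μ a b := by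
  refine semicircleLawAlmostSurely_of_moments fun k hk => ?_
  have : NeZero k := ⟨hk⟩
  refine ae_tendsto_moment hb hb_top k
    (Eventually.of_forall fun ω => by simp [goodError_eq_zero_of_signValued ha]) ?_
  -- The exponent must be even, and `b^(-4) ≤ b^(-3)`.
  refine ae_tendsto_zero_of_summable_moments (r := 4) (by decide)
    (hs.mul_left (|K (4 * k)| * ((4 * k) ^ (4 * k) : ℕ))) ?_
  filter_upwards [badSum_bound h hα hb hb_top k 4, eventually_bandwidth hb hb_top] with n hn hbn
  refine ⟨hn.1, (le_of_abs_le hn.2).trans ?_⟩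
  have hb1 : (1 : ℝ) ≤ b n := by exact_mod_cast hbn.2
  gcongr
  rw [div_pow, one_pow]
  exact one_div_le_one_div_of_le (by positivity) (pow_le_pow_right₀ hb1 (by norm_num))

/-- Second moments suffice for both parts: the bad one is `O(b^(-2))`, and the good error is `O(1/(n
b))` plus constants from `aau2`, where `1/(n b) ≤ b^(-2)`. -/
theorem semicircleLawAlmostSurely_of_summable [IsProbabilityMeasure μ]
    (h : AlmostUncorrelatedWith μ a α K C) (hα : 1 / 2 ≤ α)
    (hb : ∀ n, 1 ≤ n → IsBandwidth n (b n)) (hb_top : Tendsto b atTop atTop)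
    (hs : Summable fun n => 1 / (b n : ℝ) ^ 2) (hC : ∀ l, 1 ≤ l → Summable fun n => C l n) :
    SemicircleLawAlmostSurely μ a b := by
  refine semicircleLawAlmostSurely_of_moments fun k hk => ?_
  have : NeZero k := ⟨hk⟩
  obtain ⟨c, l, l', hc, hl, hl', hG⟩ := exists_goodError_bound h hα hb hb_top k
  refine ae_tendsto_moment hb hb_top k ?_ ?_
  · refine ae_tendsto_zero_of_summable_moments (r := 2) (by decide)
      ((hs.mul_left c).add (((hC l hl).abs.add (hC l' hl').abs).mul_left c)) ?_
    filter_upwards [hG, eventually_bandwidth hb hb_top] with n hn hbn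
    refine ⟨hn.1, hn.2.trans ?_⟩
    gcongr ?_ + _
    exact mul_le_mul_of_nonneg_left (one_div_mul_le_one_div_sq hbn.1.le hbn.2) hc
  · refine ae_tendsto_zero_of_summable_moments (r := 2) (by decide)
      (hs.mul_left (|K (2 * k)| * ((2 * k) ^ (2 * k) : ℕ))) ?_
    filter_upwards [badSum_bound h hα hb hb_top k 2] with n hn
    refine ⟨hn.1, (le_of_abs_le hn.2).trans (le_of_eq ?_)⟩
    rw [div_pow, one_pow]

theorem semicircleLawAlmostSurely_of_wigner [IsProbabilityMeasure μ] (h : IsWignerScheme μ a)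
    (hb : ∀ n, 1 ≤ n → IsBandwidth n (b n)) (hb_top : Tendsto b atTop atTop)
    (hs : Summable fun n : ℕ => 1 / ((n : ℝ) * (b n : ℝ))) : SemicircleLawAlmostSurely μ a b := by
  obtain ⟨K, hK⟩ := h.almostUncorrelatedWith
  refine semicircleLawAlmostSurely_of_moments fun k hk => ?_
  have : NeZero k := ⟨hk⟩
  refine ae_tendsto_moment hb hb_top k ?_ ?_
  · obtain ⟨c, l, l', hc, hl, hl', hG⟩ := exists_goodError_bound hK le_rfl hb hb_top k
    refine ae_tendsto_zero_of_summable_moments (r := 2) (by decide)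
      (hs.mul_left c) ?_
    filter_upwards [hG] with n hn
    simpa using hn
  -- The mean, of order `1/b`, need only tend to zero; summability is required of the variance
  -- alone, which is `O(1/(n b))`.
  · have hmean : Tendsto (fun n => ∫ ω, badSum a b k n ω ∂μ) atTop (𝓝 0) := by
      have hlim := (tendsto_one_div_bandwidth hb_top).const_mul
        (|K (1 * k)| * ((1 * k) ^ (1 * k) : ℕ))
      rw [mul_zero] at hlim
      refine squeeze_zero_norm' ?_ hlim
      filter_upwards [badSum_bound hK le_rfl hb hb_top k 1] with n hn
      simpa using hn.2
    have hcent : ∀ᵐ ω ∂μ, Tendsto (fun n => badSum a b k n ω - ∫ ω', badSum a b k n ω' ∂μ) atTop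
        (𝓝 0) := by
      refine ae_tendsto_zero_of_summable_moments (r := 2) (by decide)
        (hs.mul_left ((|K (k + k)| + |K k| * |K k|) * (k * k * (k + k) ^ (k + k) : ℕ))) ?_
      filter_upwards [eventually_bandwidth hb hb_top] with n hn
      exact h.integral_walkSum_sub_sq_le hK hn.1 hn.2 _ fun t ht => by
        simp only [badWalks, Finset.mem_filter] at ht
        exact ht.2.2
    filter_upwards [hcent] with ω hω
    simpa using hω.add hmean

end Moments
end

/-! ### The theorem -/

theorem theorem2p4 {Ω : Type*} [MeasurableSpace Ω] (μ : Measure Ω) [IsProbabilityMeasure μ]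
    (a : TriangularScheme Ω) (b : ℕ → ℕ) (hb : ∀ n, 1 ≤ n → IsBandwidth n (b n))
    (hb_top : Tendsto b atTop atTop) :
    (∀ α : ℝ, 1 / 2 ≤ α → AlmostUncorrelated μ a α → SemicircleLawInProbability μ a b) ∧
    (∀ α : ℝ, 1 / 2 ≤ α → AlmostUncorrelated μ a α → SignValued a →
      Summable (fun n => 1 / (b n : ℝ) ^ 3) → SemicircleLawAlmostSurely μ a b) ∧
    (∀ (α : ℝ) (K : ℕ → ℝ) (C D : ℕ → ℕ → ℝ), 1 / 2 < α →
      StronglyAlmostUncorrelatedWith μ a α K C D →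
      Summable (fun n => 1 / (b n : ℝ) ^ 2) →
      (∀ l, 1 ≤ l → Summable (fun n => 1 / (b n : ℝ) * D l n)) →
      (∀ l, 1 ≤ l → Summable (fun n => C l n)) →
      SemicircleLawAlmostSurely μ a b) ∧
    (IsWignerScheme μ a → Summable (fun n : ℕ => 1 / ((n : ℝ) * (b n : ℝ))) →
      SemicircleLawAlmostSurely μ a b) := by
  refine ⟨?_, ?_, ?_, ?_⟩
  · rintro α hα ⟨K, C, h⟩
    exact semicircleLawInProbability_of_almostUncorrelated h hα hb hb_top
  · rintro α hα ⟨K, C, h⟩ ha hs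
    exact semicircleLawAlmostSurely_of_signValued h hα hb hb_top ha hs
  · intro α K C D hα h hs _ hC
    exact semicircleLawAlmostSurely_of_summable h.toAlmostUncorrelatedWith hα.le hb hb_top hs hC
  · intro h hs
    exact semicircleLawAlmostSurely_of_wigner h hb hb_top hs
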